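/- **Setting.** A *seed* is a triangle in the Euclidean plane $\mathbb{E}^2$ (or an infinite region bounded by two parallel half-lines and a third side), together with a real skew-symmetric matrix $B=(b_{ij})$ indexed by the sides; the numbering of the sides is immaterial. Side $i$ is recorded by the affine function $v_i(x)=\langle a_i,x\rangle+c_i$ with $\langle a_i,a_i\rangle=2$ which is $0$ on the side and $\ge 0$ on the region; put $(v_i,v_j)=\langle a_i,a_j\rangle$. The *quiver* of the seed has the sides as vertices and an arrow $i\to j$ iff $b_{ij}>0$. Given a notion of positive affine functions, the mutation $\mu_k$ replaces $v_k$ by $-v_k$, replaces $v_i$ ($i\ne k$) by $v_i-(v_i,v_k)v_k$ if either $v_k$ is positive and $b_{ik}<0$, or $v_k$ is not positive and $b_{ik}>0$, keeps all other $v_i$, and replaces $B$ by $B'$ with $b'_{ij}=-b_{ij}$ if $k\in\{i,j\}$ and $b'_{ij}=b_{ij}+(b_{ik}|b_{kj}|+|b_{ik}|b_{kj})/2$ otherwise. Let $n\ge 2$ and $\alpha=\pi/2n$. Let $\Delta_0=A_1A_2A_3\subseteq\mathbb{E}^2$ be a triangle with angles $\alpha$, $(n-1)\alpha$, $n\alpha$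 at $A_1,A_2,A_3$, and let $a_i$ be the side opposite to $A_i$. The initial seed $(\mathbf{v}_0,B_0)$ is $\Delta_0$ with the quiver $a_1\to a_3\to a_2$, that is, $b_{13}=2\cos((n-1)\alpha)$, $b_{32}=2\cos\alpha$, $b_{12}=0$. Let $H$ be the foot of the altitude from $A_3$. The belt line $b$ is the line through $A_3$ and the mirror images of $H$ in $a_1$ and $a_2$ (these three points are collinear). An affine function $f$ is positive if $f>0$ at all points of $b$ sufficiently far in the direction from $A_3$ to the mirror image of $H$ in $a_2$ (the reference point lies infinitely far away on $b$ in the direction from the source to the sink). The exchange graph $\Gamma$ has as vertices the seeds obtained from $(\mathbf{v}_0,B_0)$ by finite sequences of mutations; two different vertices are adjacent iff they are related by one mutation. For $w\in\mathbb{E}^2$, the seed $w+(\mathbf{v},B)$ is obtained by translating the region by $w$ and keeping $B$. Let $L$ be the group of all $w\in\mathbb{E}^2$ such that $(\mathbf{v},B)\mapsto w+(\mathbf{v},B)$ is an automorphism of the graph $\Gamma$. **Theorem.** 1. Let $(n_1,n_2,n_3)$ be non-negative integers with $n_1+n_2+n_3=2n$ and $\gcd(n_1,n_2,n_3)=1$,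 and let $Q$ be a quiver with vertices $1,2,3$. Consider the vertices of $\Gamma$ whose sides can be numbered so that the quiver is $Q$ and the (finite or infinite) triangle has angle $n_i\alpha$ opposite to side $i$ for $i=1,2,3$ (an angle $0$ meaning that the two sides are parallel). These vertices lie in at most two $L$-orbits, one for each orientation: the sides $1,2,3$ follow each other counterclockwise or clockwise, and any two of these vertices with the same orientation differ by a translation by a vector in $L$. 2. $L$ is a finitely generated free abelian group, and $\operatorname{rk}_{\mathbb{Z}}(L)=\varphi(2n)/2$ or $\operatorname{rk}_{\mathbb{Z}}(L)=\varphi(2n)$, where $\varphi$ is Euler's totient function. 3. For every finite symmetric generating set $S\not\ni 0$ of $L$, the map $L\to\Gamma$, $w\mapsto w+(\mathbf{v}_0,B_0)$, is a quasi-isometry from the Cayley graph of $L$ with respect to $S$ to $\Gamma$, both with the path metric. -/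

import Mathlib

open scoped EuclideanGeometry

noncomputable section

/-- The Euclidean plane. -/
abbrev Plane : Type := EuclideanSpace ℝ (Fin 2)

/-- The three-dimensional real vector space of affine linear functions `x ↦ ⟪a, x⟫ + c` on the
plane; such a function is stored as the pair `(a, c)` of its linear part and its constant. -/
abbrev AffineForm : Type := Plane × ℝ

namespace AffineForm

/-- The value of an affine linear function at a point. -/
def eval (f : AffineForm) (x : Plane) : ℝ := inner ℝ f.1 x + f.2

/-- The degenerate symmetric bilinear form: the inner product of the linear parts. -/
def form (f g : AffineForm) : ℝ := inner ℝ f.1 g.1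

/-- The function `x ↦ f (x - w)`; its half-plane `f ≥ 0` is that of `f` translated by `w`. -/
def translate (w : Plane) (f : AffineForm) : AffineForm := (f.1, f.2 - inner ℝ f.1 w)

lemma translate_zero (f : AffineForm) : translate 0 f = f := by
  simp [translate]

lemma translate_translate (w z : Plane) (f : AffineForm) :
    translate w (translate z f) = translate (w + z) f := by
  simp only [translate, inner_add_right, Prod.mk.injEq, true_and]
  ring

end AffineForm

/-- A reference point lying infinitely far away on the line through `base` with direction `dir`,
at the end towards which `dir` points. -/
structure ReferencePoint where
  base : Plane
  dir : Plane

/-- `f` is positive if the reference point lies in the half-plane of `f`, i.e. `f` is positive at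
all points of the line that lie sufficiently far in the direction `dir`. (If `dir` is not parallel
to the boundary line of `f`, only the direction matters; otherwise this says that the
line lies in the half-plane of `f`.) -/
def ReferencePoint.IsPositive (u : ReferencePoint) (f : AffineForm) : Prop :=
  ∀ᶠ t : ℝ in Filter.atTop, 0 < f.eval (u.base + t • u.dir)

/-- A seed realised in the plane, with its sides labelled by `Fin 3`: three affine linear functions
(the domain of the seed is the intersection of their half-planes `v i ≥ 0`), and the exchange
matrix. Only seeds that arise by mutations from an honest geometric realisation are used below. -/
@[ext]
structure LabelledSeed where
  v : Fin 3 → AffineForm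
  B : Matrix (Fin 3) (Fin 3) ℝ

/-- Mutation of exchange matrices. -/
def mutateMatrix (k : Fin 3) (B : Matrix (Fin 3) (Fin 3) ℝ) : Matrix (Fin 3) (Fin 3) ℝ :=
  Matrix.of fun i j =>
    if k = i ∨ k = j then - B i j
    else B i j + (B i k * |B k j| + |B i k| * B k j) / 2

namespace LabelledSeed

open Classical in
/-- Mutation of seeds by partial reflections. -/
def mutate (u : ReferencePoint) (k : Fin 3) (s : LabelledSeed) : LabelledSeed where
  v := fun i =>
    if i = k then - s.v k
    else if (u.IsPositive (s.v k) ∧ s.B i k < 0) ∨ (¬ u.IsPositive (s.v k) ∧ 0 < s.B i k) then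
      s.v i - (s.v i).form (s.v k) • s.v k
    else s.v i
  B := mutateMatrix k s.B

/-- Translation of a seed: the triangle is translated, the exchange matrix is kept. -/
def translate (w : Plane) (s : LabelledSeed) : LabelledSeed where
  v := fun i => (s.v i).translate w
  B := s.B

/-- Renaming of the sides. -/
def relabel (σ : Equiv.Perm (Fin 3)) (s : LabelledSeed) : LabelledSeed where
  v := fun i => s.v (σ i)
  B := s.B.submatrix σ σ

/-- Labelled seeds that agree up to the numbering of their sides are identified. -/
instance setoid : Setoid LabelledSeed where
  r s t := ∃ σ : Equiv.Perm (Fin 3), t = s.relabel σ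
  iseqv :=
    { refl := fun s => ⟨1, rfl⟩
      symm := by
        rintro s t ⟨σ, rfl⟩
        refine ⟨σ⁻¹, ?_⟩
        ext <;> simp [relabel]
      trans := by
        rintro s t r ⟨σ, rfl⟩ ⟨τ, rfl⟩
        exact ⟨σ * τ, rfl⟩ }

/-- The quiver of a seed: its vertices are the sides, and there is an arrow `i ⟶ j` if and only if
the entry `B i j` is positive. -/
def quiver (s : LabelledSeed) : Digraph (Fin 3) where
  Adj i j := 0 < s.B i j

/-- The domain of a seed, the intersection of the three half-planes. -/
def domain (s : LabelledSeed) : Set Plane := {x | ∀ i, 0 ≤ (s.v i).eval x}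

/-- The interior angle of the domain opposite to the side `i`, i.e. between the two other sides.
As the linear parts of the affine functions are inward normals, it is the supplement of the angle
between the normals. It is `0` if these two sides are parallel. -/
def interiorAngle (s : LabelledSeed) (i : Fin 3) : ℝ :=
  Real.pi - InnerProductGeometry.angle (s.v (i + 1)).1 (s.v (i + 2)).1

/-- The determinant of two plane vectors. -/
def cross (a b : Plane) : ℝ := a 0 * b 1 - a 1 * b 0

/-- The orientation of a (finite or infinite) triangle with sides `0, 1, 2`: it is `1` if going
around the sides in this order is counterclockwise, and `-1` if it is clockwise. For a finite
triangle the three summands have the same sign. If two sides are parallel, one summand is `0`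
and the others have the same sign. -/
def orientation (s : LabelledSeed) : SignType :=
  SignType.sign (cross (s.v 0).1 (s.v 1).1 + cross (s.v 1).1 (s.v 2).1 + cross (s.v 2).1 (s.v 0).1)

end LabelledSeed

/-- A seed: a triangle (or infinite region) with a quiver whose vertices are the sides. -/
abbrev Seed : Type := Quotient LabelledSeed.setoid

namespace Seed

/-- Translation of seeds. -/
def translate (w : Plane) : Seed → Seed :=
  Quotient.map (LabelledSeed.translate w) (by
    rintro s t ⟨σ, rfl⟩
    exact ⟨σ, rfl⟩)

lemma translate_zero (x : Seed) : translate 0 x = x := by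
  induction x using Quotient.inductionOn with
  | h s =>
    refine congrArg (Quotient.mk _) ?_
    ext1
    · funext i
      exact AffineForm.translate_zero _
    · rfl

lemma translate_translate (w z : Plane) (x : Seed) :
    translate w (translate z x) = translate (w + z) x := by
  induction x using Quotient.inductionOn with
  | h s =>
    refine congrArg (Quotient.mk _) ?_
    ext1
    · funext i
      exact AffineForm.translate_translate _ _ _
    · rfl

/-- The seeds obtained from `s₀` by finite sequences of mutations. -/
def mutationClass (u : ReferencePoint) (s₀ : LabelledSeed) : Set Seed :=
  {x | ∃ s : LabelledSeed,
    Relation.ReflTransGen (fun s t => ∃ k, t = LabelledSeed.mutate u k s) s₀ s ∧ ⟦s⟧ = x}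

end Seed

/-- The exchange graph of `s₀`: its vertices are the seeds obtained from `s₀` by sequences of
mutations, and two different vertices are adjacent if they are related by a single mutation. -/
def exchangeGraph (u : ReferencePoint) (s₀ : LabelledSeed) :
    SimpleGraph (Seed.mutationClass u s₀) :=
  SimpleGraph.fromRel fun x y =>
    ∃ (s : LabelledSeed) (k : Fin 3), ⟦s⟧ = x.1 ∧ ⟦LabelledSeed.mutate u k s⟧ = y.1

/-- The lattice `L` of all vectors `w` such that the translation by `w` is an automorphism of the
exchange graph. -/
def translationLattice (u : ReferencePoint) (s₀ : LabelledSeed) : AddSubgroup Plane where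
  carrier := {w | ∃ φ : exchangeGraph u s₀ ≃g exchangeGraph u s₀,
    ∀ x, (φ x).1 = Seed.translate w x.1}
  zero_mem' := ⟨SimpleGraph.Iso.refl, fun x => (Seed.translate_zero _).symm⟩
  add_mem' := by
    rintro w z ⟨φ, hφ⟩ ⟨ψ, hψ⟩
    refine ⟨ψ.trans φ, fun x => ?_⟩
    rw [← Seed.translate_translate, ← hψ, ← hφ]
    rfl
  neg_mem' := by
    rintro w ⟨φ, hφ⟩
    refine ⟨φ.symm, fun x => ?_⟩
    have h := hφ (φ.symm x)
    rw [RelIso.apply_symm_apply] at h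
    rw [h, Seed.translate_translate, neg_add_cancel, Seed.translate_zero]

lemma translate_mem_mutationClass {u : ReferencePoint} {s₀ : LabelledSeed} {w : Plane}
    (hw : w ∈ translationLattice u s₀) {x : Seed} (hx : x ∈ Seed.mutationClass u s₀) :
    Seed.translate w x ∈ Seed.mutationClass u s₀ := by
  obtain ⟨φ, hφ⟩ := hw
  rw [← hφ ⟨x, hx⟩]
  exact (φ ⟨x, hx⟩).2

/-- The lattice `L` acts on the vertices of the exchange graph by translations. -/
instance translationAction (u : ReferencePoint) (s₀ : LabelledSeed) :
    AddAction (translationLattice u s₀) (Seed.mutationClass u s₀) where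
  vadd w x := ⟨Seed.translate w.1 x.1, translate_mem_mutationClass w.2 x.2⟩
  zero_vadd _ := Subtype.ext (Seed.translate_zero _)
  add_vadd _ _ _ := Subtype.ext (Seed.translate_translate _ _ _).symm

/-- `x` is represented by a finite or infinite triangle with quiver `Q` and orientation `ε` whose
angle opposite to the side `i` is `m i * α` for all `i`, for a suitable numbering of its sides. -/
def Seed.IsOfType (α : ℝ) (m : Fin 3 → ℕ) (Q : Digraph (Fin 3)) (ε : SignType) (x : Seed) : Prop :=
  ∃ s : LabelledSeed, ⟦s⟧ = x ∧ (interior s.domain).Nonempty ∧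
    (∀ i, s.interiorAngle i = m i * α) ∧ s.quiver = Q ∧ s.orientation = ε

/-- Quasi-isometries with respect to given distance functions. -/
def IsQuasiIsometry {M N : Type*} (d₁ : M → M → ℝ) (d₂ : N → N → ℝ) (f : M → N) : Prop :=
  (∃ a b : ℝ, 1 ≤ a ∧ 0 ≤ b ∧ ∀ x y,
    1 / a * d₁ x y - b ≤ d₂ (f x) (f y) ∧ d₂ (f x) (f y) ≤ a * d₁ x y + b) ∧
  ∃ c : ℝ, 0 ≤ c ∧ ∀ z, ∃ x, d₂ z (f x) ≤ c

/-- The path metric on the vertices of a graph. -/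
def graphDist {V : Type*} (G : SimpleGraph V) (x y : V) : ℝ := G.dist x y

/-- The affine function that vanishes on the side of the triangle opposite to the vertex `i`, is
positive at this vertex, and is normalised so that the square of its linear part is `2`. -/
def sideForm (T : Affine.Triangle ℝ Plane) (i : Fin 3) : AffineForm :=
  let h : Plane := T.points i - T.altitudeFoot i
  let a : Plane := (√2 / ‖h‖) • h
  (a, - inner ℝ a (T.altitudeFoot i))

/-- The initial seed, for a triangle `T` with vertices `A₁, A₂, A₃` (indexed by `0, 1, 2`) and
angles `α, (n - 1) α, n α` where `α = π / 2n`. Its quiver is `a₁ ⟶ a₃ ⟶ a₂`, where `aᵢ` is the side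
opposite to `Aᵢ`. -/
def initialSeed (n : ℕ) (T : Affine.Triangle ℝ Plane) : LabelledSeed where
  v := sideForm T
  B :=
    let α : ℝ := Real.pi / (2 * n)
    !![0, 0, 2 * Real.cos ((n - 1) * α);
       0, 0, -(2 * Real.cos α);
       -(2 * Real.cos ((n - 1) * α)), 2 * Real.cos α, 0]

/-- The reference point for a triangle with a right angle at `A₃` and quiver `a₁ ⟶ a₃ ⟶ a₂`. The
altitudes on the source `a₁` and on the sink `a₂` both have the foot `A₃`, so that the
billiard path through the feet of the altitudes runs from the foot `H` on the hypotenuse to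
`A₃` and back to `H`. Unfolding it by the reflections across `a₁` and `a₂` gives the belt line, which
passes through the mirror image of `H` in `a₁`, then `A₃`, then the mirror image of `H` in `a₂`.
The reference point lies at infinity on this line, in the direction from source to sink. -/
def initialReferencePoint (T : Affine.Triangle ℝ Plane) : ReferencePoint where
  base := T.points 2
  dir := EuclideanGeometry.reflection line[ℝ, T.points 2, T.points 0] (T.altitudeFoot 2)
    - T.points 2

/-- The initial seed as a vertex of its exchange graph. -/
def initialVertex (u : ReferencePoint) (s₀ : LabelledSeed) : Seed.mutationClass u s₀ :=
  ⟨⟦s₀⟧, s₀, Relation.ReflTransGen.refl, rfl⟩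

end

/-! Every mutation respects the belt line. Once the sides are renumbered so that the quiver runs
along 0 → 1 → 2, each seed of the class is one of the explicit seeds `BeltFrame.seed`. Such a seed
is fixed by two angles, an orientation and the point p where side 0 crosses the belt line; its size
is not free. If no angle is obtuse, a mutation at the source or sink reflects the whole triangle and
so unfolds the billiard path through the altitude feet along the belt line. In every other case only
one further side is reflected. Counting angles in units of α turns seeds into a `BeltState`. There
the mutations are either cyclic rotations of the three angles or moves of the subtractive Euclidean
algorithm, in both directions. Each displaces p by an amount that depends on the angles alone
(`exists_mutate_relabel_eq`).

Angles, quiver and orientation determine a seed up to translation along the belt line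
(`relabel_toSeed_eq`). These translations commute with mutation, so one that carries a single seed
of the class into the class preserves the whole class (`mem_translationLattice`). Conversely, every
vector of L points along the belt line (`eq_smul_dir_of_translate_eq`). This gives the statement on
orbits. There are only finitely many shapes, so L acts cocompactly on a connected, locally finite
graph with an injective orbit map. The Švarc–Milnor lemma then yields both finite generation and the
quasi-isometry. Freeness is automatic, since L has no torsion.

The rank is exactly φ(2n)/2. For the upper bound, all displacements of p are integral combinations
of 1 and of products of two cotangents. They therefore lie in the real part of the field of 2n-th
roots of unity, whose dimension is at most φ(2n)/2 (`sub_mem_realCyclotomic`,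
`finrank_realCyclotomic_le`). For the lower bound, the Euclidean algorithm reaches an infinite
region with angle gα for each g < n coprime to 2n. One mutation carries this region to its own
translate by 1/sin²(gα) (`inv_sin_sq_mem_shiftGroup`). These φ(2n)/2 numbers are independent: a
Galois conjugation moves a largest coefficient of a relation to 1/sin²α, which exceeds the sum of
all the others (`eq_zero_of_sum_invSinSq_eq_zero`). -/

open scoped EuclideanGeometry

noncomputable section

/-! ### Coordinates along the belt line, and positivity at its infinite end -/

/-- An orthonormal frame of the plane whose first axis is the belt line, together with a unit of
length along this axis. -/
structure BeltFrame where
  base : Plane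
  dir : Plane
  perp : Plane
  scale : ℝ
  dir_dir : inner ℝ dir dir = (1 : ℝ)
  perp_perp : inner ℝ perp perp = (1 : ℝ)
  dir_perp : inner ℝ dir perp = (0 : ℝ)
  scale_pos : 0 < scale

namespace BeltFrame

variable (F : BeltFrame)

lemma perp_dir : inner ℝ F.perp F.dir = (0 : ℝ) := by rw [real_inner_comm]; exact F.dir_perp

/-- The affine function with gradient `√2 (x, y)` and value `√2 c` at the origin of the frame, where
`c` is measured in the unit of length of the frame. -/
def aff (x y c : ℝ) : AffineForm :=
  (√2 • (x • F.dir + y • F.perp),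
    √2 * (F.scale * c - (x * inner ℝ F.dir F.base + y * inner ℝ F.perp F.base)))

lemma aff_congr {x y c x' y' c' : ℝ} (hx : x = x') (hy : y = y') (hc : c = c') :
    F.aff x y c = F.aff x' y' c' := by rw [hx, hy, hc]

lemma aff_sub_smul (x y c x' y' c' r : ℝ) :
    F.aff x y c - r • F.aff x' y' c' = F.aff (x - r * x') (y - r * y') (c - r * c') := by
  refine Prod.ext ?_ ?_
  · simp only [aff, Prod.fst_sub, Prod.smul_fst]
    module
  · simp only [aff, Prod.snd_sub, Prod.smul_snd, smul_eq_mul]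
    ring

lemma neg_aff (x y c : ℝ) : - F.aff x y c = F.aff (-x) (-y) (-c) := by
  refine Prod.ext ?_ ?_
  · simp only [aff, Prod.fst_neg]
    module
  · simp only [aff, Prod.snd_neg]
    ring

lemma inner_comb (x y x' y' : ℝ) :
    inner ℝ (x • F.dir + y • F.perp) (x' • F.dir + y' • F.perp) = x * x' + y * y' := by
  simp only [inner_add_left, inner_add_right, real_inner_smul_left, real_inner_smul_right,
    F.dir_dir, F.perp_perp, F.dir_perp, F.perp_dir]
  ring

lemma form_aff (x y c x' y' c' : ℝ) :
    (F.aff x y c).form (F.aff x' y' c') = 2 * (x * x' + y * y') := by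
  simp only [AffineForm.form, aff, real_inner_smul_left, real_inner_smul_right, inner_comb]
  rw [← mul_assoc, Real.mul_self_sqrt (by norm_num)]

lemma eval_aff (x y c t : ℝ) :
    (F.aff x y c).eval (F.base + t • F.dir) = √2 * (F.scale * c + x * t) := by
  simp only [AffineForm.eval, aff, real_inner_smul_left, inner_add_left, inner_add_right,
    real_inner_smul_right, F.dir_dir, F.perp_dir]
  ring

lemma translate_aff (x y c w : ℝ) :
    (F.aff x y c).translate ((F.scale * w) • F.dir) = F.aff x y (c - x * w) := by
  refine Prod.ext rfl ?_
  simp only [AffineForm.translate, aff, real_inner_smul_left, inner_add_left,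
    real_inner_smul_right, F.dir_dir, F.perp_dir]
  ring

/-- The reference point at the positive end of the first axis. -/
def IsAdapted (u : ReferencePoint) : Prop := u.base = F.base ∧ ∃ r : ℝ, 0 < r ∧ u.dir = r • F.dir

variable {F} {u : ReferencePoint}

lemma IsAdapted.isPositive_of_pos (hu : F.IsAdapted u) {x y c : ℝ} (h : 0 < x) :
    u.IsPositive (F.aff x y c) := by
  obtain ⟨hb, r, hr, hd⟩ := hu
  simp only [ReferencePoint.IsPositive, hb, hd, smul_smul, eval_aff]
  have : Filter.Tendsto (fun t : ℝ => F.scale * c + x * (t * r)) Filter.atTop Filter.atTop := by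
    apply Filter.tendsto_atTop_add_const_left
    exact (Filter.tendsto_id.atTop_mul_const hr).const_mul_atTop h
  filter_upwards [this.eventually_gt_atTop 0] with t ht
  positivity

lemma IsAdapted.isPositive_const (hu : F.IsAdapted u) {y c : ℝ} (h : 0 < c) :
    u.IsPositive (F.aff 0 y c) := by
  obtain ⟨hb, r, hr, hd⟩ := hu
  simp only [ReferencePoint.IsPositive, hb, hd, smul_smul, eval_aff]
  have := F.scale_pos
  filter_upwards with t
  rw [zero_mul, add_zero]
  positivity

lemma not_isPositive_of_neg {f : AffineForm} (h : u.IsPositive (-f)) : ¬ u.IsPositive f := by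
  intro h'
  obtain ⟨t, h1, h2⟩ := (h.and h').exists
  simp only [AffineForm.eval, Prod.fst_neg, Prod.snd_neg, inner_neg_left] at h1 h2
  linarith

lemma IsAdapted.not_isPositive_of_neg (hu : F.IsAdapted u) {x y c : ℝ} (h : x < 0) :
    ¬ u.IsPositive (F.aff x y c) := by
  refine BeltFrame.not_isPositive_of_neg ?_
  rw [neg_aff]
  exact hu.isPositive_of_pos (by linarith)

lemma IsAdapted.not_isPositive_const (hu : F.IsAdapted u) {y c : ℝ} (h : c < 0) :
    ¬ u.IsPositive (F.aff 0 y c) := by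
  refine BeltFrame.not_isPositive_of_neg ?_
  rw [neg_aff, neg_zero]
  exact hu.isPositive_const (by linarith)

/-- The hypothesis excludes exactly the functions that vanish on the whole belt line; for these
neither sign is positive. Involutivity of mutation rests on this dichotomy. -/
lemma IsAdapted.isPositive_neg_iff (hu : F.IsAdapted u) {x y c : ℝ} (h : x ≠ 0 ∨ c ≠ 0) :
    u.IsPositive (- F.aff x y c) ↔ ¬ u.IsPositive (F.aff x y c) := by
  refine ⟨BeltFrame.not_isPositive_of_neg, fun h' => ?_⟩
  rw [neg_aff]
  rcases lt_trichotomy x 0 with hx | rfl | hx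
  · exact hu.isPositive_of_pos (by linarith)
  · rcases lt_trichotomy c 0 with hc | rfl | hc
    · rw [neg_zero]
      exact hu.isPositive_const (by linarith)
    · simp at h
    · exact absurd (hu.isPositive_const hc) h'
  · exact absurd (hu.isPositive_of_pos hx) h'

/-- Positivity does not change under translations along the belt line. -/
lemma IsAdapted.isPositive_translate (hu : F.IsAdapted u) (f : AffineForm) (w : ℝ) :
    u.IsPositive (f.translate (w • F.dir)) ↔ u.IsPositive f := by
  obtain ⟨hb, r, hr, hd⟩ := hu
  have key : ∀ (f : AffineForm) (w : ℝ), u.IsPositive f → u.IsPositive (f.translate (w • F.dir)) := by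
    intro f w hf
    have := (Filter.tendsto_atTop_add_const_right Filter.atTop (-(w / r))
      Filter.tendsto_id).eventually hf
    filter_upwards [this] with t ht
    have e : f.eval (u.base + (id t + -(w / r)) • u.dir)
        = (f.translate (w • F.dir)).eval (u.base + t • u.dir) := by
      simp only [AffineForm.eval, AffineForm.translate, hd, inner_add_right, id,
        real_inner_smul_right]
      field_simp
      ring
    rwa [← e]
  refine ⟨fun h => ?_, key f w⟩
  have := key _ (-w) h
  rwa [AffineForm.translate_translate, ← add_smul, neg_add_cancel, zero_smul,
    AffineForm.translate_zero] at this

end BeltFrame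

/-! ### Mutation versus renumbering, translation and itself -/

namespace LabelledSeed

variable {F : BeltFrame} {u : ReferencePoint}

lemma mutate_v_self (u : ReferencePoint) (k : Fin 3) (s : LabelledSeed) :
    (s.mutate u k).v k = - s.v k := if_pos rfl

/-- The condition for the side `i` to be reflected by the mutation at `k`. -/
def IsReflected (u : ReferencePoint) (k i : Fin 3) (s : LabelledSeed) : Prop :=
  (u.IsPositive (s.v k) ∧ s.B i k < 0) ∨ (¬ u.IsPositive (s.v k) ∧ 0 < s.B i k)

lemma mutate_v_of_isReflected {k i : Fin 3} {s : LabelledSeed} (hi : i ≠ k)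
    (h : s.IsReflected u k i) :
    (s.mutate u k).v i = s.v i - (s.v i).form (s.v k) • s.v k := by
  simp only [mutate]
  rw [if_neg hi]
  exact if_pos h

lemma mutate_v_of_not_isReflected {k i : Fin 3} {s : LabelledSeed} (hi : i ≠ k)
    (h : ¬ s.IsReflected u k i) : (s.mutate u k).v i = s.v i := by
  simp only [mutate]
  rw [if_neg hi]
  exact if_neg h

lemma relabel_relabel (σ τ : Equiv.Perm (Fin 3)) (s : LabelledSeed) :
    (s.relabel σ).relabel τ = s.relabel (σ * τ) := rfl

lemma relabel_one (s : LabelledSeed) : s.relabel 1 = s := rfl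

lemma mutate_relabel (u : ReferencePoint) (k : Fin 3) (σ : Equiv.Perm (Fin 3)) (s : LabelledSeed) :
    (s.relabel σ).mutate u k = (s.mutate u (σ k)).relabel σ := by
  ext1
  · funext i
    change _ = (s.mutate u (σ k)).v (σ i)
    have hv : ∀ i, (s.relabel σ).v i = s.v (σ i) := fun _ => rfl
    by_cases hi : i = k
    · subst hi
      rw [mutate_v_self u i, mutate_v_self u (σ i), hv]
    · have hi' : σ i ≠ σ k := fun h => hi (σ.injective h)
      have e : (s.relabel σ).IsReflected u k i ↔ s.IsReflected u (σ k) (σ i) := Iff.rfl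
      by_cases h : s.IsReflected u (σ k) (σ i)
      · rw [mutate_v_of_isReflected hi' h, mutate_v_of_isReflected hi (e.2 h), hv, hv]
      · rw [mutate_v_of_not_isReflected hi' h, mutate_v_of_not_isReflected hi (e.not.2 h), hv]
  · ext i j
    simp [mutate, relabel, mutateMatrix]

/-- Translations along the belt line preserve positivity. Other translations can change it for a
side parallel to the belt line. -/
lemma mutate_translate (hu : F.IsAdapted u) (k : Fin 3) (w : ℝ) (s : LabelledSeed) :
    (s.translate (w • F.dir)).mutate u k = (s.mutate u k).translate (w • F.dir) := by
  ext1
  · funext i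
    change _ = ((s.mutate u k).v i).translate _
    by_cases hi : i = k
    · rw [hi, mutate_v_self, mutate_v_self]
      refine Prod.ext rfl ?_
      simp [AffineForm.translate, translate]
      ring
    · have e : (s.translate (w • F.dir)).IsReflected u k i ↔ s.IsReflected u k i := by
        simp only [IsReflected, translate, hu.isPositive_translate]
      by_cases h : s.IsReflected u k i
      · rw [mutate_v_of_isReflected hi h, mutate_v_of_isReflected hi (e.2 h)]
        refine Prod.ext rfl ?_
        simp [AffineForm.translate, translate, AffineForm.form, inner_sub_left,
          real_inner_smul_left]
        ring
      · rw [mutate_v_of_not_isReflected hi h, mutate_v_of_not_isReflected hi (e.not.2 h)]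
        rfl
  · rfl

lemma mutateMatrix_mutateMatrix (k : Fin 3) (B : Matrix (Fin 3) (Fin 3) ℝ) :
    mutateMatrix k (mutateMatrix k B) = B := by
  ext i j
  simp only [mutateMatrix, Matrix.of_apply]
  by_cases h : k = i ∨ k = j
  · simp [h]
  · simp [h]
    ring

/-- Mutation is an involution if exactly one of the two sides of the mutated line is positive. -/
lemma mutate_mutate {s : LabelledSeed} {k : Fin 3} (h2 : (s.v k).form (s.v k) = 2)
    (hk : u.IsPositive (- s.v k) ↔ ¬ u.IsPositive (s.v k)) :
    (s.mutate u k).mutate u k = s := by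
  ext1
  · funext i
    by_cases hi : i = k
    · rw [hi, mutate_v_self, mutate_v_self, neg_neg]
    · have e : (s.mutate u k).IsReflected u k i ↔ s.IsReflected u k i := by
        have hB : (s.mutate u k).B i k = - s.B i k := by simp [mutate, mutateMatrix]
        simp only [IsReflected, mutate_v_self, hB, hk, not_not, Left.neg_neg_iff,
          Left.neg_pos_iff]
        exact or_comm
      by_cases h : s.IsReflected u k i
      · rw [mutate_v_of_isReflected hi (e.2 h), mutate_v_self, mutate_v_of_isReflected hi h]
        have e : AffineForm.form (s.v i - (s.v i).form (s.v k) • s.v k) (- s.v k)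
            = (s.v i).form (s.v k) := by
          have h3 : AffineForm.form (s.v i - (s.v i).form (s.v k) • s.v k) (- s.v k)
            = - (s.v i).form (s.v k) + (s.v i).form (s.v k) * (s.v k).form (s.v k) := by
            simp [AffineForm.form, inner_sub_left, real_inner_smul_left]
            ring
          rw [h3, h2]
          ring
        rw [e]
        module
      · rw [mutate_v_of_not_isReflected hi (e.not.2 h), mutate_v_of_not_isReflected hi h]
  · exact mutateMatrix_mutateMatrix k s.B

end LabelledSeed

/-! ### Mutations of exchange matrices of size three -/

/-- A skew-symmetric matrix of size three. -/
def skewMatrix (x y z : ℝ) : Matrix (Fin 3) (Fin 3) ℝ := !![0, x, z; -x, 0, y; -z, -y, 0]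

lemma skewMatrix_congr {x y z x' y' z' : ℝ} (hx : x = x') (hy : y = y') (hz : z = z') :
    skewMatrix x y z = skewMatrix x' y' z' := by rw [hx, hy, hz]

/-- In this and the following lemmas the renumbering restores a path 0 → 1 → 2 after the mutation.
The sign of z separates the acyclic quivers (z ≥ 0, no obtuse angle) from the cyclic ones. -/
lemma mutateMatrix_zero_source {x y z : ℝ} (hx : 0 ≤ x) (hz : 0 ≤ z) :
    (mutateMatrix 0 (skewMatrix x y z)).submatrix (finRotate 3) (finRotate 3)
      = skewMatrix y z x := by
  ext i j
  fin_cases i <;> fin_cases j <;>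
    simp [mutateMatrix, skewMatrix, abs_of_nonneg hx, abs_of_nonneg hz]

lemma mutateMatrix_zero_cyclic {x y z : ℝ} (hx : 0 ≤ x) (hz : z ≤ 0) :
    (mutateMatrix 0 (skewMatrix x y z)).submatrix (Equiv.swap 0 1) (Equiv.swap 0 1)
      = skewMatrix x (-z) (y + x * z) := by
  ext i j
  fin_cases i <;> fin_cases j <;>
    simp [mutateMatrix, skewMatrix, abs_of_nonneg hx, abs_of_nonpos hz,
      Equiv.swap_apply_of_ne_of_ne]
  ring

lemma mutateMatrix_one_left {x y z : ℝ} (hx : 0 ≤ x) (hy : 0 ≤ y) :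
    (mutateMatrix 1 (skewMatrix x y z)).submatrix (Equiv.swap 1 2) (Equiv.swap 1 2)
      = skewMatrix (z + x * y) y (-x) := by
  ext i j
  fin_cases i <;> fin_cases j <;>
    simp [mutateMatrix, skewMatrix, abs_of_nonneg hx, abs_of_nonneg hy,
      Equiv.swap_apply_of_ne_of_ne]
  ring

lemma mutateMatrix_one_right {x y z : ℝ} (hx : 0 ≤ x) (hy : 0 ≤ y) :
    (mutateMatrix 1 (skewMatrix x y z)).submatrix (Equiv.swap 0 1) (Equiv.swap 0 1)
      = skewMatrix x (z + x * y) (-y) := by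
  ext i j
  fin_cases i <;> fin_cases j <;>
    simp [mutateMatrix, skewMatrix, abs_of_nonneg hx, abs_of_nonneg hy,
      Equiv.swap_apply_of_ne_of_ne]
  ring

lemma mutateMatrix_two_sink {x y z : ℝ} (hy : 0 ≤ y) (hz : 0 ≤ z) :
    (mutateMatrix 2 (skewMatrix x y z)).submatrix (finRotate 3).symm (finRotate 3).symm
      = skewMatrix z x y := by
  have h0 : (finRotate 3).symm 0 = 2 := by decide
  have h1 : (finRotate 3).symm 1 = 0 := by decide
  have h2 : (finRotate 3).symm 2 = 1 := by decide
  ext i j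
  fin_cases i <;> fin_cases j <;>
    simp [mutateMatrix, skewMatrix, abs_of_nonneg hy, abs_of_nonneg hz, h0, h1, h2]

lemma mutateMatrix_two_cyclic {x y z : ℝ} (hy : 0 ≤ y) (hz : z ≤ 0) :
    (mutateMatrix 2 (skewMatrix x y z)).submatrix (Equiv.swap 1 2) (Equiv.swap 1 2)
      = skewMatrix (-z) y (x + z * y) := by
  ext i j
  fin_cases i <;> fin_cases j <;>
    simp [mutateMatrix, skewMatrix, abs_of_nonneg hy, abs_of_nonpos hz,
      Equiv.swap_apply_of_ne_of_ne]
  ring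

namespace LabelledSeed

variable {u : ReferencePoint}

/-- Reflecting a side in an orthogonal one changes nothing. Right angles, where the entry of B
vanishes, can thus be treated together with the acute ones. -/
lemma mutate_v_reflected {k i : Fin 3} {s : LabelledSeed} (hi : i ≠ k)
    (h : (s.v i).form (s.v k) = 0 ∨ s.IsReflected u k i) :
    (s.mutate u k).v i = s.v i - (s.v i).form (s.v k) • s.v k := by
  by_cases h' : s.IsReflected u k i
  · exact mutate_v_of_isReflected hi h'
  · rw [mutate_v_of_not_isReflected hi h', h.resolve_right h', zero_smul, sub_zero]

lemma mutate_v_of_isPositive {k i : Fin 3} {s : LabelledSeed} (hi : i ≠ k)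
    (hk : u.IsPositive (s.v k)) (h : 0 ≤ s.B i k) : (s.mutate u k).v i = s.v i :=
  mutate_v_of_not_isReflected hi (by rintro (h' | h') <;> [linarith [h'.2]; exact h'.1 hk])

lemma mutate_v_of_not_isPositive {k i : Fin 3} {s : LabelledSeed} (hi : i ≠ k)
    (hk : ¬ u.IsPositive (s.v k)) (h : s.B i k ≤ 0) : (s.mutate u k).v i = s.v i :=
  mutate_v_of_not_isReflected hi (by rintro (h' | h') <;> [exact hk h'.1; linarith [h'.2]])

lemma relabel_ext {s t : LabelledSeed} {τ : Equiv.Perm (Fin 3)} (h : ∀ i, s.v (τ i) = t.v i)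
    (hB : s.B.submatrix τ τ = t.B) : s.relabel τ = t :=
  LabelledSeed.ext (funext h) hB

end LabelledSeed

/-! ### The normal form of a seed and its mutations -/

namespace BeltFrame

variable (F : BeltFrame)

/-- The seed with angle `a` between the sides `1` and `2`, angle `c` between the sides `0` and
`1`, and angle `π - a - c` between the sides `0` and `2`, whose quiver contains the path
`0 ⟶ 1 ⟶ 2`. The altitude on the side `0` has its foot at the point `p` of the belt line, and
`s = ± 1` determines the orientation. -/
def seed (a c s p : ℝ) : LabelledSeed where
  v := ![F.aff (Real.sin a) (s * Real.cos a) (-p * Real.sin a),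
    F.aff (Real.sin (c - a)) (-s * Real.cos (c - a))
      (-p * Real.sin (c - a) + Real.cos c / Real.sin a),
    F.aff (-Real.sin c) (s * Real.cos c) (p * Real.sin c - Real.cos (a + c) / Real.sin a)]
  B := skewMatrix (2 * Real.cos c) (2 * Real.cos a) (-(2 * Real.cos (a + c)))

lemma seed_v_zero (a c s p : ℝ) :
    (F.seed a c s p).v 0 = F.aff (Real.sin a) (s * Real.cos a) (-p * Real.sin a) := rfl

lemma seed_v_one (a c s p : ℝ) :
    (F.seed a c s p).v 1 = F.aff (Real.sin (c - a)) (-s * Real.cos (c - a))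
      (-p * Real.sin (c - a) + Real.cos c / Real.sin a) := rfl

lemma seed_v_two (a c s p : ℝ) :
    (F.seed a c s p).v 2 = F.aff (-Real.sin c) (s * Real.cos c)
      (p * Real.sin c - Real.cos (a + c) / Real.sin a) := rfl

lemma seed_B (a c s p : ℝ) : (F.seed a c s p).B
    = skewMatrix (2 * Real.cos c) (2 * Real.cos a) (-(2 * Real.cos (a + c))) := rfl

lemma seed_form_self {s : ℝ} (hs : s ^ 2 = 1) (a c p : ℝ) (k : Fin 3) :
    ((F.seed a c s p).v k).form ((F.seed a c s p).v k) = 2 := by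
  have h := fun x : ℝ => Real.sin_sq_add_cos_sq x
  fin_cases k
  · change AffineForm.form ((F.seed a c s p).v 0) ((F.seed a c s p).v 0) = 2
    rw [seed_v_zero, form_aff]
    linear_combination 2 * h a + 2 * Real.cos a ^ 2 * hs
  · change AffineForm.form ((F.seed a c s p).v 1) ((F.seed a c s p).v 1) = 2
    rw [seed_v_one, form_aff]
    linear_combination 2 * h (c - a) + 2 * Real.cos (c - a) ^ 2 * hs
  · change AffineForm.form ((F.seed a c s p).v 2) ((F.seed a c s p).v 2) = 2
    rw [seed_v_two, form_aff]
    linear_combination 2 * h c + 2 * Real.cos c ^ 2 * hs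

/-- Products of different sides are −2 times the cosine of the enclosed angle. They are also the
negatives of the entries of B above the diagonal, so one set of angles controls both the reflections
and the quiver. -/
lemma seed_form_zero_one {s : ℝ} (hs : s ^ 2 = 1) (a c p : ℝ) :
    ((F.seed a c s p).v 0).form ((F.seed a c s p).v 1) = -2 * Real.cos c := by
  rw [seed_v_zero, seed_v_one, form_aff]
  have e : c = (c - a) + a := by ring
  conv_rhs => rw [e, Real.cos_add]
  linear_combination -2 * Real.cos a * Real.cos (c - a) * hs

lemma seed_form_one_two {s : ℝ} (hs : s ^ 2 = 1) (a c p : ℝ) :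
    ((F.seed a c s p).v 1).form ((F.seed a c s p).v 2) = -2 * Real.cos a := by
  rw [seed_v_one, seed_v_two, form_aff]
  have e : a = c - (c - a) := by ring
  conv_rhs => rw [e, Real.cos_sub]
  linear_combination -2 * Real.cos c * Real.cos (c - a) * hs

lemma seed_form_zero_two {s : ℝ} (hs : s ^ 2 = 1) (a c p : ℝ) :
    ((F.seed a c s p).v 0).form ((F.seed a c s p).v 2) = 2 * Real.cos (a + c) := by
  rw [seed_v_zero, seed_v_two, form_aff, Real.cos_add]
  linear_combination 2 * Real.cos a * Real.cos c * hs

lemma form_comm (f g : AffineForm) : f.form g = g.form f := real_inner_comm _ _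

lemma seed_translate (a c s p w : ℝ) :
    (F.seed a c s p).translate ((F.scale * w) • F.dir) = F.seed a c s (p + w) := by
  refine LabelledSeed.ext (funext fun i => ?_) rfl
  fin_cases i
  · exact (F.translate_aff _ _ _ _).trans (F.aff_congr rfl rfl (by ring))
  · exact (F.translate_aff _ _ _ _).trans (F.aff_congr rfl rfl (by ring))
  · exact (F.translate_aff _ _ _ _).trans (F.aff_congr rfl rfl (by ring))

/-- The range of the angles for which `BeltFrame.seed` occurs in a mutation class. -/
structure Admissible (a c : ℝ) : Prop where
  pos : 0 < a
  le : a ≤ Real.pi / 2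
  nonneg : 0 ≤ c
  le' : c ≤ Real.pi / 2
  lt : a + c < Real.pi
  ne : c = 0 → a ≠ Real.pi / 2

namespace Admissible

variable {a c : ℝ}

lemma sin_pos (h : Admissible a c) : 0 < Real.sin a :=
  Real.sin_pos_of_pos_of_lt_pi h.pos (by linarith [h.le, Real.pi_pos])

lemma sin_nonneg (h : Admissible a c) : 0 ≤ Real.sin c :=
  Real.sin_nonneg_of_nonneg_of_le_pi h.nonneg (by linarith [h.le', Real.pi_pos])

lemma cos_nonneg (h : Admissible a c) : 0 ≤ Real.cos a :=
  Real.cos_nonneg_of_mem_Icc ⟨by linarith [h.pos, Real.pi_pos], h.le⟩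

lemma cos_nonneg' (h : Admissible a c) : 0 ≤ Real.cos c :=
  Real.cos_nonneg_of_mem_Icc ⟨by linarith [h.nonneg, Real.pi_pos], h.le'⟩

lemma sin_add_pos (h : Admissible a c) : 0 < Real.sin (a + c) :=
  Real.sin_pos_of_pos_of_lt_pi (by linarith [h.pos, h.nonneg]) h.lt

lemma cos_add_nonpos (h : Admissible a c) (h' : Real.pi / 2 ≤ a + c) : Real.cos (a + c) ≤ 0 :=
  Real.cos_nonpos_of_pi_div_two_le_of_le h' (by linarith [h.lt, Real.pi_pos])

lemma cos_add_pos (h : Admissible a c) (h' : a + c < Real.pi / 2) : 0 < Real.cos (a + c) :=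
  Real.cos_pos_of_mem_Ioo ⟨by linarith [h.pos, h.nonneg, Real.pi_pos], h'⟩

lemma cos_pos_of_le (h : Admissible a c) (h' : a ≤ c) : 0 < Real.cos a :=
  Real.cos_pos_of_mem_Ioo ⟨by linarith [h.pos, Real.pi_pos], by
    rcases h'.lt_or_eq with h'' | h''
    · linarith [h.le']
    · linarith [h.lt]⟩

lemma cos_pos_of_lt (h : Admissible a c) (h' : c < a) : 0 < Real.cos c :=
  Real.cos_pos_of_mem_Ioo ⟨by linarith [h.nonneg, Real.pi_pos], by linarith [h.le]⟩

end Admissible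

/-- No side of an admissible seed vanishes on the belt line. -/
lemma seed_nonvanishing {a c : ℝ} (h : Admissible a c) (s p : ℝ) (k : Fin 3) :
    ∃ x y z, (F.seed a c s p).v k = F.aff x y z ∧ (x ≠ 0 ∨ z ≠ 0) := by
  have h0 := h.sin_pos
  fin_cases k
  · exact ⟨_, _, _, rfl, Or.inl h0.ne'⟩
  · refine ⟨_, _, _, rfl, ?_⟩
    by_cases hx : Real.sin (c - a) = 0
    · right
      have hca : c = a := by
        have h1 := h.pos; have h2 := h.le; have h3 := h.le'; have h4 := h.nonneg
        have := (Real.sin_eq_zero_iff_of_lt_of_lt (by linarith) (by linarith)).1 hx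
        linarith
      have := h.cos_pos_of_le hca.ge
      rw [hx, hca]
      simp only [mul_zero, zero_add]
      positivity
    · exact Or.inl hx
  · refine ⟨_, _, _, rfl, ?_⟩
    by_cases hx : Real.sin c = 0
    · right
      have hc : c = 0 := by
        have h3 := h.le'; have h4 := h.nonneg
        have := (Real.sin_eq_zero_iff_of_lt_of_lt (by linarith [Real.pi_pos])
          (by linarith [Real.pi_pos])).1 hx
        linarith
      have ha : a < Real.pi / 2 := lt_of_le_of_ne h.le (h.ne hc)
      have : 0 < Real.cos a := Real.cos_pos_of_mem_Ioo ⟨by linarith [h.pos, Real.pi_pos], ha⟩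
      rw [hx, hc, mul_zero, zero_sub, add_zero]
      exact neg_ne_zero.2 (by positivity)
    · exact Or.inl (by simpa using hx)

variable {F} {u : ReferencePoint}

section mutations

lemma perm_inv_apply (τ : Equiv.Perm (Fin 3)) (i : Fin 3) : τ⁻¹ (τ i) = i :=
  τ.symm_apply_apply i

/-- Sides `i` and `j` after the mutation of the side `k` of `s`. -/
lemma mutate_sides {s : LabelledSeed} {t : LabelledSeed} {τ : Equiv.Perm (Fin 3)} {i j k : Fin 3}
    (hijk : ∀ l, τ l = i ∨ τ l = j ∨ τ l = k)
    (hi : (s.mutate u k).v i = t.v (τ⁻¹ i)) (hj : (s.mutate u k).v j = t.v (τ⁻¹ j))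
    (hk : - s.v k = t.v (τ⁻¹ k)) (hB : (mutateMatrix k s.B).submatrix τ τ = t.B) :
    (s.mutate u k).relabel τ = t := by
  refine LabelledSeed.relabel_ext (fun l => ?_) hB
  rcases hijk l with h | h | h
  · rw [h, hi, ← h, perm_inv_apply]
  · rw [h, hj, ← h, perm_inv_apply]
  · rw [h, LabelledSeed.mutate_v_self, hk, ← h, perm_inv_apply]

variable {a c s : ℝ} (p : ℝ)

/-- Without an obtuse angle, side 0 is a source and both other sides are reflected, so the triangle
as a whole is mirrored in side 0 and changes orientation. The old side 1 becomes the source, and p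
moves back to the next point of the unfolded billiard path. -/
lemma mutate_zero_source (hu : F.IsAdapted u) (h : Admissible a c) (hs : s ^ 2 = 1)
    (hac : Real.pi / 2 ≤ a + c) :
    ((F.seed a c s p).mutate u 0).relabel (finRotate 3)
      = F.seed (Real.pi - a - c) a (-s)
          (p - 1 + Real.cos a * Real.cos (Real.pi - a - c)
            / (Real.sin a * Real.sin (Real.pi - a - c))) := by
  have h0 := h.sin_pos
  have h1 := h.sin_add_pos
  have hpos : u.IsPositive ((F.seed a c s p).v 0) := hu.isPositive_of_pos h0
  have hc0 := h.cos_nonneg'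
  have hb0 := h.cos_add_nonpos hac
  have e : Real.pi - a - c = Real.pi - (a + c) := by ring
  have h11 := Real.sin_sq_add_cos_sq a
  have h12 := Real.sin_sq_add_cos_sq c
  have f10 : AffineForm.form ((F.seed a c s p).v 1) ((F.seed a c s p).v 0) = -2 * Real.cos c := by
    rw [form_comm, seed_form_zero_one _ hs]
  have f20 : AffineForm.form ((F.seed a c s p).v 2) ((F.seed a c s p).v 0)
      = 2 * Real.cos (a + c) := by
    rw [form_comm, seed_form_zero_two _ hs]
  refine mutate_sides (i := 1) (j := 2) (by decide) ?_ ?_ ?_ ?_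
  · rw [LabelledSeed.mutate_v_reflected (by decide)]
    · rw [f10, seed_v_one, seed_v_zero, aff_sub_smul, show (finRotate 3)⁻¹ 1 = 0 by decide,
        seed_v_zero, e, Real.sin_pi_sub, Real.cos_pi_sub]
      refine F.aff_congr ?_ ?_ ?_
      · rw [Real.sin_add, Real.sin_sub]
        ring
      · rw [Real.cos_add, Real.cos_sub]
        ring
      · rw [Real.sin_sub]
        field_simp
        rw [Real.sin_add, Real.cos_add]
        grind
    · rw [f10]
      rcases hc0.eq_or_lt with h' | h'
      · left; rw [← h', mul_zero]
      · exact Or.inr (Or.inl ⟨hpos, by simp [seed, skewMatrix, h']⟩)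
  · rw [LabelledSeed.mutate_v_reflected (by decide)]
    · rw [f20, seed_v_two, seed_v_zero, aff_sub_smul, show (finRotate 3)⁻¹ 2 = 1 by decide,
        seed_v_one, e, Real.sin_pi_sub, Real.cos_pi_sub, show a - (Real.pi - (a + c))
        = (a + (a + c)) - Real.pi by ring, Real.sin_sub_pi, Real.cos_sub_pi, Real.sin_add a (a + c),
        Real.cos_add a (a + c)]
      refine F.aff_congr ?_ ?_ ?_
      · simp only [Real.sin_add, Real.cos_add]
        grind
      · simp only [Real.sin_add, Real.cos_add]
        grind
      · field_simp
        simp only [Real.sin_add, Real.cos_add]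
        grind
    · rw [f20]
      rcases hb0.eq_or_lt with h' | h'
      · left; rw [h', mul_zero]
      · exact Or.inr (Or.inl ⟨hpos, by simp [seed, skewMatrix]; linarith⟩)
  · rw [seed_v_zero, neg_aff, show (finRotate 3)⁻¹ 0 = 2 by decide, seed_v_two, e,
        Real.sin_pi_sub, Real.cos_pi_sub, show Real.pi - (a + c) + a = Real.pi - c by ring,
        Real.cos_pi_sub]
    refine F.aff_congr rfl (by ring) ?_
    field_simp
    simp only [Real.sin_add, Real.cos_add]
    grind
  · refine (mutateMatrix_zero_source ?_ ?_).trans ?_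
    · positivity
    · linarith
    · rw [seed_B, e, Real.cos_pi_sub, show Real.pi - (a + c) + a = Real.pi - c by ring,
        Real.cos_pi_sub]
      exact skewMatrix_congr rfl (by ring) (by ring)

/-- An obtuse middle angle makes the quiver cyclic. Only side 1 is reflected, side 2 stays in place
and the orientation survives. The angle a grows by c. -/
lemma mutate_zero_cyclic (hu : F.IsAdapted u) (h : Admissible a c) (hs : s ^ 2 = 1)
    (hac : a + c < Real.pi / 2) :
    ((F.seed a c s p).mutate u 0).relabel (Equiv.swap 0 1)
      = F.seed (a + c) c s (p - Real.cos c / (Real.sin a * Real.sin (a + c))) := by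
  have h0 := h.sin_pos
  have h1 := h.sin_add_pos
  have hpos : u.IsPositive ((F.seed a c s p).v 0) := hu.isPositive_of_pos h0
  have hc0 : 0 < Real.cos c := Real.cos_pos_of_mem_Ioo
    ⟨by linarith [h.nonneg, Real.pi_pos], by linarith [h.pos]⟩
  have hb0 := h.cos_add_pos hac
  have h11 := Real.sin_sq_add_cos_sq a
  have h12 := Real.sin_sq_add_cos_sq c
  have f10 : AffineForm.form ((F.seed a c s p).v 1) ((F.seed a c s p).v 0) = -2 * Real.cos c := by
    rw [form_comm, seed_form_zero_one _ hs]
  refine mutate_sides (i := 1) (j := 2) (by decide) ?_ ?_ ?_ ?_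
  · rw [LabelledSeed.mutate_v_of_isReflected (by decide)
      (Or.inl ⟨hpos, by simp [seed, skewMatrix, hc0]⟩)]
    rw [f10, seed_v_one, seed_v_zero, aff_sub_smul, show (Equiv.swap (0 : Fin 3) 1)⁻¹ 1 = 0 by decide,
        seed_v_zero]
    refine F.aff_congr ?_ ?_ ?_
    · simp only [Real.sin_add, Real.sin_sub]
      ring
    · simp only [Real.cos_add, Real.cos_sub]
      ring
    · field_simp
      simp only [Real.sin_add, Real.sin_sub]
      grind
  · rw [LabelledSeed.mutate_v_of_isPositive (by decide) hpos (by simp [seed, skewMatrix, hb0.le])]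
    rw [seed_v_two, show (Equiv.swap (0 : Fin 3) 1)⁻¹ 2 = 2 by decide,
        seed_v_two]
    refine F.aff_congr rfl rfl ?_
    · field_simp
      simp only [Real.sin_add, Real.cos_add]
      grind
  · rw [seed_v_zero, neg_aff, show (Equiv.swap (0 : Fin 3) 1)⁻¹ 0 = 1 by decide, seed_v_one,
      show c - (a + c) = - a by ring, Real.sin_neg, Real.cos_neg]
    refine F.aff_congr rfl (by ring) ?_
    field_simp
    ring
  · refine (mutateMatrix_zero_cyclic ?_ ?_).trans ?_
    · positivity
    · linarith
    · rw [seed_B, show a + c + c = c + (a + c) by ring, Real.cos_add c (a + c), Real.cos_add a c,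
        Real.sin_add]
      exact skewMatrix_congr rfl (by ring) (by grind)

/-- The mutation at the middle side is a step of the subtractive Euclidean algorithm on (a, c). Here
side 1 is positive, so side 2 is reflected; side 0 is untouched and p does not move. -/
lemma mutate_one_left (hu : F.IsAdapted u) (h : Admissible a c) (hs : s ^ 2 = 1)
    (hac : a ≤ c) :
    ((F.seed a c s p).mutate u 1).relabel (Equiv.swap 1 2) = F.seed a (c - a) s p := by
  have h0 := h.sin_pos
  have hca := h.cos_pos_of_le hac
  have hc0 := h.cos_nonneg'
  have hpos : u.IsPositive ((F.seed a c s p).v 1) := by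
    rw [seed_v_one]
    -- For a = c the side is parallel to the belt line, and positivity is decided by the constant
    -- cos c / sin a.
    rcases hac.eq_or_lt with rfl | hac
    · rw [sub_self, Real.sin_zero, mul_zero, zero_add]
      exact hu.isPositive_const (by positivity)
    · exact hu.isPositive_of_pos (Real.sin_pos_of_pos_of_lt_pi (by linarith)
        (by linarith [h.pos, h.lt]))
  have h11 := Real.sin_sq_add_cos_sq a
  have f21 : AffineForm.form ((F.seed a c s p).v 2) ((F.seed a c s p).v 1) = -2 * Real.cos a := by
    rw [form_comm, seed_form_one_two _ hs]
  refine mutate_sides (i := 0) (j := 2) (by decide) ?_ ?_ ?_ ?_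
  · rw [LabelledSeed.mutate_v_of_isPositive (by decide) hpos (by simp [seed, skewMatrix, hc0]),
      show (Equiv.swap (1 : Fin 3) 2)⁻¹ 0 = 0 by decide, seed_v_zero, seed_v_zero]
  · rw [LabelledSeed.mutate_v_of_isReflected (by decide)
      (Or.inl ⟨hpos, by simp [seed, skewMatrix, hca]⟩)]
    rw [f21, seed_v_two, seed_v_one, aff_sub_smul,
      show (Equiv.swap (1 : Fin 3) 2)⁻¹ 2 = 1 by decide, seed_v_one,
      show c - a - a = (c - a) - a by ring, Real.sin_sub (c - a), Real.cos_sub (c - a)]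
    refine F.aff_congr ?_ ?_ ?_
    · simp only [Real.sin_sub, Real.cos_sub]
      grind
    · simp only [Real.sin_sub, Real.cos_sub]
      grind
    · field_simp
      simp only [Real.sin_sub, Real.cos_sub, Real.cos_add]
      grind
  · rw [seed_v_one, neg_aff, show (Equiv.swap (1 : Fin 3) 2)⁻¹ 1 = 2 by decide, seed_v_two,
      show a + (c - a) = c by ring]
    refine F.aff_congr rfl (by ring) (by ring)
  · rw [seed_B, seed_B, mutateMatrix_one_left (by positivity) (by positivity),
      show a + (c - a) = c by ring]
    refine skewMatrix_congr ?_ rfl rfl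
    rw [Real.cos_add, Real.cos_sub]
    ring

/-- The other Euclidean step: side 1 is not positive, so side 0 is reflected. The reversed side 1
becomes the new side 0, hence p moves. -/
lemma mutate_one_right (hu : F.IsAdapted u) (h : Admissible a c) (hs : s ^ 2 = 1)
    (hac : c < a) :
    ((F.seed a c s p).mutate u 1).relabel (Equiv.swap 0 1)
      = F.seed (a - c) c s (p + Real.cos c / (Real.sin a * Real.sin (a - c))) := by
  have h0 := h.sin_pos
  have hca := h.cos_nonneg
  have hc0 := h.cos_pos_of_lt hac
  have h1 : 0 < Real.sin (a - c) :=
    Real.sin_pos_of_pos_of_lt_pi (by linarith) (by linarith [h.nonneg, h.lt])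
  have e1 : Real.sin (c - a) = - Real.sin (a - c) := by rw [← Real.sin_neg, neg_sub]
  have e2 : Real.cos (c - a) = Real.cos (a - c) := by rw [← Real.cos_neg, neg_sub]
  have hpos : ¬ u.IsPositive ((F.seed a c s p).v 1) := by
    rw [seed_v_one]
    exact hu.not_isPositive_of_neg (by linarith)
  have h11 := Real.sin_sq_add_cos_sq a
  have h12 := Real.sin_sq_add_cos_sq c
  refine mutate_sides (i := 0) (j := 2) (by decide) ?_ ?_ ?_ ?_
  · rw [LabelledSeed.mutate_v_of_isReflected (by decide)
      (Or.inr ⟨hpos, by simp [seed, skewMatrix, hc0]⟩)]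
    rw [seed_form_zero_one _ hs, seed_v_zero, seed_v_one, aff_sub_smul,
      show (Equiv.swap (0 : Fin 3) 1)⁻¹ 0 = 1 by decide, seed_v_one, e1, e2,
      show c - (a - c) = c - (a - c) by ring, Real.sin_sub c (a - c), Real.cos_sub c (a - c)]
    refine F.aff_congr ?_ ?_ ?_
    · simp only [Real.sin_sub, Real.cos_sub]
      grind
    · simp only [Real.sin_sub, Real.cos_sub]
      grind
    · field_simp
      simp only [Real.sin_sub, Real.cos_sub]
      grind
  · rw [LabelledSeed.mutate_v_of_not_isPositive (by decide) hpos (by simp [seed, skewMatrix, hca]),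
      show (Equiv.swap (0 : Fin 3) 1)⁻¹ 2 = 2 by decide, seed_v_two, seed_v_two]
    refine F.aff_congr rfl rfl ?_
    rw [sub_add_cancel]
    field_simp
    simp only [Real.sin_sub, Real.cos_add]
    grind
  · rw [seed_v_one, neg_aff, show (Equiv.swap (0 : Fin 3) 1)⁻¹ 1 = 0 by decide, seed_v_zero, e1, e2]
    refine F.aff_congr (by ring) (by ring) ?_
    field_simp
  · rw [seed_B, seed_B, mutateMatrix_one_right (by positivity) (by positivity), sub_add_cancel]
    refine skewMatrix_congr rfl ?_ rfl
    rw [Real.cos_add, Real.cos_sub]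
    ring

lemma not_isPositive_two (hu : F.IsAdapted u) (h : Admissible a c) :
    ¬ u.IsPositive ((F.seed a c s p).v 2) := by
  have h0 := h.sin_pos
  rw [seed_v_two]
  rcases h.nonneg.eq_or_lt with rfl | hc
  · rw [Real.sin_zero, neg_zero, mul_zero, zero_sub, add_zero]
    have : 0 < Real.cos a := Real.cos_pos_of_mem_Ioo
      ⟨by linarith [h.pos, Real.pi_pos], lt_of_le_of_ne h.le (h.ne rfl)⟩
    exact hu.not_isPositive_const (neg_neg_of_pos (by positivity))
  · refine hu.not_isPositive_of_neg (neg_neg_of_pos ?_)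
    exact Real.sin_pos_of_pos_of_lt_pi hc (by linarith [h.pos, h.lt])

/-- The counterpart of `mutate_zero_source` at the other end of the path. The mirrored sink becomes
the source, so the new p is the point where the old side 2 crosses the belt line. -/
lemma mutate_two_sink (hu : F.IsAdapted u) (h : Admissible a c) (hs : s ^ 2 = 1) (hc : 0 < c)
    (hac : Real.pi / 2 ≤ a + c) :
    ((F.seed a c s p).mutate u 2).relabel (finRotate 3)⁻¹
      = F.seed c (Real.pi - a - c) (-s)
          (p + 1 - Real.cos a * Real.cos c / (Real.sin a * Real.sin c)) := by
  have h0 := h.sin_pos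
  have h1 : 0 < Real.sin c := Real.sin_pos_of_pos_of_lt_pi hc (by linarith [h.pos, h.lt])
  have hpos := not_isPositive_two (s := s) p hu h
  have ha0 := h.cos_nonneg
  have hb0 := h.cos_add_nonpos hac
  have e : Real.pi - a - c = Real.pi - (a + c) := by ring
  have h11 := Real.sin_sq_add_cos_sq a
  have h12 := Real.sin_sq_add_cos_sq c
  have f12 := F.seed_form_one_two hs a c p
  have f02 := F.seed_form_zero_two hs a c p
  refine mutate_sides (i := 0) (j := 1) (by decide) ?_ ?_ ?_ ?_
  · rw [LabelledSeed.mutate_v_reflected (by decide)]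
    · rw [f02, seed_v_two, seed_v_zero, aff_sub_smul, show ((finRotate 3)⁻¹)⁻¹ 0 = 1 by decide,
        seed_v_one, e, show Real.pi - (a + c) - c = Real.pi - (a + c + c) by ring,
        Real.sin_pi_sub, Real.cos_pi_sub, Real.sin_add (a + c), Real.cos_add (a + c)]
      refine F.aff_congr ?_ ?_ ?_
      · simp only [Real.sin_add, Real.cos_add]
        grind
      · simp only [Real.sin_add, Real.cos_add]
        grind
      · rw [Real.cos_pi_sub]
        field_simp
        simp only [Real.sin_add, Real.cos_add]
        grind
    · rw [f02]
      rcases hb0.eq_or_lt with h' | h'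
      · left; rw [h', mul_zero]
      · exact Or.inr (Or.inr ⟨hpos, by simp [seed, skewMatrix]; linarith⟩)
  · rw [LabelledSeed.mutate_v_reflected (by decide)]
    · rw [f12, seed_v_one, seed_v_two, aff_sub_smul, show ((finRotate 3)⁻¹)⁻¹ 1 = 2 by decide,
        seed_v_two, e, Real.sin_pi_sub, Real.cos_pi_sub,
        show c + (Real.pi - (a + c)) = Real.pi - a by ring, Real.cos_pi_sub]
      refine F.aff_congr ?_ ?_ ?_
      · rw [Real.sin_add, Real.sin_sub]
        ring
      · rw [Real.cos_add, Real.cos_sub]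
        ring
      · rw [Real.sin_sub]
        field_simp
        rw [Real.sin_add, Real.cos_add]
        grind
    · rw [f12]
      rcases ha0.eq_or_lt with h' | h'
      · left; rw [← h', mul_zero]
      · exact Or.inr (Or.inr ⟨hpos, by simp [seed, skewMatrix, h']⟩)
  · rw [seed_v_two, neg_aff, show ((finRotate 3)⁻¹)⁻¹ 2 = 0 by decide, seed_v_zero]
    refine F.aff_congr (by ring) (by ring) ?_
    field_simp
    simp only [Real.cos_add]
    grind
  · refine (mutateMatrix_two_sink (by positivity) (by linarith)).trans ?_
    rw [seed_B, e, Real.cos_pi_sub, show c + (Real.pi - (a + c)) = Real.pi - a by ring,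
        Real.cos_pi_sub]
    exact skewMatrix_congr (by ring) rfl (by ring)

/-- This increases c by a while side 0 stays, which undoes the step of `mutate_one_left`. -/
lemma mutate_two_cyclic (hu : F.IsAdapted u) (h : Admissible a c) (hs : s ^ 2 = 1)
    (hac : a + c < Real.pi / 2) :
    ((F.seed a c s p).mutate u 2).relabel (Equiv.swap 1 2) = F.seed a (a + c) s p := by
  have hpos := not_isPositive_two (s := s) p hu h
  have ha0 : 0 < Real.cos a := Real.cos_pos_of_mem_Ioo
    ⟨by linarith [h.pos, Real.pi_pos], by linarith [h.nonneg]⟩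
  have hb0 := h.cos_add_pos hac
  have h11 := Real.sin_sq_add_cos_sq a
  have f12 := F.seed_form_one_two hs a c p
  refine mutate_sides (i := 0) (j := 1) (by decide) ?_ ?_ ?_ ?_
  · rw [LabelledSeed.mutate_v_of_not_isPositive (by decide) hpos
      (by simp [seed, skewMatrix, hb0.le]), show (Equiv.swap (1 : Fin 3) 2)⁻¹ 0 = 0 by decide,
      seed_v_zero, seed_v_zero]
  · rw [LabelledSeed.mutate_v_of_isReflected (by decide)
      (Or.inr ⟨hpos, by simp [seed, skewMatrix, ha0]⟩)]
    rw [f12, seed_v_one, seed_v_two, aff_sub_smul,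
      show (Equiv.swap (1 : Fin 3) 2)⁻¹ 1 = 2 by decide, seed_v_two, Real.cos_add a (a + c)]
    refine F.aff_congr ?_ ?_ ?_
    · simp only [Real.sin_add, Real.sin_sub]
      ring
    · simp only [Real.cos_add, Real.cos_sub]
      ring
    · field_simp
      simp only [Real.sin_add, Real.cos_add, Real.sin_sub]
      grind
  · rw [seed_v_two, neg_aff, show (Equiv.swap (1 : Fin 3) 2)⁻¹ 2 = 1 by decide, seed_v_one,
      show a + c - a = c by ring]
    refine F.aff_congr (by ring) (by ring) (by ring)
  · refine (mutateMatrix_two_cyclic (by positivity) (by linarith)).trans ?_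
    rw [seed_B, Real.cos_add a (a + c), Real.cos_add a c, Real.sin_add]
    exact skewMatrix_congr (by ring) rfl (by grind)

end mutations

end BeltFrame

/-! ### States, and mutation as a step on them -/

/-- The combinatorial description of an admissible seed: its angles between the sides `1, 2` and
between the sides `0, 1`, as multiples of `π / 2n`, its orientation, and its position on the belt
line. -/
@[ext]
structure BeltState where
  A : ℕ
  C : ℕ
  s : ℤˣ
  p : ℝ

/-- The angle of which all angles are multiples. -/
def unitAngle (n : ℕ) : ℝ := Real.pi / (2 * n)

namespace BeltState

/-- The states of triangles whose angles are coprime multiples of `π / 2n`. -/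
structure Good (n : ℕ) (D : BeltState) : Prop where
  pos : 0 < D.A
  le : D.A ≤ n
  le' : D.C ≤ n
  coprime : ∀ d, d ∣ D.A → d ∣ D.C → d ∣ 2 * n → d = 1

/-- The seed described by a state. -/
def toSeed (F : BeltFrame) (n : ℕ) (D : BeltState) : LabelledSeed :=
  F.seed (D.A * unitAngle n) (D.C * unitAngle n) ((D.s : ℤ) : ℝ) D.p

/-- Translation along the belt line. -/
def shift (w : ℝ) (D : BeltState) : BeltState := ⟨D.A, D.C, D.s, D.p + w⟩

/-- Change of the orientation by a factor. -/
def flip (e : ℤˣ) (D : BeltState) : BeltState := ⟨D.A, D.C, e * D.s, D.p⟩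

/-- The product of the cotangents of two multiples of the unit angle. -/
def cotCot (n a b : ℕ) : ℝ :=
  Real.cos (a * unitAngle n) * Real.cos (b * unitAngle n)
    / (Real.sin (a * unitAngle n) * Real.sin (b * unitAngle n))

/-- The displacement of the altitude foot in a mutation of an obtuse triangle. -/
def footShift (n c a b : ℕ) : ℝ :=
  Real.cos (c * unitAngle n) / (Real.sin (a * unitAngle n) * Real.sin (b * unitAngle n))

/-- The effect of the mutations on states. -/
def step (n : ℕ) (k : Fin 3) (D : BeltState) : BeltState :=
  match k with
  | 0 => if n ≤ D.A + D.C
      then ⟨2 * n - D.A - D.C, D.A, -D.s, D.p - 1 + cotCot n D.A (2 * n - D.A - D.C)⟩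
      else ⟨D.A + D.C, D.C, D.s, D.p - footShift n D.C D.A (D.A + D.C)⟩
  | 1 => if D.A ≤ D.C
      then ⟨D.A, D.C - D.A, D.s, D.p⟩
      else ⟨D.A - D.C, D.C, D.s, D.p + footShift n D.C D.A (D.A - D.C)⟩
  | 2 => if n ≤ D.A + D.C
      then ⟨D.C, 2 * n - D.A - D.C, -D.s, D.p + 1 - cotCot n D.A D.C⟩
      else ⟨D.A, D.A + D.C, D.s, D.p⟩

variable {n : ℕ} {D : BeltState}

namespace Good

lemma add_lt (h : D.Good n) (hn : 2 ≤ n) : D.A + D.C < 2 * n := by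
  have h1 := h.le; have h2 := h.le'
  by_contra hc
  have h3 : D.A = n := by omega
  have h4 : D.C = n := by omega
  have := h.coprime n (by simp [h3]) (by simp [h4]) ⟨2, by ring⟩
  omega

lemma lt_of_eq_zero (h : D.Good n) (hn : 2 ≤ n) (hC : D.C = 0) : D.A < n := by
  refine lt_of_le_of_ne h.le fun hA => ?_
  have := h.coprime n (by simp [hA]) (by simp [hC]) ⟨2, by ring⟩
  omega

lemma mul_unitAngle (hn : 2 ≤ n) : (n : ℝ) * unitAngle n = Real.pi / 2 := by
  rw [unitAngle]
  field_simp

lemma unitAngle_pos (hn : 2 ≤ n) : 0 < unitAngle n := by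
  rw [unitAngle]
  positivity

lemma mul_le_iff (hn : 2 ≤ n) (k : ℕ) : (k : ℝ) * unitAngle n ≤ Real.pi / 2 ↔ k ≤ n := by
  rw [← mul_unitAngle hn, mul_le_mul_iff_left₀ (unitAngle_pos hn), Nat.cast_le]

lemma le_mul_iff (hn : 2 ≤ n) (k : ℕ) : Real.pi / 2 ≤ (k : ℝ) * unitAngle n ↔ n ≤ k := by
  rw [← mul_unitAngle hn, mul_le_mul_iff_left₀ (unitAngle_pos hn), Nat.cast_le]

lemma admissible (h : D.Good n) (hn : 2 ≤ n) :
    BeltFrame.Admissible (D.A * unitAngle n) (D.C * unitAngle n) where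
  pos := mul_pos (by exact_mod_cast h.pos) (unitAngle_pos hn)
  le := (mul_le_iff hn _).2 h.le
  nonneg := mul_nonneg (by positivity) (unitAngle_pos hn).le
  le' := (mul_le_iff hn _).2 h.le'
  lt := by
    have h1 : ((D.A + D.C : ℕ) : ℝ) < (2 * n : ℕ) := by exact_mod_cast h.add_lt hn
    push_cast at h1
    have h2 := mul_unitAngle hn
    nlinarith [unitAngle_pos hn]
  ne := by
    intro hC hA
    have hC' : D.C = 0 := by
      have := (mul_eq_zero.1 hC).resolve_right (unitAngle_pos hn).ne'
      exact_mod_cast this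
    exact absurd ((le_mul_iff hn _).1 hA.ge) (not_le.2 (h.lt_of_eq_zero hn hC'))

lemma shift (h : D.Good n) (w : ℝ) : (D.shift w).Good n := ⟨h.pos, h.le, h.le', h.coprime⟩

lemma flip (h : D.Good n) (e : ℤˣ) : (D.flip e).Good n := ⟨h.pos, h.le, h.le', h.coprime⟩

/-- The angles sum to 2n, so a common divisor of two of them and 2n divides the third. Rotations and
Euclidean steps therefore preserve coprimality. -/
lemma step (h : D.Good n) (hn : 2 ≤ n) (k : Fin 3) : (D.step n k).Good n := by
  have h1 := h.pos; have h2 := h.le; have h3 := h.le'; have h4 := h.add_lt hn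
  have key : ∀ d, d ∣ 2 * n - D.A - D.C → d ∣ 2 * n → (d ∣ D.A → d ∣ D.C) ∧ (d ∣ D.C → d ∣ D.A) := by
    intro d hd hd2
    have e : 2 * n - (2 * n - D.A - D.C) = D.A + D.C := by omega
    have := Nat.dvd_sub hd2 hd
    rw [e] at this
    exact ⟨fun h => (Nat.dvd_add_right h).1 this, fun h => (Nat.dvd_add_left h).1 this⟩
  fin_cases k
  · change ((if n ≤ D.A + D.C then _ else _ : BeltState)).Good n
    split_ifs with hc
    · exact ⟨by simp only; omega, by simp only; omega, h2,
        fun d d1 d2 d3 => h.coprime d d2 ((key d d1 d3).1 d2) d3⟩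
    · exact ⟨by simp only; omega, by simp only; omega, h3,
        fun d d1 d2 d3 => h.coprime d ((Nat.dvd_add_left d2).1 d1) d2 d3⟩
  · change ((if D.A ≤ D.C then _ else _ : BeltState)).Good n
    split_ifs with hc
    · exact ⟨h1, h2, by simp only; omega,
        fun d d1 d2 d3 => h.coprime d d1 ((Nat.dvd_sub_iff_left hc d1).1 d2) d3⟩
    · exact ⟨by simp only; omega, by simp only; omega, h3,
        fun d d1 d2 d3 => h.coprime d ((Nat.dvd_sub_iff_left (not_le.1 hc).le d2).1 d1) d2 d3⟩
  · change ((if n ≤ D.A + D.C then _ else _ : BeltState)).Good n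
    split_ifs with hc
    -- With C = 0 this branch would force A = n, which coprimality rules out.
    · have : 0 < D.C := by
        rcases Nat.eq_zero_or_pos D.C with h0 | h0
        · have := h.lt_of_eq_zero hn h0
          omega
        · exact h0
      exact ⟨this, h3, by simp only; omega,
        fun d d1 d2 d3 => h.coprime d ((key d d2 d3).2 d1) d1 d3⟩
    · exact ⟨h1, h2, by simp only; omega,
        fun d d1 d2 d3 => h.coprime d d1 ((Nat.dvd_add_right d1).1 d2) d3⟩

end Good

lemma step_shift (k : Fin 3) (w : ℝ) : (D.shift w).step n k = (D.step n k).shift w := by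
  match k with
  | 0 =>
    change (if n ≤ D.A + D.C then _ else _ : BeltState) = shift w (if n ≤ D.A + D.C then _ else _)
    split_ifs <;> exact BeltState.ext rfl rfl rfl (by simp only [shift]; ring)
  | 1 =>
    change (if D.A ≤ D.C then _ else _ : BeltState) = shift w (if D.A ≤ D.C then _ else _)
    split_ifs
    · rfl
    · exact BeltState.ext rfl rfl rfl (by simp only [shift]; ring)
  | 2 =>
    change (if n ≤ D.A + D.C then _ else _ : BeltState) = shift w (if n ≤ D.A + D.C then _ else _)
    split_ifs
    · exact BeltState.ext rfl rfl rfl (by simp only [shift]; ring)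
    · rfl

lemma step_flip (k : Fin 3) (e : ℤˣ) : (D.flip e).step n k = (D.step n k).flip e := by
  match k with
  | 0 =>
    change (if n ≤ D.A + D.C then _ else _ : BeltState) = flip e (if n ≤ D.A + D.C then _ else _)
    split_ifs <;> exact BeltState.ext rfl rfl (by simp [flip]) rfl
  | 1 =>
    change (if D.A ≤ D.C then _ else _ : BeltState) = flip e (if D.A ≤ D.C then _ else _)
    split_ifs <;> rfl
  | 2 =>
    change (if n ≤ D.A + D.C then _ else _ : BeltState) = flip e (if n ≤ D.A + D.C then _ else _)
    split_ifs <;> exact BeltState.ext rfl rfl (by simp [flip]) rfl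

lemma sign_sq (s : ℤˣ) : (((s : ℤ) : ℝ)) ^ 2 = 1 := by
  rcases Int.units_eq_one_or s with rfl | rfl <;> simp

variable {F : BeltFrame} {u : ReferencePoint}

lemma toSeed_shift (w : ℝ) :
    (D.shift w).toSeed F n = (D.toSeed F n).translate ((F.scale * w) • F.dir) :=
  (F.seed_translate _ _ _ _ _).symm

lemma cast_sub_mul {n a c : ℕ} (hn : 2 ≤ n) (h : a + c ≤ 2 * n) :
    ((2 * n - a - c : ℕ) : ℝ) * unitAngle n = Real.pi - a * unitAngle n - c * unitAngle n := by
  have h1 : ((2 * n - a - c : ℕ) : ℝ) = 2 * n - a - c := by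
    rw [Nat.sub_sub, Nat.cast_sub h]
    push_cast
    ring
  have h2 := Good.mul_unitAngle hn
  rw [h1]
  linear_combination 2 * h2

/-- Every mutation of the seed of a good state is the seed of a good state. -/
lemma exists_mutate_relabel_eq (hu : F.IsAdapted u) (hn : 2 ≤ n) (h : D.Good n) (k : Fin 3) :
    ∃ τ, ((D.toSeed F n).mutate u k).relabel τ = (D.step n k).toSeed F n := by
  have ha := h.admissible hn
  have hs := sign_sq D.s
  have e1 : ((D.A + D.C : ℕ) : ℝ) * unitAngle n = D.A * unitAngle n + D.C * unitAngle n := by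
    push_cast; ring
  have e2 := cast_sub_mul hn (h.add_lt hn).le
  have hac : Real.pi / 2 ≤ D.A * unitAngle n + D.C * unitAngle n ↔ n ≤ D.A + D.C := by
    rw [← e1, Good.le_mul_iff hn]
  have hle : D.A * unitAngle n ≤ D.C * unitAngle n ↔ D.A ≤ D.C := by
    rw [mul_le_mul_iff_left₀ (Good.unitAngle_pos hn), Nat.cast_le]
  fin_cases k
  · by_cases hc : n ≤ D.A + D.C
    · refine ⟨_, (BeltFrame.mutate_zero_source D.p hu ha hs (hac.2 hc)).trans ?_⟩
      simp [step, toSeed, hc, cotCot, e2]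
    · refine ⟨_, (BeltFrame.mutate_zero_cyclic D.p hu ha hs (not_le.1 (hac.not.2 hc))).trans ?_⟩
      simp [step, toSeed, hc, footShift, add_mul]
  · by_cases hc : D.A ≤ D.C
    · refine ⟨_, (BeltFrame.mutate_one_left D.p hu ha hs (hle.2 hc)).trans ?_⟩
      simp [step, toSeed, hc, sub_mul]
    · refine ⟨_, (BeltFrame.mutate_one_right D.p hu ha hs (not_le.1 (hle.not.2 hc))).trans ?_⟩
      simp [step, toSeed, hc, footShift, sub_mul, Nat.cast_sub (not_le.1 hc).le]
  · by_cases hc : n ≤ D.A + D.C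
    · have hC : 0 < (D.C : ℝ) * unitAngle n := by
        have := (h.step hn 2).pos
        simp only [step, hc, if_true] at this
        exact mul_pos (by exact_mod_cast this) (Good.unitAngle_pos hn)
      refine ⟨_, (BeltFrame.mutate_two_sink D.p hu ha hs hC (hac.2 hc)).trans ?_⟩
      simp [step, toSeed, hc, cotCot, e2]
    · refine ⟨_, (BeltFrame.mutate_two_cyclic D.p hu ha hs (not_le.1 (hac.not.2 hc))).trans ?_⟩
      simp [step, toSeed, hc, add_mul]

lemma mutate_mutate_toSeed (hu : F.IsAdapted u) (hn : 2 ≤ n) (h : D.Good n) (k : Fin 3) :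
    ((D.toSeed F n).mutate u k).mutate u k = D.toSeed F n := by
  refine LabelledSeed.mutate_mutate (F.seed_form_self (sign_sq D.s) _ _ _ k) ?_
  obtain ⟨x, y, z, hv, hxz⟩ := F.seed_nonvanishing (h.admissible hn) ((D.s : ℤ) : ℝ) D.p k
  rw [toSeed, hv]
  exact hu.isPositive_neg_iff hxz

/-- Two states are linked if they are related by a sequence of mutations. -/
def Linked (n : ℕ) : BeltState → BeltState → Prop :=
  Relation.EqvGen fun D D' => D.Good n ∧ ∃ k, D' = D.step n k

namespace Linked

variable {D D' D'' : BeltState}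

lemma step (h : D.Good n) (k : Fin 3) : Linked n D (D.step n k) := .rel _ _ ⟨h, k, rfl⟩

lemma symm (h : Linked n D D') : Linked n D' D := Relation.EqvGen.symm _ _ h

lemma trans (h : Linked n D D') (h' : Linked n D' D'') : Linked n D D'' :=
  Relation.EqvGen.trans _ _ _ h h'

lemma shift (h : Linked n D D') (w : ℝ) : Linked n (D.shift w) (D'.shift w) := by
  induction h with
  | rel D D' h =>
    obtain ⟨h, k, rfl⟩ := h
    rw [← step_shift]
    exact .step (h.shift w) k
  | refl D => exact .refl _
  | symm _ _ _ ih => exact ih.symm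
  | trans _ _ _ _ _ ih ih' => exact ih.trans ih'

lemma flip (h : Linked n D D') (e : ℤˣ) : Linked n (D.flip e) (D'.flip e) := by
  induction h with
  | rel D D' h =>
    obtain ⟨h, k, rfl⟩ := h
    rw [← step_flip]
    exact .step (h.flip e) k
  | refl D => exact .refl _
  | symm _ _ _ ih => exact ih.symm
  | trans _ _ _ _ _ ih ih' => exact ih.trans ih'

end Linked

end BeltState

/-! ### Angles, quiver and orientation as a complete invariant up to translation -/

namespace LabelledSeed

lemma perm_cases (τ : Equiv.Perm (Fin 3)) : τ = 1 ∨ τ = Equiv.swap 0 1 ∨ τ = Equiv.swap 1 2 ∨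
    τ = Equiv.swap 0 2 ∨ τ = finRotate 3 ∨ τ = (finRotate 3)⁻¹ := by
  revert τ
  decide

lemma interiorAngle_relabel (s : LabelledSeed) (τ : Equiv.Perm (Fin 3)) (i : Fin 3) :
    (s.relabel τ).interiorAngle i = s.interiorAngle (τ i) := by
  have h : (τ (i + 1) = τ i + 1 ∧ τ (i + 2) = τ i + 2) ∨
      (τ (i + 1) = τ i + 2 ∧ τ (i + 2) = τ i + 1) := by
    revert τ i
    decide
  simp only [interiorAngle, relabel]
  rcases h with ⟨h1, h2⟩ | ⟨h1, h2⟩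
  · rw [h1, h2]
  · rw [h1, h2, InnerProductGeometry.angle_comm]

lemma orientation_relabel (s : LabelledSeed) (τ : Equiv.Perm (Fin 3)) :
    (s.relabel τ).orientation
      = SignType.sign ((((Equiv.Perm.sign τ : ℤˣ) : ℤ) : ℝ) * (cross (s.v 0).1 (s.v 1).1
        + cross (s.v 1).1 (s.v 2).1 + cross (s.v 2).1 (s.v 0).1)) := by
  simp only [orientation, relabel]
  congr 1
  have h0 : (finRotate 3)⁻¹ 0 = 2 := by decide
  have h1 : (finRotate 3)⁻¹ 1 = 0 := by decide
  have h2 : (finRotate 3)⁻¹ 2 = 1 := by decide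
  rcases perm_cases τ with rfl | rfl | rfl | rfl | rfl | rfl <;>
    simp [cross, Equiv.swap_apply_of_ne_of_ne, h0, h1, h2] <;> ring

/-- The two seeds have the same angles, quiver and orientation. -/
structure SameShape (s t : LabelledSeed) : Prop where
  angle : ∀ i, s.interiorAngle i = t.interiorAngle i
  quiver : s.quiver = t.quiver
  orientation : s.orientation = t.orientation

end LabelledSeed

namespace BeltFrame

open LabelledSeed

variable (F : BeltFrame)

lemma plane_inner (a b : Plane) : inner ℝ a b = a 0 * b 0 + a 1 * b 1 := by
  simp [PiLp.inner_apply, Fin.sum_univ_two]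
  ring

lemma cross_sq : cross F.dir F.perp ^ 2 = 1 := by
  have h1 := F.dir_dir
  have h2 := F.perp_perp
  have h3 := F.dir_perp
  rw [plane_inner] at h1 h2 h3
  rw [cross]
  linear_combination h1 * (F.perp 0 * F.perp 0 + F.perp 1 * F.perp 1) + h2 -
    (F.dir 0 * F.perp 0 + F.dir 1 * F.perp 1) * h3

lemma cross_ne_zero : cross F.dir F.perp ≠ 0 := by
  intro h
  have := F.cross_sq
  rw [h] at this
  norm_num at this

lemma cross_aff (x y c x' y' c' : ℝ) : cross (F.aff x y c).1 (F.aff x' y' c').1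
    = 2 * (x * y' - y * x') * cross F.dir F.perp := by
  have h : √2 * √2 = (2 : ℝ) := Real.mul_self_sqrt (by norm_num)
  simp only [aff, cross, PiLp.smul_apply, PiLp.add_apply, smul_eq_mul]
  linear_combination (x * y' - y * x') * (F.dir 0 * F.perp 1 - F.dir 1 * F.perp 0) * h

lemma eq_zero_of_inner_eq_zero {w : Plane} (h1 : inner ℝ F.dir w = (0 : ℝ))
    (h2 : inner ℝ F.perp w = (0 : ℝ)) : w = 0 := by
  rw [plane_inner] at h1 h2
  have h := F.cross_ne_zero
  rw [cross] at h
  ext i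
  fin_cases i
  · refine (mul_eq_zero.1 (?_ : (F.dir 0 * F.perp 1 - F.dir 1 * F.perp 0) * w 0 = 0)).resolve_left h
    linear_combination F.perp 1 * h1 - F.dir 1 * h2
  · refine (mul_eq_zero.1 (?_ : (F.dir 0 * F.perp 1 - F.dir 1 * F.perp 0) * w 1 = 0)).resolve_left h
    linear_combination F.dir 0 * h2 - F.perp 0 * h1

/-- The sum of sines is positive for admissible angles, so the orientation is the sign s times a
sign fixed by the frame. -/
lemma seed_cross (a c s p : ℝ) :
    cross ((F.seed a c s p).v 0).1 ((F.seed a c s p).v 1).1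
      + cross ((F.seed a c s p).v 1).1 ((F.seed a c s p).v 2).1
      + cross ((F.seed a c s p).v 2).1 ((F.seed a c s p).v 0).1
      = (2 * (Real.sin a + Real.sin c + Real.sin (a + c))) * (s * -cross F.dir F.perp) := by
  rw [seed_v_zero, seed_v_one, seed_v_two, cross_aff, cross_aff, cross_aff]
  have h11 := Real.sin_sq_add_cos_sq a
  have h12 := Real.sin_sq_add_cos_sq c
  have : Real.sin a * (-s * Real.cos (c - a)) - s * Real.cos a * Real.sin (c - a)
      + (Real.sin (c - a) * (s * Real.cos c) - -s * Real.cos (c - a) * -Real.sin c)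
      + (-Real.sin c * (s * Real.cos a) - s * Real.cos c * Real.sin a)
      = - (s * (Real.sin a + Real.sin c + Real.sin (a + c))) := by
    rw [Real.sin_add, Real.sin_sub, Real.cos_sub]
    grind
  linear_combination 2 * cross F.dir F.perp * this

lemma seed_angle {x y z x' y' z' θ : ℝ} (h1 : x ^ 2 + y ^ 2 = 1) (h2 : x' ^ 2 + y' ^ 2 = 1)
    (h : x * x' + y * y' = -Real.cos θ) (hθ : 0 ≤ θ) (hθ' : θ ≤ Real.pi) :
    Real.pi - InnerProductGeometry.angle (F.aff x y z).1 (F.aff x' y' z').1 = θ := by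
  have hn : ∀ x y z : ℝ, x ^ 2 + y ^ 2 = 1 → ‖(F.aff x y z).1‖ = √2 := by
    intro x y z h
    rw [norm_eq_sqrt_real_inner]
    congr 1
    have := F.form_aff x y z x y z
    rw [AffineForm.form] at this
    rw [this]
    linear_combination 2 * h
  have h3 := F.form_aff x y z x' y' z'
  rw [AffineForm.form] at h3
  rw [InnerProductGeometry.angle, hn _ _ _ h1, hn _ _ _ h2, h3, h,
    Real.mul_self_sqrt (by norm_num), mul_div_cancel_left₀ _ (by norm_num), Real.arccos_neg,
    Real.arccos_cos hθ hθ']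
  ring

section angles

variable {a c s : ℝ} (p : ℝ)

lemma interiorAngle_seed_zero (h : Admissible a c) (hs : s ^ 2 = 1) :
    (F.seed a c s p).interiorAngle 0 = a := by
  have h12 := Real.sin_sq_add_cos_sq (c - a)
  have h13 := Real.sin_sq_add_cos_sq c
  refine F.seed_angle ?_ ?_ ?_ h.pos.le (by linarith [h.lt, h.nonneg])
  · linear_combination h12 + Real.cos (c - a) ^ 2 * hs
  · linear_combination h13 + Real.cos c ^ 2 * hs
  · have := F.seed_form_one_two hs a c p
    rw [seed_v_one, seed_v_two, form_aff] at this
    linear_combination this / 2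

lemma interiorAngle_seed_one (h : Admissible a c) (hs : s ^ 2 = 1) :
    (F.seed a c s p).interiorAngle 1 = Real.pi - a - c := by
  have h12 := Real.sin_sq_add_cos_sq a
  have h13 := Real.sin_sq_add_cos_sq c
  refine F.seed_angle ?_ ?_ ?_ (by linarith [h.lt]) (by linarith [h.pos, h.nonneg])
  · linear_combination h13 + Real.cos c ^ 2 * hs
  · linear_combination h12 + Real.cos a ^ 2 * hs
  · have := F.seed_form_zero_two hs a c p
    rw [seed_v_zero, seed_v_two, form_aff] at this
    rw [show Real.pi - a - c = Real.pi - (a + c) by ring, Real.cos_pi_sub]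
    linear_combination this / 2

lemma interiorAngle_seed_two (h : Admissible a c) (hs : s ^ 2 = 1) :
    (F.seed a c s p).interiorAngle 2 = c := by
  have h12 := Real.sin_sq_add_cos_sq a
  have h13 := Real.sin_sq_add_cos_sq (c - a)
  refine F.seed_angle ?_ ?_ ?_ h.nonneg (by linarith [h.lt, h.pos])
  · linear_combination h12 + Real.cos a ^ 2 * hs
  · linear_combination h13 + Real.cos (c - a) ^ 2 * hs
  · have := F.seed_form_zero_one hs a c p
    rw [seed_v_zero, seed_v_one, form_aff] at this
    linear_combination this / 2

end angles

lemma cos_pi_div_two_add (x : ℝ) : Real.cos (Real.pi / 2 + x) = -Real.sin x := by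
  rw [add_comm, Real.cos_add_pi_div_two]

/-- The source and the side following it may be exchanged if they are orthogonal. -/
lemma seed_relabel_source {a : ℝ} (h0 : Real.sin a ≠ 0) (h1 : Real.cos a ≠ 0) (s p : ℝ) :
    (F.seed a (Real.pi / 2) s p).relabel (Equiv.swap 0 1)
      = F.seed (Real.pi / 2 - a) (Real.pi / 2) (-s) p := by
  have e : Real.cos (Real.pi / 2 - a + Real.pi / 2) = -Real.cos a := by
    rw [Real.cos_add_pi_div_two, Real.sin_pi_div_two_sub]
  refine relabel_ext (fun i => ?_) ?_
  · match i with
    | 0 =>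
      rw [Equiv.swap_apply_left, seed_v_one, seed_v_zero]
      exact F.aff_congr rfl (by ring) (by simp)
    | 1 =>
      rw [Equiv.swap_apply_right, seed_v_one, seed_v_zero]
      simp only [sub_sub_cancel]
      exact F.aff_congr rfl (by ring) (by simp)
    | 2 =>
      rw [Equiv.swap_apply_of_ne_of_ne (by decide) (by decide), seed_v_two, seed_v_two]
      refine F.aff_congr rfl (by simp) ?_
      rw [e, Real.cos_add_pi_div_two, Real.sin_pi_div_two_sub]
      field_simp
  · rw [seed_B, seed_B, e]
    ext i j
    fin_cases i <;> fin_cases j <;>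
      simp [skewMatrix, Equiv.swap_apply_of_ne_of_ne, Real.cos_add_pi_div_two,
        Real.cos_pi_div_two_sub]

/-- The sink and the side preceding it may be exchanged if they are orthogonal. -/
lemma seed_relabel_sink (c s p : ℝ) :
    (F.seed (Real.pi / 2) c s p).relabel (Equiv.swap 1 2)
      = F.seed (Real.pi / 2) (Real.pi / 2 - c) (-s) p := by
  have e : Real.cos (Real.pi / 2 + (Real.pi / 2 - c)) = -Real.cos c := by
    rw [cos_pi_div_two_add, Real.sin_pi_div_two_sub]
  refine relabel_ext (fun i => ?_) ?_
  · match i with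
    | 0 =>
      rw [Equiv.swap_apply_of_ne_of_ne (by decide) (by decide), seed_v_zero, seed_v_zero]
      exact F.aff_congr rfl (by simp) rfl
    | 1 =>
      rw [Equiv.swap_apply_left, seed_v_one, seed_v_two, cos_pi_div_two_add,
        show Real.pi / 2 - c - Real.pi / 2 = -c by ring]
      refine F.aff_congr (by simp) (by simp) ?_
      simp [Real.cos_pi_div_two_sub]
    | 2 =>
      rw [Equiv.swap_apply_right, seed_v_one, seed_v_two, e, Real.sin_sub_pi_div_two,
        Real.cos_sub_pi_div_two, Real.sin_pi_div_two_sub, Real.cos_pi_div_two_sub]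
      exact F.aff_congr rfl rfl (by ring)
  · rw [seed_B, seed_B, e]
    ext i j
    fin_cases i <;> fin_cases j <;>
      simp [skewMatrix, Equiv.swap_apply_of_ne_of_ne, cos_pi_div_two_add, Real.cos_pi_div_two_sub]

end BeltFrame

namespace BeltState

open LabelledSeed

variable {F : BeltFrame} {n : ℕ} {D D' : BeltState}

/-- The angles opposite to the sides, as multiples of the unit angle. -/
def angles (n : ℕ) (D : BeltState) : Fin 3 → ℕ := ![D.A, 2 * n - D.A - D.C, D.C]

lemma interiorAngle_toSeed (hn : 2 ≤ n) (h : D.Good n) (i : Fin 3) :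
    (D.toSeed F n).interiorAngle i = D.angles n i * unitAngle n := by
  match i with
  | 0 => exact F.interiorAngle_seed_zero D.p (h.admissible hn) (sign_sq D.s)
  | 1 =>
    exact (F.interiorAngle_seed_one D.p (h.admissible hn) (sign_sq D.s)).trans
      (cast_sub_mul hn (h.add_lt hn).le).symm
  | 2 => exact F.interiorAngle_seed_two D.p (h.admissible hn) (sign_sq D.s)

/-- The arrows of the quiver of a state. -/
def arrow (n : ℕ) (D : BeltState) : Fin 3 → Fin 3 → Prop :=
  ![![False, D.C < n, n < D.A + D.C], ![False, False, D.A < n], ![D.A + D.C < n, False, False]]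

lemma cos_pos_iff (hn : 2 ≤ n) {k : ℕ} (hk : k ≤ 2 * n) :
    0 < Real.cos (k * unitAngle n) ↔ k < n := by
  rw [← not_le (a := n), ← Good.le_mul_iff hn, not_le]
  have h0 : 0 ≤ (k : ℝ) * unitAngle n := mul_nonneg (by positivity) (Good.unitAngle_pos hn).le
  constructor
  · intro h
    by_contra h'
    refine absurd h (not_lt.2 (Real.cos_nonpos_of_pi_div_two_le_of_le (not_lt.1 h') ?_))
    have h1 := Good.mul_unitAngle hn
    have h2 : (k : ℝ) ≤ 2 * n := by exact_mod_cast hk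
    nlinarith [Good.unitAngle_pos hn, Real.pi_pos]
  · intro h
    exact Real.cos_pos_of_mem_Ioo ⟨by linarith [Real.pi_pos], h⟩

lemma cos_neg_iff (hn : 2 ≤ n) {k : ℕ} (hk : k ≤ 2 * n) :
    Real.cos (k * unitAngle n) < 0 ↔ n < k := by
  have h1 := Good.mul_unitAngle hn
  have e := cos_pos_iff hn (Nat.sub_le (2 * n) k)
  rw [Nat.cast_sub hk, sub_mul] at e
  push_cast at e
  rw [mul_assoc, h1, mul_div_cancel₀ _ (by norm_num), Real.cos_pi_sub, Left.neg_pos_iff] at e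
  rw [e]
  omega

lemma quiver_toSeed (hn : 2 ≤ n) (h : D.Good n) (i j : Fin 3) :
    (D.toSeed F n).quiver.Adj i j ↔ D.arrow n i j := by
  change 0 < (D.toSeed F n).B i j ↔ _
  have ha := h.admissible hn
  have h1 := ha.cos_nonneg
  have h2 := ha.cos_nonneg'
  have e : ((D.A + D.C : ℕ) : ℝ) * unitAngle n = D.A * unitAngle n + D.C * unitAngle n := by
    push_cast; ring
  have hA := cos_pos_iff hn (k := D.A) (by linarith [h.le])
  have hC := cos_pos_iff hn (k := D.C) (by linarith [h.le'])
  have hB := cos_pos_iff hn (h.add_lt hn).le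
  have hB' := cos_neg_iff hn (h.add_lt hn).le
  rw [e] at hB hB'
  have hB'' : 2 * Real.cos (D.A * unitAngle n + D.C * unitAngle n) < 0 ↔ n < D.A + D.C := by
    rw [← hB']
    constructor <;> intro <;> linarith
  fin_cases i <;> fin_cases j <;> simp [toSeed, BeltFrame.seed, skewMatrix, arrow, *]

lemma orientation_toSeed_relabel (hn : 2 ≤ n) (h : D.Good n) (τ : Equiv.Perm (Fin 3)) :
    ((D.toSeed F n).relabel τ).orientation = SignType.sign
      ((((Equiv.Perm.sign τ * D.s : ℤˣ) : ℤ) : ℝ) * -cross F.dir F.perp) := by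
  have ha := h.admissible hn
  have h1 := ha.sin_pos
  have h2 := ha.sin_add_pos
  have h3 := ha.sin_nonneg
  rw [orientation_relabel, toSeed, F.seed_cross]
  rw [mul_left_comm, sign_mul, sign_pos (by positivity), one_mul, ← mul_assoc, Units.val_mul,
    Int.cast_mul]

lemma sign_unit_mul_ne {x : ℝ} (hx : x ≠ 0) {e e' : ℤˣ}
    (h : SignType.sign (((e : ℤ) : ℝ) * x) = SignType.sign (((e' : ℤ) : ℝ) * x)) : e = e' := by
  have h1 : SignType.sign x ≠ 0 := sign_ne_zero.2 hx
  rw [sign_mul, sign_mul] at h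
  have h2 := mul_right_cancel₀ h1 h
  rcases Int.units_eq_one_or e with rfl | rfl <;> rcases Int.units_eq_one_or e' with rfl | rfl <;>
    simp at h2 ⊢

/-- The angles, the quiver and the orientation determine a seed up to translations along the belt
line. -/
theorem relabel_toSeed_eq (hn : 2 ≤ n) (h : D.Good n) (h' : D'.Good n) {τ : Equiv.Perm (Fin 3)}
    (hs : SameShape ((D'.toSeed F n).relabel τ) (D.toSeed F n)) :
    (D'.toSeed F n).relabel τ = (D.shift (D'.p - D.p)).toSeed F n := by
  have hang : ∀ i, D'.angles n (τ i) = D.angles n i := by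
    intro i
    have := hs.angle i
    rw [interiorAngle_relabel, interiorAngle_toSeed hn h, interiorAngle_toSeed hn h'] at this
    exact_mod_cast mul_right_cancel₀ (Good.unitAngle_pos hn).ne' this
  have harr : ∀ i j, D'.arrow n (τ i) (τ j) ↔ D.arrow n i j := by
    intro i j
    rw [← quiver_toSeed (F := F) hn h, ← quiver_toSeed (F := F) hn h', ← hs.quiver]
    rfl
  have hsign : Equiv.Perm.sign τ * D'.s = D.s := by
    have h1 := hs.orientation
    rw [← relabel_one (D.toSeed F n), orientation_toSeed_relabel hn h,
      orientation_toSeed_relabel hn h', map_one, one_mul] at h1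
    exact sign_unit_mul_ne (neg_ne_zero.2 F.cross_ne_zero) h1
  have a0 := hang 0
  have a1 := hang 1
  have a2 := hang 2
  have q01 := harr 0 1
  have q12 := harr 1 2
  have q02 := harr 0 2
  have l1 := h.le; have l2 := h.le'; have l1' := h'.le; have l2' := h'.le'
  have l3 := h.lt_of_eq_zero hn
  have l4 := h.pos
  have i0 : (finRotate 3)⁻¹ 0 = 2 := by decide
  have i1 : (finRotate 3)⁻¹ 1 = 0 := by decide
  have i2 : (finRotate 3)⁻¹ 2 = 1 := by decide
  have hn2 := Good.mul_unitAngle hn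
  have ep : D.p + (D'.p - D.p) = D'.p := by ring
  -- The identity gives equal states up to p. The swaps 0 1 and 1 2 survive only when the exchanged
  -- sides are orthogonal, where one right triangle has two state descriptions with the same p. The
  -- remaining permutations contradict the arrows and the bounds on the angles.
  rcases perm_cases τ with rfl | rfl | rfl | rfl | rfl | rfl
  · have e : D' = D.shift (D'.p - D.p) := by
      ext
      · exact a0
      · exact a2
      · rw [map_one, one_mul] at hsign
        exact congrArg (fun e : ℤˣ => (e : ℤ)) hsign
      · simp [BeltState.shift]
    rw [relabel_one, ← e]
  · simp [angles, arrow, Equiv.swap_apply_of_ne_of_ne] at a0 a1 a2 q01 q12 q02 hsign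
    have hC : D.C = n := by omega
    have hC' : D'.C = n := by omega
    have hA : D.A = n - D'.A := by omega
    have ha' := h'.admissible hn
    have hcos : 0 < Real.cos (D'.A * unitAngle n) := (cos_pos_iff hn (by omega)).2 (by omega)
    simp only [toSeed, BeltState.shift]
    rw [hC', hC, hn2, F.seed_relabel_source ha'.sin_pos.ne' hcos.ne', ← hsign, hA, ep,
      Nat.cast_sub l1', sub_mul, hn2]
    simp
  · simp [angles, arrow, Equiv.swap_apply_of_ne_of_ne] at a0 a1 a2 q01 q12 q02 hsign
    have hA : D.A = n := by omega
    have hA' : D'.A = n := by omega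
    have hC : D.C = n - D'.C := by omega
    simp only [toSeed, BeltState.shift]
    rw [hA', hA, hn2, F.seed_relabel_sink, ← hsign, hC, ep, Nat.cast_sub l2', sub_mul, hn2]
    simp
  · simp [angles, arrow, Equiv.swap_apply_of_ne_of_ne] at a0 a1 a2 q01 q12 q02
    omega
  · simp [angles, arrow] at a0 a1 a2 q01 q12 q02
    omega
  · simp [angles, arrow, i0, i1, i2] at a0 a1 a2 q01 q12 q02
    omega

/-- Sides 0 and 2 are never parallel, as sin(a + c) > 0. Fixing both determines the translation. -/
lemma translate_toSeed_injective (hn : 2 ≤ n) (h : D.Good n) {w : Plane}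
    (hw : (D.toSeed F n).translate w = D.toSeed F n) : w = 0 := by
  have ha := h.admissible hn
  have h0 := ha.sin_add_pos
  have hs := sign_sq D.s
  have key : ∀ x y c, (F.aff x y c).translate w = F.aff x y c →
      x * inner ℝ F.dir w + y * inner ℝ F.perp w = (0 : ℝ) := by
    intro x y c hc
    have h1 := congrArg Prod.snd hc
    simp only [AffineForm.translate, sub_eq_self] at h1
    simp only [BeltFrame.aff, real_inner_smul_left, inner_add_left] at h1
    exact (mul_eq_zero.1 h1).resolve_left (by norm_num)
  have k0 := key _ _ _ (congrFun (congrArg LabelledSeed.v hw) 0)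
  have k2 := key _ _ _ (congrFun (congrArg LabelledSeed.v hw) 2)
  rw [Real.sin_add] at h0
  set x : ℝ := inner ℝ F.dir w
  set y : ℝ := inner ℝ F.perp w
  set sa := Real.sin (D.A * unitAngle n)
  set ca := Real.cos (D.A * unitAngle n)
  set sc := Real.sin (D.C * unitAngle n)
  set cc := Real.cos (D.C * unitAngle n)
  set s : ℝ := ((D.s : ℤ) : ℝ)
  have hx : (sa * cc + ca * sc) * x = 0 := by
    linear_combination (cc * k0 - ca * k2)
  have hy : (sa * cc + ca * sc) * y = 0 := by
    linear_combination s * (sc * k0 + sa * k2) - (sa * cc + ca * sc) * y * hs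
  exact F.eq_zero_of_inner_eq_zero ((mul_eq_zero.1 hx).resolve_left h0.ne')
    ((mul_eq_zero.1 hy).resolve_left h0.ne')

end BeltState

/-! ### Links between states and the displacements they produce -/

namespace BeltState

variable {n : ℕ} {D D' : BeltState}

lemma Good.of_linked (hn : 2 ≤ n) (h : Linked n D D') : D.Good n ↔ D'.Good n := by
  induction h with
  | rel D D' h =>
    obtain ⟨h, k, rfl⟩ := h
    exact ⟨fun _ => h.step hn k, fun _ => h⟩
  | refl D => rfl
  | symm _ _ _ ih => exact ih.symm
  | trans _ _ _ _ _ ih ih' => exact ih.trans ih'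

/-- The Euclidean algorithm connects every state to an infinite region. -/
lemma exists_linked_strip (hn : 2 ≤ n) (h : D.Good n) :
    ∃ p, Linked n D ⟨Nat.gcd D.A D.C, 0, D.s, p⟩ := by
  induction hN : D.A + D.C using Nat.strong_induction_on generalizing D with
  | _ N ih =>
    subst hN
    rcases Nat.eq_zero_or_pos D.C with h0 | h0
    · refine ⟨D.p, ?_⟩
      have e : D = ⟨Nat.gcd D.A D.C, 0, D.s, D.p⟩ := by
        ext <;> simp [h0]
      rw [← e]
      exact .refl _
    · have h1 := h.step hn 1
      have l := Linked.step h 1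
      have hp := h.pos
      by_cases hc : D.A ≤ D.C
      · have e : D.step n 1 = ⟨D.A, D.C - D.A, D.s, D.p⟩ := if_pos hc
        rw [e] at h1 l
        obtain ⟨p, hl⟩ := ih (D.A + (D.C - D.A)) (by omega) h1 rfl
        simp only [Nat.gcd_sub_self_right hc] at hl
        exact ⟨p, l.trans hl⟩
      · have e : D.step n 1 = ⟨D.A - D.C, D.C, D.s, _⟩ := if_neg hc
        rw [e] at h1 l
        obtain ⟨p, hl⟩ := ih (D.A - D.C + D.C) (by omega) h1 rfl
        simp only [Nat.gcd_sub_self_left (not_le.1 hc).le] at hl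
        exact ⟨p, l.trans hl⟩

/-- All infinite regions are linked, up to translations and changes of the orientation. -/
lemma exists_linked_strip_of_coprime (hn : 2 ≤ n) (h : D.Good n) (hD : Nat.gcd D.A D.C = 1) {g : ℕ}
    (hg0 : 0 < g) (hg : g < n) (hg1 : Nat.Coprime g (2 * n)) :
    ∃ s p, Linked n D ⟨g, 0, s, p⟩ := by
  obtain ⟨p, hp⟩ := exists_linked_strip hn h
  rw [hD] at hp
  have hk : n / g * g ≤ n := Nat.div_mul_le_self n g
  have hk' : n < g + n / g * g := by
    have := Nat.lt_div_mul_add (a := n) hg0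
    omega
  -- Both angles are multiples of g, so the Euclidean algorithm ends at the region with angle g. The
  -- second one is the largest multiple of g up to n, so the source mutation is a rotation and
  -- brings in the angle 2n − g − ⌊n/g⌋g, which is coprime to g. From there the algorithm ends at
  -- the region with angle 1, which `D` also reaches.
  have hE : Good n ⟨g, n / g * g, 1, 0⟩ :=
    ⟨hg0, hg.le, hk, fun d d1 _ d3 => Nat.eq_one_of_dvd_one (hg1 ▸ Nat.dvd_gcd d1 d3)⟩
  obtain ⟨p1, h1⟩ := exists_linked_strip hn hE
  have e : step n 0 ⟨g, n / g * g, 1, 0⟩ = ⟨2 * n - g - n / g * g, g, -1, _⟩ :=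
    if_pos hk'.le
  have l := Linked.step hE 0
  have hE' := hE.step hn 0
  rw [e] at hE' l
  obtain ⟨p2, h2⟩ := exists_linked_strip hn hE'
  simp only [Nat.gcd_mul_left_right] at h1
  have e2 : Nat.gcd (2 * n - g - n / g * g) g = 1 := by
    have e3 : 2 * n - g - n / g * g + (n / g + 1) * g = 2 * n := by
      rw [add_mul]
      omega
    have : Nat.gcd (2 * n - g - n / g * g + (n / g + 1) * g) g = 1 := by
      rw [e3]
      exact hg1.symm
    rwa [Nat.gcd_add_mul_right_left] at this
  simp only [e2] at h2
  -- Links are compatible with flips and shifts. The flip matches the orientation −1 of this chain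
  -- with that of `D`, and the shift matches the positions.
  have h3 := ((h2.symm.trans (l.symm.trans h1)).flip (-D.s)).shift (p - p2)
  simp only [flip, BeltState.shift, neg_mul_neg, mul_one, add_sub_cancel] at h3
  exact ⟨_, _, hp.trans h3⟩

/-- The group of the translations along the belt line that preserve the class of a state. -/
def shiftGroup (n : ℕ) (D : BeltState) : AddSubgroup ℝ where
  carrier := {w | Linked n D (D.shift w)}
  zero_mem' := by
    have : D.shift 0 = D := by ext <;> simp [BeltState.shift]
    change Linked n D (D.shift 0)
    rw [this]
    exact .refl _
  add_mem' := by
    intro w z hw hz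
    have e : (D.shift w).shift z = D.shift (w + z) := by ext <;> simp [BeltState.shift, add_assoc]
    have := hz.trans (Linked.shift hw z)
    rwa [e] at this
  neg_mem' := by
    intro w hw
    have e : (D.shift w).shift (-w) = D := by ext <;> simp [BeltState.shift]
    have := Linked.shift hw (-w)
    rw [e] at this
    exact this.symm

/-- States with equal angles and orientation in the class of `D` differ by an element of its group
of translations. -/
lemma sub_mem_shiftGroup {E E' : BeltState} (h : Linked n D E) (h' : Linked n D E')
    (hE : E' = E.shift (E'.p - E.p)) : E'.p - E.p ∈ shiftGroup n D := by
  rw [hE] at h'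
  exact h'.trans (h.shift _).symm

/-- In the infinite region with angles (g, 0), the mutation at side 0 adds the angle 0 to g. It
keeps the shape and orientation and moves the region by cos 0 / sin²(gα). -/
lemma inv_sin_sq_mem_shiftGroup (hn : 2 ≤ n) (h : D.Good n) (hD : Nat.gcd D.A D.C = 1) {g : ℕ}
    (hg0 : 0 < g) (hg : g < n) (hg1 : Nat.Coprime g (2 * n)) :
    1 / Real.sin (g * unitAngle n) ^ 2 ∈ shiftGroup n D := by
  obtain ⟨s, p, hl⟩ := exists_linked_strip_of_coprime hn h hD hg0 hg hg1
  have hG := (Good.of_linked hn hl).1 h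
  have l := hl.trans (Linked.step hG 0)
  have e : step n 0 ⟨g, 0, s, p⟩ = ⟨g, 0, s, p - footShift n 0 g g⟩ := if_neg (by simpa using hg)
  rw [e] at l
  have := sub_mem_shiftGroup l hl (by ext <;> simp [BeltState.shift])
  simpa [footShift, sq] using this

/-- The field generated by the roots of unity of order `2n`. -/
def cyclotomicSubfield (n : ℕ) : IntermediateField ℚ ℂ :=
  IntermediateField.adjoin ℚ {Complex.exp (2 * Complex.I * unitAngle n)}

/-- The space of the real numbers in the field of the roots of unity of order `2n`. -/
def realCyclotomic (n : ℕ) : Submodule ℚ ℝ :=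
  (cyclotomicSubfield n).toSubmodule.comap (Complex.ofRealAm.restrictScalars ℚ).toLinearMap

lemma mem_realCyclotomic {x : ℝ} : x ∈ realCyclotomic n ↔ (x : ℂ) ∈ cyclotomicSubfield n := Iff.rfl

lemma one_mem_realCyclotomic : (1 : ℝ) ∈ realCyclotomic n := by
  rw [mem_realCyclotomic, Complex.ofReal_one]
  exact one_mem _

/-- A cotangent is i times a rational function of a root of unity of order dividing 2n. In a product
of two, the factors i combine to a rational number. -/
lemma cotCot_mem (a b : ℕ) : cotCot n a b ∈ realCyclotomic n := by
  have hz : ∀ k : ℕ, Complex.exp (2 * Complex.I * (k * unitAngle n)) ∈ cyclotomicSubfield n := by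
    intro k
    have : Complex.exp (2 * Complex.I * (k * unitAngle n))
        = Complex.exp (2 * Complex.I * unitAngle n) ^ k := by
      rw [← Complex.exp_nat_mul]
      congr 1
      ring
    rw [this]
    exact pow_mem (IntermediateField.mem_adjoin_simple_self ℚ _) k
  have e : (cotCot n a b : ℂ) = Complex.cot (a * unitAngle n) * Complex.cot (b * unitAngle n) := by
    simp only [cotCot, Complex.cot]
    push_cast
    rw [div_mul_div_comm]
  rw [mem_realCyclotomic, e, Complex.cot_eq_exp_ratio, Complex.cot_eq_exp_ratio, div_mul_div_comm,
    mul_mul_mul_comm Complex.I, Complex.I_mul_I]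
  have h1 := one_mem (cyclotomicSubfield n)
  exact div_mem (mul_mem (add_mem (hz a) h1) (add_mem (hz b) h1))
    (mul_mem (neg_mem h1) (mul_mem (sub_mem h1 (hz a)) (sub_mem h1 (hz b))))

/-- The angle c is the difference of a and b, so this is the addition theorem for cos(a − b) divided
by sin a sin b. -/
lemma footShift_eq {a b c : ℕ} (ha : Real.sin (a * unitAngle n) ≠ 0)
    (hb : Real.sin (b * unitAngle n) ≠ 0) (h : a + c = b ∨ b + c = a) :
    footShift n c a b = cotCot n a b + 1 := by
  rw [footShift, cotCot, div_add_one (mul_ne_zero ha hb)]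
  congr 1
  rcases h with rfl | rfl
  · rw [← Real.cos_sub, ← Real.cos_neg]
    congr 1
    push_cast
    ring
  · rw [← Real.cos_sub]
    congr 1
    push_cast
    ring

lemma sub_mem_realCyclotomic (hn : 2 ≤ n) (h : Linked n D D') :
    D'.p - D.p ∈ realCyclotomic n := by
  induction h with
  | rel D D' h =>
    obtain ⟨h, k, rfl⟩ := h
    have h1 := h.step hn k
    have h2 := (h.admissible hn).sin_pos.ne'
    have h3 := (h1.admissible hn).sin_pos.ne'
    match k with
    | 0 =>
      by_cases hc : n ≤ D.A + D.C
      · have e : D.step n 0 = ⟨_, _, _, D.p - 1 + cotCot n D.A (2 * n - D.A - D.C)⟩ := if_pos hc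
        rw [e]
        convert sub_mem (cotCot_mem D.A (2 * n - D.A - D.C)) one_mem_realCyclotomic using 1
        ring
      · have e : D.step n 0 = ⟨_, _, _, D.p - footShift n D.C D.A (D.A + D.C)⟩ := if_neg hc
        rw [e] at h3 ⊢
        simp only
        rw [footShift_eq h2 h3 (Or.inl rfl)]
        convert neg_mem (add_mem (cotCot_mem D.A (D.A + D.C)) one_mem_realCyclotomic) using 1
        ring
    | 1 =>
      by_cases hc : D.A ≤ D.C
      · have e : D.step n 1 = ⟨_, _, _, D.p⟩ := if_pos hc
        rw [e, sub_self]
        exact zero_mem _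
      · have e : D.step n 1 = ⟨_, _, _, D.p + footShift n D.C D.A (D.A - D.C)⟩ := if_neg hc
        rw [e] at h3 ⊢
        simp only
        rw [footShift_eq h2 h3 (Or.inr (Nat.sub_add_cancel (not_le.1 hc).le)),
          add_sub_cancel_left]
        exact add_mem (cotCot_mem D.A (D.A - D.C)) one_mem_realCyclotomic
    | 2 =>
      by_cases hc : n ≤ D.A + D.C
      · have e : D.step n 2 = ⟨_, _, _, D.p + 1 - cotCot n D.A D.C⟩ := if_pos hc
        rw [e]
        convert sub_mem one_mem_realCyclotomic (cotCot_mem D.A D.C) using 1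
        ring
      · have e : D.step n 2 = ⟨_, _, _, D.p⟩ := if_neg hc
        rw [e, sub_self]
        exact zero_mem _
  | refl D => simp
  | symm D D' _ ih => simpa using neg_mem ih
  | trans D D' D'' _ _ ih ih' => simpa using add_mem ih ih'

end BeltState

/-! ### Cyclotomic bounds for the rank -/

namespace BeltState

variable {n : ℕ}

lemma exp_unitAngle_isPrimitiveRoot (hn : 2 ≤ n) :
    IsPrimitiveRoot (Complex.exp (2 * Complex.I * unitAngle n)) (2 * n) := by
  have h := Complex.isPrimitiveRoot_exp (2 * n) (by omega)
  have e : 2 * Complex.I * unitAngle n = 2 * Real.pi * Complex.I / ((2 * n : ℕ) : ℂ) := by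
    rw [unitAngle]
    push_cast
    ring
  rwa [e]

lemma finrank_cyclotomicSubfield (hn : 2 ≤ n) :
    FiniteDimensional ℚ (cyclotomicSubfield n) ∧
      Module.finrank ℚ (cyclotomicSubfield n) = Nat.totient (2 * n) := by
  have hζ := exp_unitAngle_isPrimitiveRoot hn
  have hint := (hζ.isIntegral (by omega)).tower_top (A := ℚ)
  refine ⟨IntermediateField.adjoin.finiteDimensional hint, ?_⟩
  rw [cyclotomicSubfield, IntermediateField.adjoin.finrank hint,
    ← Polynomial.cyclotomic_eq_minpoly_rat hζ (by omega), Polynomial.natDegree_cyclotomic]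

/-- The space of real numbers in the cyclotomic field has at most half the dimension. -/
lemma finrank_realCyclotomic_le (hn : 2 ≤ n) :
    FiniteDimensional ℚ (realCyclotomic n) ∧
      2 * Module.finrank ℚ (realCyclotomic n) ≤ Nat.totient (2 * n) := by
  obtain ⟨hfin, hrank⟩ := finrank_cyclotomicSubfield hn
  set ζ := Complex.exp (2 * Complex.I * unitAngle n) with hζ
  have hζK : ζ ∈ cyclotomicSubfield n := IntermediateField.mem_adjoin_simple_self ℚ _
  have him : ζ.im ≠ 0 := by
    have e : 2 * Complex.I * unitAngle n = ((2 * unitAngle n : ℝ) : ℂ) * Complex.I := by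
      push_cast
      ring
    rw [hζ, e, Complex.exp_ofReal_mul_I_im]
    have h1 := Good.mul_unitAngle hn
    have h2 := Good.unitAngle_pos hn
    have h3 : (2 : ℝ) ≤ n := by exact_mod_cast hn
    refine (Real.sin_pos_of_pos_of_lt_pi (by linarith) ?_).ne'
    nlinarith [Real.pi_pos]
  have hreal : ∀ x : realCyclotomic n, ((x : ℝ) : ℂ) ∈ cyclotomicSubfield n := fun x => x.2
  -- The root of unity ζ is not real, so W + Wζ is direct for the space W of real elements: two
  -- copies of W fit into the field.
  let f : realCyclotomic n × realCyclotomic n →ₗ[ℚ] cyclotomicSubfield n :=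
    { toFun := fun x => ⟨((x.1 : ℝ) : ℂ) + ((x.2 : ℝ) : ℂ) * ζ,
        add_mem (hreal _) (mul_mem (hreal _) hζK)⟩
      map_add' := by
        intro x y
        ext1
        simp
        ring
      map_smul' := by
        intro c x
        ext1
        simp [Algebra.smul_def]
        ring }
  have hf : Function.Injective f := by
    rw [← LinearMap.ker_eq_bot, LinearMap.ker_eq_bot']
    rintro ⟨x, y⟩ h
    have h' : ((x : ℝ) : ℂ) + ((y : ℝ) : ℂ) * ζ = 0 := congrArg Subtype.val h
    have h1 := congrArg Complex.im h'
    have h2 := congrArg Complex.re h'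
    simp [him] at h1
    simp [h1] at h2
    ext
    · simp [h2]
    · simp [h1]
  have hW : FiniteDimensional ℚ (realCyclotomic n) := by
    refine FiniteDimensional.of_injective (f ∘ₗ LinearMap.inl ℚ _ _) ?_
    exact hf.comp LinearMap.inl_injective
  refine ⟨hW, ?_⟩
  have := LinearMap.finrank_le_finrank_of_injective hf
  rw [Module.finrank_prod, hrank] at this
  omega

/-- The positive integers below `n` that are coprime to `2n`. -/
def halfUnits (n : ℕ) : Finset ℕ := {g ∈ Finset.range n | Nat.Coprime g (2 * n)}

lemma mem_halfUnits {g : ℕ} : g ∈ halfUnits n ↔ g < n ∧ Nat.Coprime g (2 * n) := by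
  simp [halfUnits]

lemma pos_of_mem_halfUnits {g : ℕ} (hg : g ∈ halfUnits n) : 0 < g := by
  rcases Nat.eq_zero_or_pos g with rfl | h
  · have := (mem_halfUnits.1 hg).2
    simp at this
  · exact h

/-- The units modulo 2n are paired by g ↦ 2n − g. The midpoint n is not a unit, because n ≥ 2. -/
lemma card_halfUnits (hn : 2 ≤ n) : Nat.totient (2 * n) = 2 * (halfUnits n).card := by
  have hinj : Set.InjOn (fun g => 2 * n - g) (halfUnits n) := by
    intro a ha b hb h
    have h1 := (mem_halfUnits.1 ha).1
    have h2 := (mem_halfUnits.1 hb).1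
    simp only at h
    omega
  have hcop : ∀ a, a ≤ 2 * n → (Nat.Coprime (2 * n - a) (2 * n) ↔ Nat.Coprime a (2 * n)) := by
    intro a ha
    rw [Nat.coprime_self_sub_left ha]
  have hdisj : Disjoint (halfUnits n) ((halfUnits n).image fun g => 2 * n - g) := by
    rw [Finset.disjoint_left]
    intro a ha hb
    obtain ⟨b, hb', rfl⟩ := Finset.mem_image.1 hb
    have h1 := (mem_halfUnits.1 ha).1
    have h2 := (mem_halfUnits.1 hb').1
    omega
  rw [two_mul (Finset.card _)]
  nth_rw 2 [← Finset.card_image_of_injOn hinj]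
  rw [← Finset.card_union_of_disjoint hdisj, Nat.totient_eq_card_coprime]
  congr 1
  ext a
  simp only [Finset.mem_filter, Finset.mem_range, Finset.mem_union, Finset.mem_image,
    mem_halfUnits]
  constructor
  · rintro ⟨h1, h2⟩
    rcases lt_trichotomy a n with h | rfl | h
    · exact Or.inl ⟨h, h2.symm⟩
    · have := Nat.Coprime.eq_one_of_dvd h2.symm ⟨2, by ring⟩
      omega
    · exact Or.inr ⟨2 * n - a, ⟨by omega, (hcop a h1.le).2 h2.symm⟩, by omega⟩
  · rintro (⟨h1, h2⟩ | ⟨b, ⟨h1, h2⟩, rfl⟩)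
    · exact ⟨by omega, h2.symm⟩
    · have h0 := pos_of_mem_halfUnits (mem_halfUnits.2 ⟨h1, h2⟩)
      exact ⟨by omega, ((hcop b (by omega)).2 h2).symm⟩

/-- Telescoping, by (2m + 3)² ≥ 4(m + 1)(m + 2). -/
lemma sum_inv_odd_sq_le (N : ℕ) :
    ∑ m ∈ Finset.range N, 1 / (2 * (m : ℝ) + 3) ^ 2 ≤ 1 / 4 - 1 / (4 * ((N : ℝ) + 1)) := by
  induction N with
  | zero => norm_num
  | succ N ih =>
    rw [Finset.sum_range_succ]
    have : 1 / (2 * (N : ℝ) + 3) ^ 2 ≤ 1 / (4 * ((N : ℝ) + 1)) - 1 / (4 * ((N : ℝ) + 1 + 1)) := by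
      rw [div_sub_div _ _ (by positivity) (by positivity), div_le_div_iff₀ (by positivity)
        (by positivity)]
      nlinarith
    push_cast
    linarith

/-- The inverse square of the sine of a multiple of the unit angle. -/
def invSinSq (n k : ℕ) : ℝ := 1 / Real.sin (k * unitAngle n) ^ 2

lemma invSinSq_nonneg (k : ℕ) : 0 ≤ invSinSq n k := by
  rw [invSinSq]
  positivity

/-- The value at `1` dominates the sum of all other values. -/
lemma sum_invSinSq_lt (hn : 2 ≤ n) :
    ∑ g ∈ (halfUnits n).erase 1, invSinSq n g < invSinSq n 1 := by
  have hα := Good.unitAngle_pos hn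
  have hπ := Real.pi_pos
  have hn0 : (0 : ℝ) < n := by positivity
  have h1 : ∀ g ∈ (halfUnits n).erase 1, invSinSq n g ≤ (n : ℝ) ^ 2 * (1 / (g : ℝ) ^ 2) := by
    intro g hg
    obtain ⟨_, hg⟩ := Finset.mem_erase.1 hg
    have h0 : (0 : ℝ) < g := by exact_mod_cast pos_of_mem_halfUnits hg
    have hle := (Good.mul_le_iff hn g).2 (mem_halfUnits.1 hg).1.le
    -- Jordan's inequality sin x ≥ 2x/π on [0, π/2].
    have hs := Real.mul_le_sin (x := g * unitAngle n) (by positivity) hle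
    have e : 2 / Real.pi * (g * unitAngle n) = g / n := by
      rw [unitAngle]
      field_simp
    rw [e] at hs
    have e2 : (n : ℝ) ^ 2 * (1 / (g : ℝ) ^ 2) = 1 / ((g : ℝ) / n) ^ 2 := by
      field_simp
    rw [e2, invSinSq]
    gcongr
  have h2 : ∑ g ∈ (halfUnits n).erase 1, 1 / (g : ℝ) ^ 2 ≤ 1 / 4 := by
    -- Numbers coprime to 2n are odd, so after removing 1 they are at least 3.
    have hsub : (halfUnits n).erase 1 ⊆ (Finset.range n).image fun m => 2 * m + 3 := by
      intro g hg
      obtain ⟨hg1, hg⟩ := Finset.mem_erase.1 hg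
      obtain ⟨hlt, hc⟩ := mem_halfUnits.1 hg
      have hodd : Odd g := Nat.Coprime.odd_of_right (hc.symm.coprime_mul_right).symm 
      obtain ⟨m, rfl⟩ := hodd
      exact Finset.mem_image.2 ⟨m - 1, Finset.mem_range.2 (by omega), by omega⟩
    refine (Finset.sum_le_sum_of_subset_of_nonneg hsub fun _ _ _ => by positivity).trans ?_
    rw [Finset.sum_image fun a _ b _ h => by simpa using h]
    have := sum_inv_odd_sq_le n
    have h3 : (0 : ℝ) ≤ 1 / (4 * (n + 1)) := by positivity
    push_cast
    linarith
  have h3 : (4 : ℝ) * n ^ 2 / Real.pi ^ 2 ≤ invSinSq n 1 := by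
    have hs := Real.sin_le hα.le
    have hp : 0 < Real.sin (unitAngle n) := by
      refine Real.sin_pos_of_pos_of_lt_pi hα ?_
      have := (Good.mul_le_iff hn 1).2 (by omega)
      simp at this
      linarith
    have e : (4 : ℝ) * n ^ 2 / Real.pi ^ 2 = 1 / unitAngle n ^ 2 := by
      rw [unitAngle]
      field_simp
      norm_num
    rw [e, invSinSq, Nat.cast_one, one_mul]
    gcongr
  -- The other terms sum to at most n²/4, and the term at 1 is at least 1/α² = 4n²/π²; π < 4
  -- separates them.
  have h4 : (n : ℝ) ^ 2 * (1 / 4) < 4 * n ^ 2 / Real.pi ^ 2 := by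
    have hπ4 := Real.pi_lt_four
    have : Real.pi ^ 2 < 16 := by nlinarith
    rw [lt_div_iff₀ (by positivity)]
    nlinarith [sq_pos_of_pos hn0]
  calc _ ≤ ∑ g ∈ (halfUnits n).erase 1, (n : ℝ) ^ 2 * (1 / (g : ℝ) ^ 2) := Finset.sum_le_sum h1
    _ = (n : ℝ) ^ 2 * ∑ g ∈ (halfUnits n).erase 1, 1 / (g : ℝ) ^ 2 := by rw [Finset.mul_sum]
    _ ≤ (n : ℝ) ^ 2 * (1 / 4) := by gcongr
    _ < _ := h4.trans_le h3

lemma invSinSq_eq_exp (k : ℕ) : (invSinSq n k : ℂ)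
    = -4 * Complex.exp (2 * Complex.I * unitAngle n) ^ k
      / (1 - Complex.exp (2 * Complex.I * unitAngle n) ^ k) ^ 2 := by
  have e : Complex.exp (2 * Complex.I * unitAngle n) ^ k
      = Complex.exp (k * unitAngle n * Complex.I) ^ 2 := by
    rw [← Complex.exp_nat_mul, ← Complex.exp_nat_mul]
    congr 1
    push_cast
    ring
  rw [e, invSinSq]
  push_cast
  rw [Complex.sin, neg_mul, Complex.exp_neg]
  set w := Complex.exp (k * unitAngle n * Complex.I)
  have e2 : ((w⁻¹ - w) * Complex.I / 2) ^ 2 = (1 - w ^ 2) ^ 2 / (-4 * w ^ 2) := by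
    field_simp
    rw [Complex.I_sq]
    ring
  rw [e2, one_div_div]

/-- Galois conjugation of linear relations between the inverse squares of sines. -/
lemma sum_invSinSq_mul_eq_zero (hn : 2 ≤ n) {S : Finset ℕ} {c : ℕ → ℤ}
    (h : ∑ g ∈ S, (c g : ℝ) * invSinSq n g = 0) {b : ℕ} (hb : Nat.Coprime b (2 * n))
    (K : Type*) [Field K] [Algebra ℚ K] [IsCyclotomicExtension {2 * n} ℚ K] :
    ∑ g ∈ S, (c g : ℝ) * invSinSq n (g * b) = 0 := by
  have : NeZero (2 * n) := ⟨by omega⟩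
  have hζ := exp_unitAngle_isPrimitiveRoot hn
  set ζ := Complex.exp (2 * Complex.I * unitAngle n) with hζdef
  let z : K := IsCyclotomicExtension.zeta (2 * n) ℚ K
  have hz : IsPrimitiveRoot z (2 * n) := IsCyclotomicExtension.zeta_spec (2 * n) ℚ K
  have hemb : ∀ b, Nat.Coprime b (2 * n) → ∃ φ : K →ₐ[ℚ] ℂ, φ z = ζ ^ b := by
    intro b hb
    have hirr := Polynomial.cyclotomic.irreducible_rat (n := 2 * n) (by omega)
    let E := hz.embeddingsEquivPrimitiveRoots ℂ hirr
    have hmem : ζ ^ b ∈ primitiveRoots (2 * n) ℂ :=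
      (mem_primitiveRoots (by omega)).2 (hζ.pow_of_coprime b hb)
    refine ⟨E.symm ⟨ζ ^ b, hmem⟩, ?_⟩
    have := hz.embeddingsEquivPrimitiveRoots_apply_coe ℂ hirr (E.symm ⟨ζ ^ b, hmem⟩)
    rw [← this]
    exact congrArg Subtype.val (E.apply_symm_apply ⟨ζ ^ b, hmem⟩)
  -- One field element whose images under z ↦ ζ and z ↦ ζ^b are the two sums. A field embedding is
  -- injective, so if one image vanishes, so does the other.
  let β : K := ∑ g ∈ S, (c g : K) * (-4 * z ^ g / (1 - z ^ g) ^ 2)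
  have hval : ∀ b (φ : K →ₐ[ℚ] ℂ), φ z = ζ ^ b →
      φ β = ((∑ g ∈ S, (c g : ℝ) * invSinSq n (g * b) : ℝ) : ℂ) := by
    intro b φ hφ
    simp only [β, map_sum, map_mul, map_intCast, map_div₀, map_sub, map_pow, map_one, map_neg,
      map_ofNat, hφ]
    push_cast
    refine Finset.sum_congr rfl fun g _ => ?_
    rw [invSinSq_eq_exp, ← hζdef, ← pow_mul, mul_comm b]
  obtain ⟨φ, hφ⟩ := hemb 1 (Nat.coprime_one_left _)
  obtain ⟨ψ, hψ⟩ := hemb b hb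
  have h0 : φ β = 0 := by
    rw [hval 1 φ hφ]
    simp only [mul_one]
    rw [h, Complex.ofReal_zero]
  have hβ : β = 0 := (map_eq_zero φ).1 h0
  have h1 := hval b ψ hψ
  rw [hβ, map_zero] at h1
  exact_mod_cast h1.symm

lemma invSinSq_mod (hn : 2 ≤ n) (k : ℕ) : invSinSq n (k % (2 * n)) = invSinSq n k := by
  have h1 := Good.mul_unitAngle hn
  have e : (k : ℝ) * unitAngle n
      = ((k % (2 * n) : ℕ) : ℝ) * unitAngle n + (k / (2 * n) : ℕ) * Real.pi := by
    have h2 : ((k % (2 * n) + 2 * n * (k / (2 * n)) : ℕ) : ℝ) = k := by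
      rw [Nat.mod_add_div]
    rw [← h2]
    push_cast
    linear_combination 2 * ((k / (2 * n) : ℕ) : ℝ) * h1
  rw [invSinSq, invSinSq, e, Real.sin_add_nat_mul_pi, mul_pow, ← pow_mul, mul_comm _ 2, pow_mul]
  norm_num

lemma invSinSq_sub (hn : 2 ≤ n) {k : ℕ} (hk : k ≤ 2 * n) :
    invSinSq n (2 * n - k) = invSinSq n k := by
  have h1 := Good.mul_unitAngle hn
  have e : ((2 * n - k : ℕ) : ℝ) * unitAngle n = Real.pi - k * unitAngle n := by
    rw [Nat.cast_sub hk]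
    push_cast
    linear_combination 2 * h1
  rw [invSinSq, invSinSq, e, Real.sin_pi_sub]

/-- The inverse squares of the sines of the multiples of `π / 2n` coprime to `2n` are linearly
independent over the integers. -/
lemma eq_zero_of_sum_invSinSq_eq_zero (hn : 2 ≤ n) {c : ℕ → ℤ}
    (h : ∑ g ∈ halfUnits n, (c g : ℝ) * invSinSq n g = 0) : ∀ g ∈ halfUnits n, c g = 0 := by
  by_contra! hne
  obtain ⟨g₁, hg₁, hc₁⟩ := hne
  obtain ⟨g₀, hg₀, hmax⟩ := (halfUnits n).exists_max_image (fun g => |(c g : ℝ)|) ⟨g₁, hg₁⟩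
  have hpos : 0 < |(c g₀ : ℝ)| := (abs_pos.2 (by exact_mod_cast hc₁)).trans_le (hmax g₁ hg₁)
  -- Conjugating by the inverse of g₀ attaches the largest coefficient to the dominant value at 1.
  obtain ⟨b, hb⟩ := Nat.exists_mul_mod_eq_one_of_coprime (mem_halfUnits.1 hg₀).2 (by omega)
  have hb : g₀ * b % (2 * n) = 1 := hb.2
  have hbc : Nat.Coprime b (2 * n) := by
    refine Nat.coprime_of_mul_modEq_one g₀ ?_
    rw [mul_comm b, Nat.ModEq, hb, Nat.mod_eq_of_lt (by omega)]
  let : Algebra ℚ (CyclotomicField (2 * n) ℚ) := CyclotomicField.algebra (2 * n) ℚ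
  have hsum := sum_invSinSq_mul_eq_zero hn h hbc (CyclotomicField (2 * n) ℚ)
  -- Multiplication by b modulo 2n, folded below n by r ↦ 2n − r, under which sin² is invariant. It
  -- maps `halfUnits n` injectively to itself.
  let f : ℕ → ℕ := fun g => if g * b % (2 * n) < n then g * b % (2 * n) else 2 * n - g * b % (2 * n)
  have hmod : ∀ g, g * b % (2 * n) < 2 * n := fun g => Nat.mod_lt _ (by omega)
  have hf : ∀ g, invSinSq n (g * b) = invSinSq n (f g) := by
    intro g
    simp only [f]
    split_ifs
    · exact (invSinSq_mod hn _).symm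
    · rw [invSinSq_sub hn (hmod g).le, invSinSq_mod hn]
  have hf₀ : f g₀ = 1 := by
    simp only [f, hb]
    rw [if_pos (by omega)]
  have hcop : ∀ g ∈ halfUnits n, Nat.Coprime (g * b % (2 * n)) (2 * n) := by
    intro g hg
    rw [Nat.coprime_iff_gcd_eq_one, (Nat.mod_modEq (g * b) (2 * n)).gcd_eq]
    exact (mem_halfUnits.1 hg).2.mul_left hbc
  have hmem : ∀ g ∈ halfUnits n, f g ∈ halfUnits n := by
    intro g hg
    have h1 := hcop g hg
    have h2 := hmod g
    simp only [f, mem_halfUnits]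
    generalize g * b % (2 * n) = r at h1 h2
    split_ifs with hr
    · exact ⟨hr, h1⟩
    · have : r ≠ n := by
        rintro rfl
        have := Nat.Coprime.eq_one_of_dvd h1 ⟨2, by ring⟩
        omega
      exact ⟨by omega, (Nat.coprime_self_sub_left h2.le).2 h1⟩
  have hinj : Set.InjOn f (halfUnits n) := by
    intro g hg g' hg' hgg
    have l1 := (mem_halfUnits.1 hg).1
    have l2 := (mem_halfUnits.1 hg').1
    have p1 := pos_of_mem_halfUnits hg
    have h2 := hmod g
    have h2' := hmod g'
    have key : g * b % (2 * n) = g' * b % (2 * n) ∨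
        g * b % (2 * n) + g' * b % (2 * n) = 2 * n := by
      simp only [f] at hgg
      split_ifs at hgg <;> omega
    rcases key with h3 | h3
    · have h4 : g ≡ g' [MOD 2 * n] := Nat.ModEq.cancel_right_of_coprime hbc.symm h3
      exact Nat.ModEq.eq_of_lt_of_lt h4 (by omega) (by omega)
    · exfalso
      have h4 : (g + g') * b % (2 * n) = 0 := by
        rw [add_mul, Nat.add_mod, h3, Nat.mod_self]
      have h5 := hbc.symm.dvd_of_dvd_mul_right (Nat.dvd_of_mod_eq_zero h4)
      have := Nat.le_of_dvd (by omega) h5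
      omega
  have hlt : ∑ g ∈ (halfUnits n).erase g₀, invSinSq n (f g) < invSinSq n 1 := by
    refine lt_of_le_of_lt ?_ (sum_invSinSq_lt hn)
    rw [← Finset.sum_image (f := invSinSq n) (hinj.mono (by simp))]
    refine Finset.sum_le_sum_of_subset_of_nonneg ?_ fun _ _ _ => invSinSq_nonneg _
    intro r hr
    obtain ⟨g, hg, rfl⟩ := Finset.mem_image.1 hr
    obtain ⟨hg0, hg⟩ := Finset.mem_erase.1 hg
    refine Finset.mem_erase.2 ⟨fun h1 => hg0 (hinj hg hg₀ (h1.trans hf₀.symm)), hmem g hg⟩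
  simp only [hf] at hsum
  rw [← Finset.add_sum_erase _ _ hg₀, hf₀] at hsum
  have h1 : |(c g₀ : ℝ)| * invSinSq n 1 
      ≤ |(c g₀ : ℝ)| * ∑ g ∈ (halfUnits n).erase g₀, invSinSq n (f g) := by
    rw [← abs_of_nonneg (invSinSq_nonneg (n := n) 1), ← abs_mul, eq_neg_of_add_eq_zero_left hsum,
      abs_neg, Finset.mul_sum]
    refine (Finset.abs_sum_le_sum_abs _ _).trans (Finset.sum_le_sum fun g hg => ?_)
    rw [abs_mul, abs_of_nonneg (invSinSq_nonneg _)]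
    exact mul_le_mul_of_nonneg_right (hmax g (Finset.mem_of_mem_erase hg)) (invSinSq_nonneg _)
  exact absurd (le_of_mul_le_mul_left h1 hpos) (not_le.2 hlt)

end BeltState

namespace BeltState

variable {n : ℕ}

/-- The rank of a finitely generated group of real numbers in the cyclotomic field that contains
the inverse squares of the sines. -/
lemma finrank_eq_totient_div_two (hn : 2 ≤ n) (Λ : AddSubgroup ℝ) [Module.Finite ℤ Λ]
    (h1 : ∀ w ∈ Λ, w ∈ realCyclotomic n) (h2 : ∀ g ∈ halfUnits n, invSinSq n g ∈ Λ) :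
    Module.finrank ℤ Λ = Nat.totient (2 * n) / 2 := by
  have hcard := card_halfUnits hn
  obtain ⟨hfin, hle⟩ := finrank_realCyclotomic_le hn
  refine le_antisymm ?_ ?_
  · let b := Module.finBasis ℤ Λ
    let ι : Λ →ₗ[ℤ] realCyclotomic n :=
      AddMonoidHom.toIntLinearMap
        { toFun := fun w => ⟨w, h1 w w.2⟩, map_zero' := rfl, map_add' := fun _ _ => rfl }
    have hι : Function.Injective ι := fun x y h => Subtype.ext (congrArg (fun z : realCyclotomic n => (z : ℝ)) h)
    have hb : LinearIndependent ℤ (ι ∘ b) :=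
      b.linearIndependent.map' ι (LinearMap.ker_eq_bot.2 hι)
    -- Clearing denominators: a ℤ-basis stays independent over ℚ, so the rank is at most the
    -- dimension of the real cyclotomic space.
    have hb' : LinearIndependent ℚ (ι ∘ b) := (LinearIndependent.iff_fractionRing ℤ ℚ).1 hb
    have := hb'.fintype_card_le_finrank
    rw [Fintype.card_fin] at this
    omega
  · have hli : LinearIndependent ℤ fun g : halfUnits n => (⟨invSinSq n g, h2 g g.2⟩ : Λ) := by
      rw [Fintype.linearIndependent_iff]
      intro c hc
      have h3 := congrArg Subtype.val hc
      rw [AddSubgroup.val_finsetSum] at h3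
      let c' : ℕ → ℤ := fun g => if hg : g ∈ halfUnits n then c ⟨g, hg⟩ else 0
      have h4 : ∑ g ∈ halfUnits n, (c' g : ℝ) * invSinSq n g = 0 := by
        rw [← Finset.sum_coe_sort, ← AddSubgroup.coe_zero Λ, ← h3]
        refine Finset.sum_congr rfl fun g _ => ?_
        simp [c']
      intro g
      have := eq_zero_of_sum_invSinSq_eq_zero hn h4 g g.2
      simpa [c'] using this
    have := hli.fintype_card_le_finrank
    rw [Fintype.card_coe] at this
    omega

end BeltState

/-! ### The Švarc–Milnor lemma for graphs -/

section graphs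

namespace SimpleGraph

variable {V : Type*} {G : SimpleGraph V}

lemma dist_map_le (hG : G.Connected) (f : V → V) (hf : ∀ x y, G.Adj x y → G.Adj (f x) (f y))
    (x y : V) : G.dist (f x) (f y) ≤ G.dist x y := by
  obtain ⟨p, hp⟩ := hG.exists_walk_length_eq_dist x y
  let φ : G →g G := ⟨f, fun h => hf _ _ h⟩
  rw [← hp, ← Walk.length_map φ p]
  exact dist_le _

variable {L : Type*} [AddCommGroup L] [AddAction L V]

lemma dist_vadd (hG : G.Connected) (hadj : ∀ (g : L) x y, G.Adj x y → G.Adj (g +ᵥ x) (g +ᵥ y))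
    (g : L) (x y : V) : G.dist (g +ᵥ x) (g +ᵥ y) = G.dist x y := by
  refine le_antisymm (dist_map_le hG (g +ᵥ ·) (hadj g) x y) ?_
  simpa using dist_map_le hG (-g +ᵥ ·) (hadj (-g)) (g +ᵥ x) (g +ᵥ y)

lemma finite_ball (hG : G.Connected) (hfin : ∀ x, (G.neighborSet x).Finite) (v : V) (r : ℕ) :
    {x | G.dist x v ≤ r}.Finite := by
  have key : ∀ k, {x | ∃ p : G.Walk x v, p.length = k}.Finite := by
    intro k
    induction k with
    | zero =>
      refine (Set.finite_singleton v).subset ?_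
      rintro x ⟨p, hp⟩
      exact Walk.eq_of_length_eq_zero hp
    | succ k ih =>
      refine (ih.biUnion fun y _ => hfin y).subset ?_
      rintro x ⟨p, hp⟩
      cases p with
      | nil => simp at hp
      | cons h p =>
        rw [Walk.length_cons] at hp
        exact Set.mem_biUnion (show _ ∈ {x | ∃ p : G.Walk x v, p.length = k} from ⟨p, by omega⟩)
          h.symm
  refine ((Set.finite_Iic r).biUnion fun k _ => key k).subset ?_
  intro x hx
  obtain ⟨p, hp⟩ := hG.exists_walk_length_eq_dist x v
  exact Set.mem_biUnion (show G.dist x v ∈ Set.Iic r from hx) ⟨p, hp⟩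

lemma addCayley_connected {S : Set L} (hS : AddSubgroup.closure S = ⊤) :
    (addCayley S).Connected := by
  have key : ∀ g ∈ AddSubgroup.closure S, ∀ a, (addCayley S).Reachable a (a + g) := by
    intro g hg
    induction hg using AddSubgroup.closure_induction with
    | mem s hs =>
      intro a
      by_cases h : a = a + s
      · rw [← h]
      · exact Adj.reachable ((addCayley_adj' S _ _).2 ⟨h, s, hs, Or.inl rfl⟩)
    | zero => intro a; rw [add_zero]
    | add x y _ _ hx hy =>
      intro a
      rw [← add_assoc]
      exact (hx a).trans (hy _)
    | neg x _ hx =>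
      intro a
      have := (hx (a + -x)).symm
      rwa [neg_add_cancel_right] at this
  refine (connected_iff _).2 ⟨fun a b => ?_, ⟨0⟩⟩
  have := key (b - a) (hS ▸ AddSubgroup.mem_top _) a
  rwa [add_sub_cancel] at this

/-- A cocompact action of a commutative group on a connected graph by automorphisms whose orbit map
is at bounded distance from every vertex. -/
structure IsGeometricAction (L : Type*) [AddCommGroup L] [AddAction L V] (G : SimpleGraph V)
    (v : V) (c : ℕ) : Prop where
  connected : G.Connected
  adj : ∀ (g : L) x y, G.Adj x y → G.Adj (g +ᵥ x) (g +ᵥ y)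
  finite : ∀ x, (G.neighborSet x).Finite
  injective : Function.Injective fun g : L => g +ᵥ v
  cobounded : ∀ x, ∃ g : L, G.dist x (g +ᵥ v) ≤ c

namespace IsGeometricAction

variable {v : V} {c : ℕ}

/-- Properness of the action: balls are finite by local finiteness, and the orbit map is injective.
-/
lemma finite_displacement (h : IsGeometricAction L G v c) (r : ℕ) :
    {g : L | G.dist (g +ᵥ v) v ≤ r}.Finite :=
  (finite_ball h.connected h.finite v r).preimage h.injective.injOn

lemma dist_sub (h : IsGeometricAction L G v c) (g g' : L) :
    G.dist ((g - g') +ᵥ v) v = G.dist (g +ᵥ v) (g' +ᵥ v) := by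
  rw [← dist_vadd h.connected h.adj g', vadd_vadd, add_sub_cancel]

/-- Along a walk, orbit points close to the walk differ by boundedly many elements of bounded
displacement. -/
lemma walk_induction (h : IsGeometricAction L G v c) {P : L → L → ℕ → Prop}
    (hP : ∀ g g', G.dist ((g - g') +ᵥ v) v ≤ 2 * c + 1 → P g g' 1)
    (htrans : ∀ g g' g'' k l, P g g' k → P g' g'' l → P g g'' (k + l))
    {x y : V} (p : G.Walk x y) : ∀ g g' : L, G.dist x (g +ᵥ v) ≤ c → G.dist y (g' +ᵥ v) ≤ c →
      P g g' (p.length + 1) := by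
  induction p with
  | nil =>
    intro g g' hg hg'
    refine hP g g' ?_
    rw [h.dist_sub]
    rename_i u
    have := h.connected.dist_triangle (u := g +ᵥ v) (v := u) (w := g' +ᵥ v)
    rw [dist_comm (u := g +ᵥ v) (v := u)] at this
    omega
  | cons hadj p ih =>
    intro g g' hg hg'
    rename_i x z y
    -- An orbit point near the next vertex of the walk. It differs from the previous one by a
    -- displacement of at most c + 1 + c.
    obtain ⟨g₁, hg₁⟩ := h.cobounded z
    have h1 : P g g₁ 1 := by
      refine hP g g₁ ?_
      rw [h.dist_sub]
      have t1 := h.connected.dist_triangle (u := g +ᵥ v) (v := x) (w := g₁ +ᵥ v)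
      have t2 := h.connected.dist_triangle (u := x) (v := z) (w := g₁ +ᵥ v)
      rw [dist_comm (u := g +ᵥ v) (v := x)] at t1
      have := dist_eq_one_iff_adj.2 hadj
      omega
    have := htrans _ _ _ _ _ h1 (ih g₁ g' hg₁ hg')
    rwa [Walk.length_cons, add_comm]

/-- A group with a geometric action is finitely generated. -/
theorem fg (h : IsGeometricAction L G v c) : AddGroup.FG L := by
  let E := {g : L | G.dist (g +ᵥ v) v ≤ 2 * c + 1}
  rw [AddGroup.fg_iff]
  refine ⟨E, ?_, h.finite_displacement _⟩
  rw [eq_top_iff]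
  intro g _
  obtain ⟨p⟩ := h.connected.preconnected (g +ᵥ v) ((0 : L) +ᵥ v)
  have := h.walk_induction (P := fun g g' _ => g - g' ∈ AddSubgroup.closure E)
    (fun g g' hg => AddSubgroup.subset_closure hg)
    (fun g g' g'' _ _ h1 h2 => by simpa using add_mem h1 h2) p g 0 (by simp) (by simp)
  simpa using this

/-- The Švarc–Milnor lemma: the orbit map is a quasi-isometry. -/
theorem isQuasiIsometry (h : IsGeometricAction L G v c) {S : Set L} (hfin : S.Finite)
    (hS : AddSubgroup.closure S = ⊤) :
    IsQuasiIsometry (graphDist (addCayley S)) (graphDist G) fun g : L => g +ᵥ v := by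
  have hC := addCayley_connected hS
  have hCadj : ∀ g x y : L, (addCayley S).Adj x y → (addCayley S).Adj (g +ᵥ x) (g +ᵥ y) :=
    fun g x y hxy => (addCayley_adj_add_iff_right).2 hxy
  -- M bounds the displacement of the generators, and K the word length of the finitely many
  -- elements displacing by at most 2c + 1.
  obtain ⟨M, hM⟩ := (hfin.image fun s => G.dist (s +ᵥ v) v).bddAbove
  obtain ⟨K, hK⟩ := ((h.finite_displacement (2 * c + 1)).image
    fun g => (addCayley S).dist g 0).bddAbove
  have upper : ∀ g g', G.dist (g +ᵥ v) (g' +ᵥ v) ≤ M * (addCayley S).dist g g' := by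
    intro g g'
    obtain ⟨p, hp⟩ := hC.exists_walk_length_eq_dist g g'
    rw [← hp]
    clear hp
    induction p with
    | nil => simp
    | cons hadj p ih =>
      rename_i x z y
      have h1 : G.dist (x +ᵥ v) (z +ᵥ v) ≤ M := by
        obtain ⟨_, s, hs, rfl | rfl⟩ := (addCayley_adj' S _ _).1 hadj
        · rw [dist_comm, ← h.dist_sub, add_sub_cancel_left]
          exact hM ⟨s, hs, rfl⟩
        · rw [← h.dist_sub, add_sub_cancel_left]
          exact hM ⟨s, hs, rfl⟩
      have := h.connected.dist_triangle (u := x +ᵥ v) (v := z +ᵥ v) (w := y +ᵥ v)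
      rw [Walk.length_cons, mul_add, mul_one]
      omega
  have lower : ∀ g g', (addCayley S).dist g g' ≤ K * (G.dist (g +ᵥ v) (g' +ᵥ v) + 1) := by
    intro g g'
    obtain ⟨p, hp⟩ := h.connected.exists_walk_length_eq_dist (g +ᵥ v) (g' +ᵥ v)
    rw [← hp]
    refine h.walk_induction (P := fun g g' k => (addCayley S).dist g g' ≤ K * k)
      (fun g g' hg => ?_) (fun g g' g'' k l h1 h2 => ?_) p g g' (by simp) (by simp)
    · rw [mul_one, ← dist_vadd hC hCadj (-g'), vadd_eq_add, vadd_eq_add, neg_add_cancel,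
        neg_add_eq_sub]
      exact hK ⟨g - g', hg, rfl⟩
    · rw [mul_add]
      exact hC.dist_triangle.trans (add_le_add h1 h2)
  -- The 1 in the sum keeps the factor at least 1. The additive constant 1 absorbs the extra orbit
  -- step in `lower`.
  refine ⟨⟨1 + K + M, 1, ?_, zero_le_one, fun g g' => ?_⟩, c, by positivity, fun z => ?_⟩
  · have : (0 : ℝ) ≤ K := by positivity
    linarith
  · have h1 : (G.dist (g +ᵥ v) (g' +ᵥ v) : ℝ) ≤ M * (addCayley S).dist g g' := by
      exact_mod_cast upper g g'
    have h2 : ((addCayley S).dist g g' : ℝ) ≤ K * (G.dist (g +ᵥ v) (g' +ᵥ v) + 1) := by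
      exact_mod_cast lower g g'
    simp only [graphDist]
    constructor
    · rw [sub_le_iff_le_add, one_div, inv_mul_le_iff₀ (by positivity)]
      nlinarith
    · nlinarith
  · obtain ⟨g, hg⟩ := h.cobounded z
    exact ⟨g, by simpa only [graphDist, Nat.cast_le] using hg⟩

end IsGeometricAction

end SimpleGraph

end graphs

/-! ### Coordinates for the initial triangle -/

section triangle

variable (T : Affine.Triangle ℝ Plane)

/-- A point of a side is the foot of the altitude on this side if it is so by orthogonality. -/
lemma altitudeFoot_eq_of_inner_eq_zero {i j k : Fin 3} (hijk : ({i}ᶜ : Set (Fin 3)) = {j, k})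
    {q : Plane} (hq : q ∈ line[ℝ, T.points j, T.points k])
    (h : inner ℝ (T.points i - q) (T.points j - T.points k) = (0 : ℝ)) :
    T.altitudeFoot i = q := by
  have hr : Set.range (T.faceOpposite i).points = {T.points j, T.points k} := by
    rw [Affine.Simplex.range_faceOpposite_points, hijk, Set.image_pair]
  rw [Affine.Simplex.altitudeFoot, Affine.Simplex.orthogonalProjectionSpan,
    EuclideanGeometry.coe_orthogonalProjection_eq_iff_mem, hr]
  refine ⟨hq, ?_⟩
  rw [Submodule.mem_orthogonal, direction_affineSpan]
  intro v hv
  obtain ⟨r, rfl⟩ := mem_vectorSpan_pair.1 hv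
  rw [real_inner_smul_left, vsub_eq_sub, vsub_eq_sub, real_inner_comm, h, mul_zero]

lemma sideForm_eq_aff (F : BeltFrame) {i : Fin 3} {x y c r : ℝ} (hr : 0 < r)
    (hxy : x ^ 2 + y ^ 2 = 1)
    (h : T.points i - T.altitudeFoot i = r • (x • F.dir + y • F.perp))
    (hc : inner ℝ (x • F.dir + y • F.perp) (F.base - T.altitudeFoot i) = F.scale * c) :
    sideForm T i = F.aff x y c := by
  have hn : ‖x • F.dir + y • F.perp‖ = 1 := by
    rw [norm_eq_sqrt_real_inner, F.inner_comb, ← sq, ← sq, hxy, Real.sqrt_one]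
  have e : (√2 / ‖T.points i - T.altitudeFoot i‖) • (T.points i - T.altitudeFoot i)
      = √2 • (x • F.dir + y • F.perp) := by
    rw [h, norm_smul, hn, mul_one, Real.norm_of_nonneg hr.le, smul_smul,
      div_mul_cancel₀ _ hr.ne']
  refine Prod.ext e ?_
  simp only [sideForm, e, BeltFrame.aff]
  rw [inner_sub_right] at hc
  rw [← hc, real_inner_smul_left]
  simp only [inner_add_left, real_inner_smul_left]
  ring

end triangle

lemma mul_unitAngle_eq {n : ℕ} (hn : 2 ≤ n) : (n : ℝ) * (Real.pi / (2 * n)) = Real.pi / 2 := by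
  field_simp

/-- Coordinates for a right triangle. -/
lemma exists_right_triangle_frame {n : ℕ} (hn : 2 ≤ n) (T : Affine.Triangle ℝ Plane)
    (h₁ : ∠ (T.points 1) (T.points 0) (T.points 2) = Real.pi / (2 * n))
    (h₃ : ∠ (T.points 0) (T.points 2) (T.points 1) = n * (Real.pi / (2 * n))) :
    ∃ (e f : Plane) (l : ℝ), 0 < l ∧ inner ℝ e e = (1 : ℝ) ∧ inner ℝ f f = (1 : ℝ) ∧
      inner ℝ e f = (0 : ℝ) ∧ T.points 0 = T.points 2 + (l * Real.cos (unitAngle n)) • e ∧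
      T.points 1 = T.points 2 + (l * Real.sin (unitAngle n)) • f := by
  set a := T.points 0 - T.points 2 with ha
  set b := T.points 1 - T.points 2 with hb
  have hinj := T.independent.injective
  have ha0 : a ≠ 0 := sub_ne_zero.2 fun h => by simpa using hinj h
  have hb0 : b ≠ 0 := sub_ne_zero.2 fun h => by simpa using hinj h
  have hab : inner ℝ a b = (0 : ℝ) := by
    rw [mul_unitAngle_eq hn] at h₃
    exact InnerProductGeometry.inner_eq_zero_iff_angle_eq_pi_div_two _ _ |>.2 h₃
  have hna : 0 < ‖a‖ := norm_pos_iff.2 ha0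
  have hnb : 0 < ‖b‖ := norm_pos_iff.2 hb0
  have hα := BeltState.Good.unitAngle_pos hn
  have hsin : 0 < Real.sin (unitAngle n) := by
    refine Real.sin_pos_of_pos_of_lt_pi hα ?_
    have := (BeltState.Good.mul_le_iff hn 1).2 (by omega)
    simp at this
    linarith [Real.pi_pos]
  set l := ‖b - a‖ with hl
  have hl2 : l ^ 2 = ‖a‖ ^ 2 + ‖b‖ ^ 2 := by
    rw [hl, norm_sub_sq_real, real_inner_comm, hab]
    ring
  have hlpos : 0 < l := by
    have : 0 ≤ l := norm_nonneg _
    nlinarith [sq_pos_of_pos hna, sq_pos_of_pos hnb]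
  have hcos : ‖a‖ = l * Real.cos (unitAngle n) := by
    have h4 := InnerProductGeometry.cos_angle_mul_norm_mul_norm (T.points 1 - T.points 0)
      (T.points 2 - T.points 0)
    have e1 : T.points 1 - T.points 0 = b - a := by rw [ha, hb]; abel
    have e2 : T.points 2 - T.points 0 = - a := by rw [ha]; abel
    have e3 : InnerProductGeometry.angle (T.points 1 - T.points 0) (T.points 2 - T.points 0)
        = unitAngle n := h₁
    rw [e3, e1, e2, norm_neg, inner_neg_right, inner_sub_left, real_inner_comm, hab, zero_sub,
      neg_neg, real_inner_self_eq_norm_sq] at h4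
    have : ‖a‖ * ‖a‖ = (l * Real.cos (unitAngle n)) * ‖a‖ := by linarith
    exact mul_right_cancel₀ hna.ne' this
  have hsinb : ‖b‖ = l * Real.sin (unitAngle n) := by
    have h5 : ‖b‖ ^ 2 = (l * Real.sin (unitAngle n)) ^ 2 := by
      rw [hcos] at hl2
      linear_combination -hl2 - l ^ 2 * Real.sin_sq_add_cos_sq (unitAngle n)
    exact (sq_eq_sq₀ hnb.le (by positivity)).1 h5
  refine ⟨‖a‖⁻¹ • a, ‖b‖⁻¹ • b, l, hlpos, ?_, ?_, ?_, ?_, ?_⟩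
  · rw [real_inner_smul_left, real_inner_smul_right, real_inner_self_eq_norm_sq]
    field_simp
  · rw [real_inner_smul_left, real_inner_smul_right, real_inner_self_eq_norm_sq]
    field_simp
  · rw [real_inner_smul_left, real_inner_smul_right, hab, mul_zero, mul_zero]
  · rw [← hcos, smul_smul, mul_inv_cancel₀ hna.ne', one_smul, ha, add_sub_cancel]
  · rw [← hsinb, smul_smul, mul_inv_cancel₀ hnb.ne', one_smul, hb, add_sub_cancel]

/-- The state of the initial seed. -/
def initialState (n : ℕ) : BeltState := ⟨1, n - 1, 1, 0⟩

lemma initialState_good {n : ℕ} (hn : 2 ≤ n) : (initialState n).Good n where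
  pos := one_pos
  le := by simp only [initialState]; omega
  le' := by simp only [initialState]; omega
  coprime d hd _ _ := Nat.eq_one_of_dvd_one hd

/-- The initial seed is the seed of a state for a suitable frame. -/
theorem exists_frame_initialSeed {n : ℕ} (hn : 2 ≤ n) (T : Affine.Triangle ℝ Plane)
    (h₁ : ∠ (T.points 1) (T.points 0) (T.points 2) = Real.pi / (2 * n))
    (h₃ : ∠ (T.points 0) (T.points 2) (T.points 1) = n * (Real.pi / (2 * n))) :
    ∃ F : BeltFrame, F.IsAdapted (initialReferencePoint T) ∧
      initialSeed n T = ((initialState n).toSeed F n).relabel (Equiv.swap 1 2) := by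
  obtain ⟨e, f, l, hl, hee, hff, hef, h0, h1⟩ := exists_right_triangle_frame hn T h₁ h₃
  have hfe : inner ℝ f e = (0 : ℝ) := by rw [real_inner_comm]; exact hef
  have ha := (initialState_good hn).admissible hn
  have hs : 0 < Real.sin (unitAngle n) := by simpa [initialState] using ha.sin_pos
  have hA : (((initialState n).A : ℕ) : ℝ) * unitAngle n = unitAngle n := by simp [initialState]
  have hC : (((initialState n).C : ℕ) : ℝ) * unitAngle n = Real.pi / 2 - unitAngle n := by
    have := BeltState.Good.mul_unitAngle hn
    simp only [initialState]
    rw [Nat.cast_sub (by omega)]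
    push_cast
    linarith
  have hc : 0 < Real.cos (unitAngle n) := by
    have := BeltState.cos_pos_iff hn (k := 1) (by omega)
    rw [Nat.cast_one, one_mul] at this
    exact this.2 (by omega)
  have hB : Real.cos ((n - 1) * (Real.pi / (2 * n))) = Real.sin (unitAngle n) := by
    have : ((n : ℝ) - 1) * (Real.pi / (2 * n)) = Real.pi / 2 - unitAngle n := by
      rw [sub_mul, mul_unitAngle_eq hn, one_mul]
      rfl
    rw [this, Real.cos_pi_div_two_sub]
  have hB' : Real.cos (Real.pi / (2 * n)) = Real.cos (unitAngle n) := rfl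
  have hsc := Real.sin_sq_add_cos_sq (unitAngle n)
  have hsin2 := Real.sin_two_mul (unitAngle n)
  have hcos2 := Real.cos_two_mul (unitAngle n)
  set sa := Real.sin (unitAngle n) with hsa
  set ca := Real.cos (unitAngle n) with hca
  have hinner : ∀ x y x' y' : ℝ, inner ℝ (x • e + y • f) (x' • e + y' • f) = x * x' + y * y' := by
    intro x y x' y'
    simp only [inner_add_left, inner_add_right, real_inner_smul_left, real_inner_smul_right, hee,
      hff, hef, hfe]
    ring
  -- With the origin at A₃ and e, f along the legs, H lies in direction sin α e + cos α f. Its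
  -- mirror image in the leg A₃A₁ gives `dir`. The unit of length is the altitude A₃H, half the
  -- length of the billiard path.
  let F : BeltFrame :=
    { base := T.points 2
      dir := sa • e + (-ca) • f
      perp := ca • e + sa • f
      scale := l * sa * ca
      dir_dir := by rw [hinner]; linarith
      perp_perp := by rw [hinner]; linarith
      dir_perp := by rw [hinner]; ring
      scale_pos := by positivity }
  have hcomb : ∀ x y : ℝ, x • F.dir + y • F.perp = (x * sa + y * ca) • e + (y * sa - x * ca) • f := by
    intro x y
    simp only [F]
    module
  have f0 : T.altitudeFoot 0 = T.points 2 := by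
    refine altitudeFoot_eq_of_inner_eq_zero T (j := 1) (k := 2) (by ext i; fin_cases i <;> simp)
      (right_mem_affineSpan_pair ℝ _ _) ?_
    rw [h0, h1, add_sub_cancel_left, add_sub_cancel_left, real_inner_smul_left,
      real_inner_smul_right, hef, mul_zero, mul_zero]
  have f1 : T.altitudeFoot 1 = T.points 2 := by
    refine altitudeFoot_eq_of_inner_eq_zero T (j := 0) (k := 2) (by ext i; fin_cases i <;> simp)
      (right_mem_affineSpan_pair ℝ _ _) ?_
    rw [h0, h1, add_sub_cancel_left, add_sub_cancel_left, real_inner_smul_left,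
      real_inner_smul_right, hfe, mul_zero, mul_zero]
  have f2 : T.altitudeFoot 2 = T.points 2 + (l * sa * ca) • (sa • e + ca • f) := by
    refine altitudeFoot_eq_of_inner_eq_zero T (j := 0) (k := 1) (by ext i; fin_cases i <;> simp)
      ?_ ?_
    -- The foot H is at distance l cos²α from A₁ on the hypotenuse of length l.
    · have : T.points 2 + (l * sa * ca) • (sa • e + ca • f)
          = AffineMap.lineMap (T.points 0) (T.points 1) (ca ^ 2) := by
        rw [AffineMap.lineMap_apply_module, h0, h1]
        match_scalars
        · ring
        · linear_combination l * ca * hsc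
        · ring
      rw [this]
      exact AffineMap.lineMap_mem_affineSpan_pair _ _ _
    · have e1 : T.points 2 - (T.points 2 + (l * sa * ca) • (sa • e + ca • f))
          = (-(l * sa * ca * sa)) • e + (-(l * sa * ca * ca)) • f := by module
      have e2 : T.points 0 - T.points 1 = (l * ca) • e + (-(l * sa)) • f := by
        rw [h0, h1]
        module
      rw [e1, e2, hinner]
      ring
  refine ⟨F, ⟨rfl, l * sa * ca, by positivity, ?_⟩, ?_⟩
  · have hr : EuclideanGeometry.reflection line[ℝ, T.points 2, T.points 0] (T.altitudeFoot 2)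
        = T.points 2 + (l * sa * ca) • F.dir := by
      have e1 : T.altitudeFoot 2
          = ((l * sa * ca * ca) • f) +ᵥ (T.points 2 + (l * sa * ca * sa) • e) := by
        rw [f2, vadd_eq_add]
        module
      rw [e1, EuclideanGeometry.reflection_orthogonal_vadd]
      · simp only [F, vadd_eq_add]
        module
      · have : T.points 2 + (l * sa * ca * sa) • e
            = AffineMap.lineMap (T.points 2) (T.points 0) (sa ^ 2) := by
          rw [AffineMap.lineMap_apply_module, h0]
          module
        rw [this]
        exact AffineMap.lineMap_mem_affineSpan_pair _ _ _
      · rw [Submodule.mem_orthogonal, direction_affineSpan]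
        intro v hv
        obtain ⟨r, rfl⟩ := mem_vectorSpan_pair.1 hv
        rw [vsub_eq_sub, h0]
        simp [inner_smul_left, inner_smul_right, hef]
    change EuclideanGeometry.reflection line[ℝ, T.points 2, T.points 0] (T.altitudeFoot 2)
      - T.points 2 = _
    rw [hr, add_sub_cancel_left]
  · have hsgn : (((initialState n).s : ℤ) : ℝ) = 1 := by simp [initialState]
    have hp : (initialState n).p = 0 := rfl
    have e2 : Real.pi / 2 - unitAngle n - unitAngle n = Real.pi / 2 - 2 * unitAngle n := by ring
    have v0 : ((initialState n).toSeed F n).v 0 = F.aff sa ca 0 := by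
      rw [BeltState.toSeed, F.seed_v_zero, hA, hsgn, hp]
      exact F.aff_congr rfl (one_mul _) (by ring)
    have v1 : ((initialState n).toSeed F n).v 1 = F.aff (2 * ca ^ 2 - 1) (-(2 * sa * ca)) 1 := by
      rw [BeltState.toSeed, F.seed_v_one, hA, hC, hsgn, hp, e2, Real.cos_pi_div_two_sub,
        Real.cos_pi_div_two_sub, Real.sin_pi_div_two_sub]
      refine F.aff_congr hcos2 (by rw [hsin2]; ring) ?_
      rw [div_self hs.ne']
      ring
    have v2 : ((initialState n).toSeed F n).v 2 = F.aff (-ca) sa 0 := by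
      rw [BeltState.toSeed, F.seed_v_two, hA, hC, hsgn, hp, add_sub_cancel, Real.cos_pi_div_two,
        Real.cos_pi_div_two_sub, Real.sin_pi_div_two_sub]
      exact F.aff_congr rfl (one_mul _) (by simp)
    symm
    refine LabelledSeed.relabel_ext (fun i => ?_) ?_
    · match i with
      | 0 =>
        rw [Equiv.swap_apply_of_ne_of_ne (by decide) (by decide), v0]
        refine (sideForm_eq_aff T F (r := l * ca) (by positivity) hsc ?_ ?_).symm
        · rw [f0, h0, add_sub_cancel_left, hcomb]
          congr 1
          match_scalars <;> linarith
        · rw [f0]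
          simp [F]
      | 1 =>
        rw [Equiv.swap_apply_left, v2]
        refine (sideForm_eq_aff T F (r := l * sa) (by positivity) (by linarith) ?_ ?_).symm
        · rw [f1, h1, add_sub_cancel_left, hcomb]
          congr 1
          match_scalars <;> linarith
        · rw [f1]
          simp [F]
      | 2 =>
        rw [Equiv.swap_apply_right, v1]
        have e3 : (2 * ca ^ 2 - 1) * sa + -(2 * sa * ca) * ca = -sa := by ring
        have e4 : -(2 * sa * ca) * sa - (2 * ca ^ 2 - 1) * ca = -ca := by
          linear_combination -2 * ca * hsc
        refine (sideForm_eq_aff T F (r := l * sa * ca) (by positivity) ?_ ?_ ?_).symm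
        · linear_combination 4 * ca ^ 2 * hsc
        · rw [f2, hcomb, e3, e4]
          module
        · rw [f2, hcomb, e3, e4]
          have e5 : F.base - (T.points 2 + (l * sa * ca) • (sa • e + ca • f))
              = (-(l * sa * ca * sa)) • e + (-(l * sa * ca * ca)) • f := by
            simp only [F]
            module
          rw [e5, hinner]
          simp only [F]
          linear_combination l * sa * ca * hsc
    · ext i j
      rw [BeltState.toSeed, F.seed_B, hA, hC, add_sub_cancel, Real.cos_pi_div_two,
        Real.cos_pi_div_two_sub, ← hsa, ← hca]
      fin_cases i <;> fin_cases j <;>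
        simp [initialSeed, skewMatrix, Equiv.swap_apply_of_ne_of_ne, hB, hB']

/-! ### From states to vertices of the exchange graph -/

namespace LabelledSeed

lemma translate_translate (w z : Plane) (s : LabelledSeed) :
    (s.translate z).translate w = s.translate (w + z) := by
  ext1
  · funext i
    exact AffineForm.translate_translate _ _ _
  · rfl

lemma translate_zero (s : LabelledSeed) : s.translate 0 = s := by
  ext1
  · funext i
    exact AffineForm.translate_zero _
  · rfl

lemma SameShape.relabel {s t : LabelledSeed} (h : SameShape s t) (τ : Equiv.Perm (Fin 3)) :
    SameShape (s.relabel τ) (t.relabel τ) where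
  angle i := by rw [interiorAngle_relabel, interiorAngle_relabel, h.angle]
  quiver := by
    have := congrArg Digraph.Adj h.quiver
    ext i j
    exact iff_of_eq (congrFun (congrFun this (τ i)) (τ j))
  orientation := by
    rw [orientation_relabel, orientation_relabel, sign_mul, sign_mul]
    exact congrArg _ h.orientation

lemma mk_relabel (s : LabelledSeed) (τ : Equiv.Perm (Fin 3)) :
    (⟦s.relabel τ⟧ : Seed) = ⟦s⟧ :=
  (Quotient.sound ⟨τ, rfl⟩ : (⟦s⟧ : Seed) = _).symm

lemma exists_relabel_eq {s t : LabelledSeed} (h : (⟦s⟧ : Seed) = ⟦t⟧) :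
    ∃ τ, s = t.relabel τ :=
  Quotient.exact h.symm

lemma mk_mutate_relabel (u : ReferencePoint) (k : Fin 3) (τ : Equiv.Perm (Fin 3))
    (s : LabelledSeed) : (⟦(s.relabel τ).mutate u k⟧ : Seed) = ⟦s.mutate u (τ k)⟧ := by
  rw [mutate_relabel, mk_relabel]

end LabelledSeed

section ExchangeGraph

variable {u : ReferencePoint} {s₀ : LabelledSeed}

lemma mk_mutate_mem_mutationClass {s : LabelledSeed} (h : ⟦s⟧ ∈ Seed.mutationClass u s₀)
    (k : Fin 3) : ⟦s.mutate u k⟧ ∈ Seed.mutationClass u s₀ := by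
  obtain ⟨t, ht, hts⟩ := h
  obtain ⟨τ, rfl⟩ := LabelledSeed.exists_relabel_eq hts.symm
  rw [LabelledSeed.mk_mutate_relabel]
  exact ⟨_, ht.tail ⟨τ k, rfl⟩, rfl⟩

lemma exchangeGraph_connected : (exchangeGraph u s₀).Connected := by
  have key : ∀ s : LabelledSeed,
      Relation.ReflTransGen (fun s t => ∃ k, t = LabelledSeed.mutate u k s) s₀ s →
      ∀ hs : ⟦s⟧ ∈ Seed.mutationClass u s₀,
        (exchangeGraph u s₀).Reachable (initialVertex u s₀) ⟨⟦s⟧, hs⟩ := by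
    intro s h
    induction h with
    | refl => exact fun _ => .refl _
    | @tail s t h hst ih =>
      obtain ⟨k, rfl⟩ := hst
      intro ht
      have hs : ⟦s⟧ ∈ Seed.mutationClass u s₀ := ⟨s, h, rfl⟩
      refine (ih hs).trans ?_
      by_cases he : (⟨⟦s⟧, hs⟩ : Seed.mutationClass u s₀) = ⟨⟦s.mutate u k⟧, ht⟩
      · rw [he]
      · exact SimpleGraph.Adj.reachable
          ((SimpleGraph.fromRel_adj _ _ _).2 ⟨he, Or.inl ⟨s, k, rfl, rfl⟩⟩)
  have key' : ∀ x, (exchangeGraph u s₀).Reachable (initialVertex u s₀) x := by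
    rintro ⟨_, s, hs, rfl⟩
    exact key s hs _
  exact (SimpleGraph.connected_iff _).2
    ⟨fun x y => (key' x).symm.trans (key' y), ⟨initialVertex u s₀⟩⟩

lemma exchangeGraph_adj_translate {F : BeltFrame} (hu : F.IsAdapted u) (w : ℝ)
    {x y x' y' : Seed.mutationClass u s₀} (hx : x'.1 = Seed.translate (w • F.dir) x.1)
    (hy : y'.1 = Seed.translate (w • F.dir) y.1) (h : (exchangeGraph u s₀).Adj x y) :
    (exchangeGraph u s₀).Adj x' y' := by
  have key : ∀ {x y x' y' : Seed.mutationClass u s₀}, x'.1 = Seed.translate (w • F.dir) x.1 →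
      y'.1 = Seed.translate (w • F.dir) y.1 →
      (∃ (s : LabelledSeed) (k : Fin 3), ⟦s⟧ = x.1 ∧ ⟦s.mutate u k⟧ = y.1) →
      ∃ (s : LabelledSeed) (k : Fin 3), ⟦s⟧ = x'.1 ∧ ⟦s.mutate u k⟧ = y'.1 := by
    rintro x y x' y' hx hy ⟨s, k, h1, h2⟩
    refine ⟨s.translate (w • F.dir), k, ?_, ?_⟩
    · rw [hx, ← h1]
      rfl
    · rw [LabelledSeed.mutate_translate hu, hy, ← h2]
      rfl
  rw [exchangeGraph, SimpleGraph.fromRel_adj] at h ⊢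
  refine ⟨fun he => h.1 (Subtype.ext ?_), h.2.imp (key hx hy) (key hy hx)⟩
  have := congrArg (Seed.translate (-(w • F.dir))) ((hx.symm.trans (congrArg _ he)).trans hy)
  simpa only [Seed.translate_translate, neg_add_cancel, Seed.translate_zero] using this

/-- Translations along the belt line that map the mutation class to itself belong to the
lattice. -/
lemma mem_translationLattice_of_mapsTo {F : BeltFrame} (hu : F.IsAdapted u) (w : ℝ)
    (h1 : ∀ x ∈ Seed.mutationClass u s₀,
      Seed.translate (w • F.dir) x ∈ Seed.mutationClass u s₀)
    (h2 : ∀ x ∈ Seed.mutationClass u s₀,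
      Seed.translate (-(w • F.dir)) x ∈ Seed.mutationClass u s₀) :
    w • F.dir ∈ translationLattice u s₀ := by
  let e : Seed.mutationClass u s₀ ≃ Seed.mutationClass u s₀ :=
    { toFun := fun x => ⟨_, h1 _ x.2⟩
      invFun := fun x => ⟨_, h2 _ x.2⟩
      left_inv := fun x => Subtype.ext (by
        simp only [Seed.translate_translate, neg_add_cancel, Seed.translate_zero])
      right_inv := fun x => Subtype.ext (by
        simp only [Seed.translate_translate, add_neg_cancel, Seed.translate_zero]) }
  refine ⟨⟨e, fun {x y} => ⟨fun h => ?_, exchangeGraph_adj_translate hu w rfl rfl⟩⟩, fun _ => rfl⟩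
  refine exchangeGraph_adj_translate hu (-w) (x' := x) (y' := y) ?_ ?_ h <;>
  · change _ = Seed.translate _ (Seed.translate _ _)
    rw [neg_smul, Seed.translate_translate, neg_add_cancel, Seed.translate_zero]

end ExchangeGraph

namespace BeltState

open LabelledSeed

variable {F : BeltFrame} {u : ReferencePoint} {n : ℕ} {D D' E : BeltState}

/-- The seed described by a state, up to the numbering of its sides. -/
def vertex (F : BeltFrame) (n : ℕ) (D : BeltState) : Seed := ⟦D.toSeed F n⟧

lemma vertex_shift (w : ℝ) :
    (D.shift w).vertex F n = Seed.translate ((F.scale * w) • F.dir) (D.vertex F n) := by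
  rw [vertex, toSeed_shift]
  rfl

lemma mk_mutate_toSeed (hu : F.IsAdapted u) (hn : 2 ≤ n) (h : D.Good n) (k : Fin 3) :
    (⟦(D.toSeed F n).mutate u k⟧ : Seed) = (D.step n k).vertex F n := by
  obtain ⟨τ, hτ⟩ := exists_mutate_relabel_eq hu hn h k
  rw [vertex, ← hτ, mk_relabel]

/-- Mutations of equivalent seeds can be undone. -/
lemma exists_mk_mutate_eq (hu : F.IsAdapted u) (hn : 2 ≤ n) (h : D.Good n) {s : LabelledSeed}
    {k : Fin 3} (hs : ⟦(D.toSeed F n).mutate u k⟧ = (⟦s⟧ : Seed)) :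
    ∃ j, (⟦s.mutate u j⟧ : Seed) = D.vertex F n := by
  obtain ⟨τ, rfl⟩ := exists_relabel_eq hs.symm
  refine ⟨τ.symm k, ?_⟩
  rw [mk_mutate_relabel, Equiv.apply_symm_apply, mutate_mutate_toSeed hu hn h, vertex]

variable {D₀ : BeltState} {s₀ : LabelledSeed}

/-- Links are reversible by definition, whereas undoing a step on states may lead to the second
state of a right triangle. On the level of seeds, mutation is an involution and membership passes
both ways. -/
lemma vertex_mem_iff_of_linked (hu : F.IsAdapted u) (hn : 2 ≤ n) (h : Linked n D D') :
    D.vertex F n ∈ Seed.mutationClass u s₀ ↔ D'.vertex F n ∈ Seed.mutationClass u s₀ := by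
  induction h with
  | rel D D' h =>
    obtain ⟨h, k, rfl⟩ := h
    refine ⟨fun hD => ?_, fun hD => ?_⟩
    · rw [← mk_mutate_toSeed hu hn h]
      exact mk_mutate_mem_mutationClass hD k
    · obtain ⟨j, hj⟩ := exists_mk_mutate_eq hu hn h (mk_mutate_toSeed hu hn h k)
      rw [← hj]
      exact mk_mutate_mem_mutationClass hD j
  | refl D => rfl
  | symm _ _ _ ih => exact ih.symm
  | trans _ _ _ _ _ ih ih' => exact ih.trans ih'

/-- The seeds in the mutation class are those of the states linked to the initial one. -/
lemma mem_mutationClass_iff (hu : F.IsAdapted u) (hn : 2 ≤ n) (h₀ : D₀.Good n)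
    (hs₀ : ⟦s₀⟧ = D₀.vertex F n) {x : Seed} :
    x ∈ Seed.mutationClass u s₀ ↔ ∃ D, Linked n D₀ D ∧ D.vertex F n = x := by
  constructor
  · rintro ⟨s, hs, rfl⟩
    induction hs with
    | refl => exact ⟨D₀, .refl _, hs₀.symm⟩
    | tail _ hst ih =>
      obtain ⟨k, rfl⟩ := hst
      obtain ⟨D, hD, hs⟩ := ih
      obtain ⟨τ, rfl⟩ := exists_relabel_eq hs.symm
      have hG := (Good.of_linked hn hD).1 h₀
      exact ⟨D.step n (τ k), hD.trans (.step hG _),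
        by rw [mk_mutate_relabel, mk_mutate_toSeed hu hn hG]⟩
  · rintro ⟨D, hD, rfl⟩
    rw [← vertex_mem_iff_of_linked hu hn hD, ← hs₀]
    exact (initialVertex u s₀).2

/-- A translation that maps one seed of the class to a seed of the class belongs to the lattice. -/
lemma mem_translationLattice (hu : F.IsAdapted u) (hn : 2 ≤ n) (h₀ : D₀.Good n)
    (hs₀ : ⟦s₀⟧ = D₀.vertex F n) (hD : Linked n D₀ D) (hE : Linked n D₀ E) {w : ℝ}
    (h : (D.shift w).vertex F n = E.vertex F n) :
    (F.scale * w) • F.dir ∈ translationLattice u s₀ := by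
  have hmem := @mem_mutationClass_iff F u n D₀ s₀ hu hn h₀ hs₀
  have key : ∀ {D E : BeltState} {w : ℝ}, Linked n D₀ D → Linked n D₀ E →
      (D.shift w).vertex F n = E.vertex F n → ∀ x ∈ Seed.mutationClass u s₀,
        Seed.translate ((F.scale * w) • F.dir) x ∈ Seed.mutationClass u s₀ := by
    intro D E w hD hE h x hx
    obtain ⟨D', hD', rfl⟩ := hmem.1 hx
    -- Shifting the whole chain of mutations from `D'` to `D` reduces the claim to `D`, whose
    -- translate is the seed of `E`.
    rw [← vertex_shift, vertex_mem_iff_of_linked hu hn ((hD'.symm.trans hD).shift w), h]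
    exact hmem.2 ⟨E, hE, rfl⟩
  refine mem_translationLattice_of_mapsTo hu _ (key hD hE h) ?_
  have h' : (E.shift (-w)).vertex F n = D.vertex F n := by
    rw [vertex_shift, ← h, vertex_shift, Seed.translate_translate, ← add_smul, mul_neg,
      neg_add_cancel, zero_smul, Seed.translate_zero]
  have := key hE hD h'
  rwa [mul_neg, neg_smul] at this

/-- Seeds of equal shape differ by a translation along the belt line. -/
lemma translate_mk_eq (hn : 2 ≤ n) (h : D.Good n) (h' : D'.Good n) {s t : LabelledSeed}
    (hs : D.vertex F n = ⟦s⟧) (ht : D'.vertex F n = ⟦t⟧) (hst : SameShape t s) :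
    (D.shift (D'.p - D.p)).vertex F n = D'.vertex F n := by
  obtain ⟨τ, rfl⟩ := exists_relabel_eq hs.symm
  obtain ⟨σ, rfl⟩ := exists_relabel_eq ht.symm
  have h1 := hst.relabel τ⁻¹
  rw [relabel_relabel, relabel_relabel, mul_inv_cancel, relabel_one] at h1
  rw [vertex, ← relabel_toSeed_eq hn h h' h1, mk_relabel, vertex]

/-- Translations that relate seeds of states are translations along the belt line. -/
lemma eq_smul_dir_of_translate_eq (hn : 2 ≤ n) (h : D.Good n) (h' : D'.Good n) {v : Plane}
    (hv : Seed.translate v (D.vertex F n) = D'.vertex F n) :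
    v = (F.scale * (D'.p - D.p)) • F.dir := by
  obtain ⟨τ, hτ⟩ := exists_relabel_eq (s := (D.toSeed F n).translate v) hv
  -- A plane translation keeps angles, quiver and orientation, so the two seeds also differ by a
  -- translation along the belt line; `translate_toSeed_injective` then shows that both vectors
  -- agree.
  have h1 := relabel_toSeed_eq hn h h' (τ := τ) (F := F)
    (by rw [← hτ]; exact ⟨fun _ => rfl, rfl, rfl⟩)
  rw [← hτ, toSeed_shift] at h1
  have h2 := congrArg (LabelledSeed.translate (-((F.scale * (D'.p - D.p)) • F.dir))) h1
  rw [LabelledSeed.translate_translate, LabelledSeed.translate_translate, neg_add_cancel,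
    LabelledSeed.translate_zero] at h2
  exact (neg_add_eq_zero.1 (translate_toSeed_injective hn h h2)).symm

end BeltState

/-! ### The action of the lattice and its rank -/

namespace BeltState

open LabelledSeed

variable {F : BeltFrame} {u : ReferencePoint} {n : ℕ} {D₀ : BeltState} {s₀ : LabelledSeed}

/-- Vertices of the exchange graph with the same angles, quiver and orientation lie in the same
orbit of the lattice. -/
lemma exists_vadd_eq (hu : F.IsAdapted u) (hn : 2 ≤ n) (h₀ : D₀.Good n)
    (hs₀ : ⟦s₀⟧ = D₀.vertex F n) {x y : Seed.mutationClass u s₀} {s t : LabelledSeed}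
    (hs : ⟦s⟧ = x.1) (ht : ⟦t⟧ = y.1) (hst : SameShape t s) :
    ∃ w : translationLattice u s₀, w +ᵥ x = y := by
  obtain ⟨D, hD, hDx⟩ := (mem_mutationClass_iff hu hn h₀ hs₀).1 x.2
  obtain ⟨E, hE, hEy⟩ := (mem_mutationClass_iff hu hn h₀ hs₀).1 y.2
  have h := translate_mk_eq hn ((Good.of_linked hn hD).1 h₀) ((Good.of_linked hn hE).1 h₀)
    (hDx.trans hs.symm) (hEy.trans ht.symm) hst
  refine ⟨⟨_, mem_translationLattice hu hn h₀ hs₀ hD hE h⟩, Subtype.ext ?_⟩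
  change Seed.translate _ x.1 = y.1
  rw [← hDx, ← vertex_shift, h, hEy]

/-- The belt coordinates of the translations in the lattice. -/
def beltLattice (F : BeltFrame) (u : ReferencePoint) (s₀ : LabelledSeed) : AddSubgroup ℝ :=
  (translationLattice u s₀).comap
    { toFun := fun c => (F.scale * c) • F.dir
      map_zero' := by simp
      map_add' := fun c d => by rw [mul_add, add_smul] }

lemma mem_beltLattice {c : ℝ} :
    c ∈ beltLattice F u s₀ ↔ (F.scale * c) • F.dir ∈ translationLattice u s₀ := Iff.rfl

/-- A lattice vector is read off from the image of the initial vertex, so its belt coordinate is a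
displacement between linked states. -/
lemma exists_linked_of_mem_translationLattice (hu : F.IsAdapted u) (hn : 2 ≤ n) (h₀ : D₀.Good n)
    (hs₀ : ⟦s₀⟧ = D₀.vertex F n) {v : Plane} (hv : v ∈ translationLattice u s₀) :
    ∃ D, Linked n D₀ D ∧ v = (F.scale * (D.p - D₀.p)) • F.dir := by
  obtain ⟨D, hD, hDv⟩ := (mem_mutationClass_iff hu hn h₀ hs₀).1
    (translate_mem_mutationClass hv (initialVertex u s₀).2)
  refine ⟨D, hD, eq_smul_dir_of_translate_eq hn h₀ ((Good.of_linked hn hD).1 h₀) ?_⟩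
  rw [hDv, ← hs₀]
  rfl

lemma dir_ne_zero : F.dir ≠ 0 := by
  intro h
  have := F.dir_dir
  simp [h] at this

lemma smul_dir_injective : Function.Injective fun c : ℝ => (F.scale * c) • F.dir := fun _ _ h =>
  mul_left_cancel₀ F.scale_pos.ne' (smul_left_injective ℝ dir_ne_zero h)

lemma mem_realCyclotomic_of_mem_beltLattice (hu : F.IsAdapted u) (hn : 2 ≤ n) (h₀ : D₀.Good n)
    (hs₀ : ⟦s₀⟧ = D₀.vertex F n) {c : ℝ} (hc : c ∈ beltLattice F u s₀) :
    c ∈ realCyclotomic n := by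
  obtain ⟨D, hD, h⟩ := exists_linked_of_mem_translationLattice hu hn h₀ hs₀ hc
  rw [smul_dir_injective h]
  exact sub_mem_realCyclotomic hn hD

lemma shiftGroup_le_beltLattice (hu : F.IsAdapted u) (hn : 2 ≤ n) (h₀ : D₀.Good n)
    (hs₀ : ⟦s₀⟧ = D₀.vertex F n) : shiftGroup n D₀ ≤ beltLattice F u s₀ := fun _ hw =>
  mem_translationLattice hu hn h₀ hs₀ (.refl _) hw rfl

/-- The lattice of translations is isomorphic to the group of its belt coordinates. -/
def beltLatticeEquiv (hu : F.IsAdapted u) (hn : 2 ≤ n) (h₀ : D₀.Good n)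
    (hs₀ : ⟦s₀⟧ = D₀.vertex F n) : beltLattice F u s₀ ≃+ translationLattice u s₀ :=
  AddEquiv.ofBijective (AddMonoidHom.addSubgroupComap _ _) ⟨fun _ _ h =>
    Subtype.ext (smul_dir_injective (congrArg Subtype.val h)), fun ⟨v, hv⟩ => by
      obtain ⟨D, -, h⟩ := exists_linked_of_mem_translationLattice hu hn h₀ hs₀ hv
      exact ⟨⟨D.p - D₀.p, mem_beltLattice.2 (h ▸ hv)⟩, Subtype.ext h.symm⟩⟩

/-- Adjacency is symmetrised, so a neighbour may arise as a mutation of x or have x as a mutation.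
In the second case mutating back shows that it is also one of the three mutations of x. -/
lemma finite_neighborSet (hu : F.IsAdapted u) (hn : 2 ≤ n) (h₀ : D₀.Good n)
    (hs₀ : ⟦s₀⟧ = D₀.vertex F n) (x : Seed.mutationClass u s₀) :
    ((exchangeGraph u s₀).neighborSet x).Finite := by
  obtain ⟨D, hD, hDx⟩ := (mem_mutationClass_iff hu hn h₀ hs₀).1 x.2
  refine ((Set.finite_range fun k => (⟦(D.toSeed F n).mutate u k⟧ : Seed)).preimage
    Subtype.val_injective.injOn).subset fun y hy => ?_
  rw [SimpleGraph.mem_neighborSet, exchangeGraph] at hy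
  rcases ((SimpleGraph.fromRel_adj _ _ _).1 hy).2 with ⟨s, k, hs, hk⟩ | ⟨s, k, hs, hk⟩
  · obtain ⟨τ, rfl⟩ := exists_relabel_eq (hs.trans hDx.symm)
    exact ⟨τ k, by rw [← hk, mk_mutate_relabel]⟩
  · obtain ⟨E, hE, hEy⟩ := (mem_mutationClass_iff hu hn h₀ hs₀).1 y.2
    obtain ⟨τ, rfl⟩ := exists_relabel_eq (hs.trans hEy.symm)
    rw [mk_mutate_relabel, ← hDx] at hk
    obtain ⟨j, hj⟩ := exists_mk_mutate_eq hu hn ((Good.of_linked hn hE).1 h₀) hk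
    exact ⟨j, hj.trans hEy⟩

/-- The lattice acts cocompactly, since there are only finitely many shapes. -/
lemma exists_isGeometricAction (hu : F.IsAdapted u) (hn : 2 ≤ n) (h₀ : D₀.Good n)
    (hs₀ : ⟦s₀⟧ = D₀.vertex F n) :
    ∃ c, SimpleGraph.IsGeometricAction (translationLattice u s₀) (exchangeGraph u s₀)
      (initialVertex u s₀) c := by
  have hadj : ∀ (g : translationLattice u s₀) x y, (exchangeGraph u s₀).Adj x y →
      (exchangeGraph u s₀).Adj (g +ᵥ x) (g +ᵥ y) := by
    rintro ⟨g, φ, hφ⟩ x y h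
    have e : ∀ x, (⟨g, φ, hφ⟩ : translationLattice u s₀) +ᵥ x = φ x :=
      fun x => Subtype.ext (hφ x).symm
    rw [e, e]
    exact φ.map_rel_iff.2 h
  have hx : ∀ x : Seed.mutationClass u s₀, ∃ D, Linked n D₀ D ∧ D.vertex F n = x.1 :=
    fun x => (mem_mutationClass_iff hu hn h₀ hs₀).1 x.2
  choose state hlink hstate using hx
  -- Both angles are at most n, so reduction modulo n + 1 loses nothing and the shapes form a finite
  -- set.
  let shape : Seed.mutationClass u s₀ → Fin (n + 1) × Fin (n + 1) × ℤˣ := fun x =>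
    (Fin.ofNat _ (state x).A, Fin.ofNat _ (state x).C, (state x).s)
  have hshape : ∀ x y, shape x = shape y → ∃ w : translationLattice u s₀, w +ᵥ x = y := by
    intro x y h
    have gx := (Good.of_linked hn (hlink x)).1 h₀
    have gy := (Good.of_linked hn (hlink y)).1 h₀
    simp only [shape, Prod.mk.injEq, Fin.ext_iff, Fin.val_ofNat,
      Nat.mod_eq_of_lt (Nat.lt_succ_of_le gx.le), Nat.mod_eq_of_lt (Nat.lt_succ_of_le gx.le'),
      Nat.mod_eq_of_lt (Nat.lt_succ_of_le gy.le), Nat.mod_eq_of_lt (Nat.lt_succ_of_le gy.le')] at h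
    have e : (state x).shift ((state y).p - (state x).p) = state y := by
      ext
      · exact h.1
      · exact h.2.1
      · exact congrArg Units.val h.2.2
      · exact add_sub_cancel _ _
    have e' : ((state x).shift ((state y).p - (state x).p)).vertex F n = (state y).vertex F n := by
      rw [e]
    refine ⟨⟨_, mem_translationLattice hu hn h₀ hs₀ (hlink x) (hlink y) e'⟩, Subtype.ext ?_⟩
    change Seed.translate _ x.1 = y.1
    rw [← hstate x, ← vertex_shift, e', hstate y]
  have hG : (exchangeGraph u s₀).Connected := exchangeGraph_connected
  -- One vertex is chosen for each shape that occurs. The largest distance from these to the initial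
  -- vertex serves as the cobounding radius.
  obtain ⟨c, hc⟩ := (Set.finite_range fun t : Set.range shape =>
    (exchangeGraph u s₀).dist t.2.choose (initialVertex u s₀)).bddAbove
  refine ⟨c, hG, hadj, finite_neighborSet hu hn h₀ hs₀, fun g g' h => ?_, fun x => ?_⟩
  · have h1 := congrArg (fun x => Seed.translate (-g'.1) x.1) h
    change Seed.translate _ (Seed.translate _ ⟦s₀⟧) = Seed.translate _ (Seed.translate _ ⟦s₀⟧) at h1
    rw [Seed.translate_translate, Seed.translate_translate, neg_add_cancel, Seed.translate_zero,
      hs₀] at h1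
    have h2 := eq_smul_dir_of_translate_eq hn h₀ h₀ h1
    rw [sub_self, mul_zero, zero_smul] at h2
    exact Subtype.ext (neg_add_eq_zero.1 h2).symm
  · let t : Set.range shape := ⟨shape x, x, rfl⟩
    obtain ⟨w, hw⟩ := hshape _ _ t.2.choose_spec
    refine ⟨w, ?_⟩
    rw [← hw, SimpleGraph.dist_vadd hG hadj]
    exact hc ⟨t, rfl⟩

lemma orientation_ne_zero (hn : 2 ≤ n) {D : BeltState} (h : D.Good n) {s : LabelledSeed}
    (hs : D.vertex F n = ⟦s⟧) : s.orientation ≠ 0 := by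
  obtain ⟨τ, rfl⟩ := exists_relabel_eq hs.symm
  rw [orientation_toSeed_relabel hn h]
  exact sign_ne_zero.2 (mul_ne_zero (by simp) (neg_ne_zero.2 F.cross_ne_zero))

/-- Finite generation comes from the geometric action and is needed first, since the upper bound on
the rank uses a finite ℤ-basis. The rank is then computed on the belt coordinates, a group of real
numbers. -/
lemma finite_and_finrank_translationLattice (hu : F.IsAdapted u) (hn : 2 ≤ n) (h₀ : D₀.Good n)
    (hD₀ : Nat.gcd D₀.A D₀.C = 1) (hs₀ : ⟦s₀⟧ = D₀.vertex F n) :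
    Module.Finite ℤ (translationLattice u s₀) ∧
      Module.finrank ℤ (translationLattice u s₀) = Nat.totient (2 * n) / 2 := by
  obtain ⟨c, hc⟩ := exists_isGeometricAction hu hn h₀ hs₀
  have hfin : Module.Finite ℤ (translationLattice u s₀) := Module.Finite.iff_addGroup_fg.2 hc.fg
  let e : beltLattice F u s₀ ≃ₗ[ℤ] translationLattice u s₀ :=
    (beltLatticeEquiv hu hn h₀ hs₀).toIntLinearEquiv
  have := Module.Finite.equiv e.symm
  refine ⟨hfin, ?_⟩
  rw [← e.finrank_eq]
  exact finrank_eq_totient_div_two hn _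
    (fun w hw => mem_realCyclotomic_of_mem_beltLattice hu hn h₀ hs₀ hw) fun g hg =>
      shiftGroup_le_beltLattice hu hn h₀ hs₀ (inv_sin_sq_mem_shiftGroup hn h₀ hD₀
        (pos_of_mem_halfUnits hg) (mem_halfUnits.1 hg).1 (mem_halfUnits.1 hg).2)

end BeltState

end

/-! ### The theorem -/

theorem theorem6p1 (n : ℕ) (hn : 2 ≤ n) (T : Affine.Triangle ℝ Plane)
    (h₁ : ∠ (T.points 1) (T.points 0) (T.points 2) = Real.pi / (2 * n))
    (h₂ : ∠ (T.points 0) (T.points 1) (T.points 2) = (n - 1) * (Real.pi / (2 * n)))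
    (h₃ : ∠ (T.points 0) (T.points 2) (T.points 1) = n * (Real.pi / (2 * n)))
    (u : ReferencePoint) (hu : u = initialReferencePoint T)
    (s₀ : LabelledSeed) (hs₀ : s₀ = initialSeed n T) :
    (∀ m : Fin 3 → ℕ, m 0 + m 1 + m 2 = 2 * n → Finset.univ.gcd m = 1 →
      ∀ Q : Digraph (Fin 3),
        ((fun x => (Quotient.mk _ x :
            AddAction.orbitRel.Quotient (translationLattice u s₀) (Seed.mutationClass u s₀))) ''
          {x | ∃ ε, x.1.IsOfType (Real.pi / (2 * n)) m Q ε}).encard ≤ 2 ∧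
        (∀ (x : Seed.mutationClass u s₀) (ε : SignType),
          x.1.IsOfType (Real.pi / (2 * n)) m Q ε → ε = 1 ∨ ε = -1) ∧
        ∀ (ε : SignType) (x y : Seed.mutationClass u s₀),
          x.1.IsOfType (Real.pi / (2 * n)) m Q ε → y.1.IsOfType (Real.pi / (2 * n)) m Q ε →
            ∃ w : translationLattice u s₀, w +ᵥ x = y) ∧
    (Module.Finite ℤ (translationLattice u s₀) ∧
      (Module.finrank ℤ (translationLattice u s₀) = Nat.totient (2 * n) / 2 ∨
        Module.finrank ℤ (translationLattice u s₀) = Nat.totient (2 * n))) ∧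
    (∀ S : Set (translationLattice u s₀), S.Finite → S = -S → 0 ∉ S →
      AddSubgroup.closure S = ⊤ →
        IsQuasiIsometry (graphDist (SimpleGraph.addCayley S)) (graphDist (exchangeGraph u s₀))
          (fun w => w +ᵥ initialVertex u s₀)) := by
  subst hu hs₀
  obtain ⟨F, hF, hT⟩ := exists_frame_initialSeed hn T h₁ h₃
  have h₀ := initialState_good hn
  have hs₀ : ⟦initialSeed n T⟧ = (initialState n).vertex F n := by
    rw [hT, LabelledSeed.mk_relabel, BeltState.vertex]
  obtain ⟨c, hc⟩ := BeltState.exists_isGeometricAction hF hn h₀ hs₀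
  obtain ⟨hfin, hrank⟩ := BeltState.finite_and_finrank_translationLattice hF hn h₀
    (Nat.gcd_one_left _) hs₀
  refine ⟨fun m _ _ Q => ?_, ⟨hfin, Or.inl hrank⟩, fun S hS _ _ hS' => hc.isQuasiIsometry hS hS'⟩
  have hor : ∀ (x : Seed.mutationClass (initialReferencePoint T) (initialSeed n T))
      (ε : SignType), x.1.IsOfType (Real.pi / (2 * n)) m Q ε → ε = 1 ∨ ε = -1 := by
    rintro x ε ⟨s, hs, -, -, -, rfl⟩
    obtain ⟨D, hD, hDx⟩ := (BeltState.mem_mutationClass_iff hF hn h₀ hs₀).1 x.2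
    have h := BeltState.orientation_ne_zero hn ((BeltState.Good.of_linked hn hD).1 h₀)
      (hDx.trans hs.symm)
    generalize s.orientation = ε at h
    revert ε
    decide
  have htrans : ∀ (ε : SignType)
      (x y : Seed.mutationClass (initialReferencePoint T) (initialSeed n T)),
      x.1.IsOfType (Real.pi / (2 * n)) m Q ε → y.1.IsOfType (Real.pi / (2 * n)) m Q ε →
        ∃ w : translationLattice (initialReferencePoint T) (initialSeed n T), w +ᵥ x = y := by
    rintro ε x y ⟨s, hs, -, hsa, hsq, hso⟩ ⟨t, ht, -, hta, htq, hto⟩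
    exact BeltState.exists_vadd_eq hF hn h₀ hs₀ hs ht
      ⟨fun i => (hta i).trans (hsa i).symm, htq.trans hsq.symm, hto.trans hso.symm⟩
  refine ⟨?_, hor, htrans⟩
  set π := fun x => (Quotient.mk _ x : AddAction.orbitRel.Quotient
    (translationLattice (initialReferencePoint T) (initialSeed n T))
    (Seed.mutationClass (initialReferencePoint T) (initialSeed n T)))
  have hone : ∀ ε, (π '' {x | x.1.IsOfType (Real.pi / (2 * n)) m Q ε}).encard ≤ 1 := by
    intro ε
    rw [Set.encard_le_one_iff]
    rintro _ _ ⟨x, hx, rfl⟩ ⟨y, hy, rfl⟩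
    obtain ⟨w, hw⟩ := htrans ε y x hy hx
    exact Quotient.sound ⟨w, hw⟩
  -- Orientation 0 does not occur, and each of the two others contributes at most one orbit.
  calc _ ≤ (π '' {x | x.1.IsOfType (Real.pi / (2 * n)) m Q 1} ∪
        π '' {x | x.1.IsOfType (Real.pi / (2 * n)) m Q (-1)}).encard := by
        refine Set.encard_le_encard ?_
        rintro _ ⟨x, ⟨ε, hx⟩, rfl⟩
        rcases hor x ε hx with rfl | rfl
        · exact Or.inl ⟨x, hx, rfl⟩
        · exact Or.inr ⟨x, hx, rfl⟩
    _ ≤ 1 + 1 := (Set.encard_union_le _ _).trans (add_le_add (hone 1) (hone (-1)))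
    _ = 2 := one_add_one_eq_two
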